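/- Let $\Bbbk$ be a field and $R=\Bbbk[x_1,\dots,x_n]$ with its $\mathbb Z^n$-grading; multidegrees are written as monomials, and $[\,\cdot\,]$ denotes least common multiple. For a bihomogeneous element $f$ write $|f|$ for its homological degree and $m_f$ for its multidegree. A *DG algebra* over $R$ is a complex $A$ of finitely generated multigraded free $R$-modules in nonnegative homological degrees (with bihomogeneous bases whose multidegrees are monomials of $R$), with a unitary associative $R$-bilinear product respecting both gradings, such that $\partial(ab)=\partial(a)b+(-1)^{|a|}a\,\partial(b)$, $ab=(-1)^{|a||b|}ba$, and $a^2=0$ if $|a|$ is odd. It is a *DG $\Gamma$-algebra* if every bihomogeneous $x\in A$ of even positive homological degree has divided powers $x^{(i)}\in A$, $i\ge 0$, such that (for $x$, $y$ bihomogeneous, and whenever the divided powers that occur are of elements of even positive degree) $x^{(0)}=1$, $x^{(1)}=x$, $x^{(i)}$ is bihomogeneous of homological degree $i|x|$ and multidegree $m_x^i$; $x^{(h)}x^{(i)}=\binom{h+i}{h}x^{(h+i)}$; $(x+y)^{(i)}=\sum_{a+b=i}x^{(a)}y^{(b)}$ if $x,y$ have the same bidegree; for $i\ge2$, $(xy)^{(i)}=0$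 if $|x|,|y|$ are odd and $(xy)^{(i)}=x^iy^{(i)}$ if $|x|$ is even and $|y|$ is even and positive; $(x^{(h)})^{(i)}=\frac{(hi)!}{i!(h!)^i}x^{(hi)}$ for $h\geq 1$; and $\partial(x^{(i)})=x^{(i-1)}\partial(x)$ for $i\ge1$. A map of DG $\Gamma$-algebras is an $R$-linear map that respects the bigrading, differential, unit, product and divided powers. Let $I_1,\dots,I_r$ be monomial ideals of $R$, and for each $i$ let $F_i$ be a DG $\Gamma$-algebra whose underlying complex is a resolution of $R/I_i$. The generalized Taylor resolution $F_1*\cdots*F_r$ is the following complex with product. Its underlying module is $F_1\otimes_R\cdots\otimes_RF_r$, free on the tensors $a_1*\cdots*a_r$ of elements of bihomogeneous bases of the $F_i$, where $a_1*\cdots*a_r$ has homological degree $\sum|a_i|$ and multidegree $[m_{a_1},\dots,m_{a_r}]$. For bihomogeneous $f_i=\sum_{j}\alpha_{i,j}\frac{m_{f_i}}{m_{a_{i,j}}}a_{i,j}$ with $\alpha_{i,j}\in\Bbbk$ and basis elements $a_{i,j}$, put $$f_1*\cdots*f_r=\sum_{j_1,\dots,j_r}\alpha_{1,j_1}\cdots\alpha_{r,j_r}\frac{[m_{f_1},\dots,m_{f_r}]}{[m_{a_{1,j_1}},\dots,m_{a_{r,j_r}}]}\,a_{1,j_1}*\cdots*a_{r,j_r},$$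 an element of multidegree $[m_{f_1},\dots,m_{f_r}]$. For basis elements $f_i$, $f_i'$ of $F_i$, if $\partial f_i=\sum_j\alpha_{i,j}\frac{m_{f_i}}{m_{a_{i,j}}}a_{i,j}$ and $f_if_i'=\sum_j\beta_{i,j}\frac{m_{f_i}m_{f_i'}}{m_{a_{i,j}}}a_{i,j}$ with $\alpha_{i,j},\beta_{i,j}\in\Bbbk$, then $$\partial(f_1*\cdots*f_r)=\sum_{i}(-1)^{|f_1|+\cdots+|f_{i-1}|}\sum_j\alpha_{i,j}\frac{[m_{f_1},\dots,m_{f_r}]}{[m_{f_1},\dots,m_{a_{i,j}},\dots,m_{f_r}]}f_1*\cdots*a_{i,j}*\cdots*f_r,$$ $$(f_1*\cdots*f_r)(f_1'*\cdots*f_r')=(-1)^{\sum_i|f_i'|\sum_{j>i}|f_j|}\sum_{j_1,\dots,j_r}\beta_{1,j_1}\cdots\beta_{r,j_r}\frac{[m_{f_1},\dots,m_{f_r}][m_{f_1'},\dots,m_{f_r'}]}{[m_{a_{1,j_1}},\dots,m_{a_{r,j_r}}]}a_{1,j_1}*\cdots*a_{r,j_r},$$ and both are extended $R$-linearly; the unit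 is $1*\cdots*1$. **Theorem.** With this differential and product, $F_1*\cdots*F_r$ is a DG algebra, and it has divided powers making it a DG $\Gamma$-algebra such that, for all bihomogeneous $f_1\in F_1,\dots,f_r\in F_r$ with $|f_1|+\cdots+|f_r|$ even and positive: - if some $|f_k|$ is odd, then $(f_1*\cdots*f_r)^{(i)}=0$ for all $i\ge2$; - if all $|f_k|$ are even and $j$ is the smallest index with $|f_j|>0$, then for all $i\geq 0$ $$(f_1*\cdots*f_r)^{(i)}=f_1^i*\cdots*f_{j-1}^i*f_j^{(i)}*f_{j+1}^i*\cdots*f_r^i .$$ For these divided powers the inclusions $F_l\to F_1*\cdots*F_r$, $f\mapsto1*\cdots*1*f*1*\cdots*1$, are maps of DG $\Gamma$-algebras for all $l$. Moreover they are the only divided powers on the DG algebra $F_1*\cdots*F_r$ that make it a DG $\Gamma$-algebra for which all these inclusions are maps of DG $\Gamma$-algebras. -/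

import Mathlib

universe u v

noncomputable section

namespace GenTaylor

/-- The polynomial ring `R = k[x_1, …, x_n]`. Monomials of `R` are identified with their exponent
vectors `m : Fin n →₀ ℕ`; divisibility is `≤`, the product is `+`, the `i`-th power is `i • m` and
the least common multiple is the supremum. -/
abbrev Poly (k : Type v) [Field k] (n : ℕ) : Type v := MvPolynomial (Fin n) k

/-- An ideal of `R` generated by monomials. -/
def IsMonomialIdeal {k : Type v} [Field k] {n : ℕ} (I : Ideal (Poly k n)) : Prop :=
  ∃ S : Set (Fin n →₀ ℕ), I = Ideal.span ((fun m => MvPolynomial.monomial m (1 : k)) '' S)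

/-- The underlying data of a multigraded DG algebra whose underlying module is free over
`R = k[x_1, …, x_n]`: the index set `B` of a bihomogeneous basis, the homological degree and the
multidegree of each basis element, a differential, a product and a unit on the free module
`B →₀ R`. The axioms are in `DGData.IsDGAlgebra`. -/
structure DGData (k : Type v) [Field k] (n : ℕ) where
  B : Type u
  hdeg : B → ℕ
  mdeg : B → (Fin n →₀ ℕ)
  d : (B →₀ Poly k n) →ₗ[Poly k n] (B →₀ Poly k n)
  mul : (B →₀ Poly k n) →ₗ[Poly k n] (B →₀ Poly k n) →ₗ[Poly k n] (B →₀ Poly k n)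
  one : B →₀ Poly k n

namespace DGData

variable {k : Type v} [Field k] {n : ℕ}

/-- The underlying free module, all homological degrees together. -/
abbrev Carrier (A : DGData.{u, v} k n) : Type (max u v) := A.B →₀ Poly k n

/-- The basis element with index `b`. -/
def basisElt (A : DGData.{u, v} k n) (b : A.B) : A.Carrier := Finsupp.single b 1

/-- The component `A_p` of homological degree `p`. -/
def part (A : DGData.{u, v} k n) (p : ℕ) : Submodule (Poly k n) A.Carrier :=
  Finsupp.supported (Poly k n) (Poly k n) {b | A.hdeg b = p}

/-- `x` is bihomogeneous of homological degree `p` and multidegree `m`: it is a combination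
of basis elements `b` of homological degree `p` whose multidegree divides `m`, with coefficients
`c • (m / mdeg b)`, `c ∈ k`. The zero element is bihomogeneous of every bidegree. -/
def Bihom (A : DGData.{u, v} k n) (p : ℕ) (m : Fin n →₀ ℕ) (x : A.Carrier) : Prop :=
  ∀ b, x b ≠ 0 → A.hdeg b = p ∧ A.mdeg b ≤ m ∧
    ∃ c : k, x b = MvPolynomial.monomial (m - A.mdeg b) c

/-- The power `x ^ i` for the product of `A`. -/
def pow (A : DGData.{u, v} k n) (x : A.Carrier) : ℕ → A.Carrier
  | 0 => A.one
  | i + 1 => A.mul x (A.pow x i)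

/-- The axioms of a DG algebra over `R`: a complex of finitely generated multigraded free modules
in nonnegative homological degrees, with a unitary associative product respecting both gradings,
the Leibniz rule, and strict graded commutativity. -/
structure IsDGAlgebra (A : DGData.{u, v} k n) : Prop where
  finite_part : ∀ p, {b | A.hdeg b = p}.Finite
  d_bihom : ∀ p m x, A.Bihom (p + 1) m x → A.Bihom p m (A.d x)
  d_zero : ∀ x ∈ A.part 0, A.d x = 0
  d_d : ∀ x, A.d (A.d x) = 0
  one_bihom : A.Bihom 0 0 A.one
  mul_bihom : ∀ p q m m' x y, A.Bihom p m x → A.Bihom q m' y →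
    A.Bihom (p + q) (m + m') (A.mul x y)
  one_mul : ∀ x, A.mul A.one x = x
  mul_one : ∀ x, A.mul x A.one = x
  mul_assoc : ∀ x y z, A.mul (A.mul x y) z = A.mul x (A.mul y z)
  leibniz : ∀ p, ∀ x ∈ A.part p, ∀ y,
    A.d (A.mul x y) = A.mul (A.d x) y + (-1 : Poly k n) ^ p • A.mul x (A.d y)
  mul_comm : ∀ p q, ∀ x ∈ A.part p, ∀ y ∈ A.part q,
    A.mul x y = (-1 : Poly k n) ^ (p * q) • A.mul y x
  sq_zero : ∀ p, Odd p → ∀ x ∈ A.part p, A.mul x x = 0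

/-- `γ` is a system of divided powers on `A`, where `γ i x` is `x^{(i)}`. Only the values at
bihomogeneous elements of even positive homological degree are constrained. -/
structure IsDividedPowers (A : DGData.{u, v} k n) (γ : ℕ → A.Carrier → A.Carrier) : Prop where
  zero : ∀ p m x, A.Bihom p m x → Even p → 0 < p → γ 0 x = A.one
  one : ∀ p m x, A.Bihom p m x → Even p → 0 < p → γ 1 x = x
  bihom : ∀ p m x, A.Bihom p m x → Even p → 0 < p → ∀ i, A.Bihom (i * p) (i • m) (γ i x)
  mul : ∀ p m x, A.Bihom p m x → Even p → 0 < p →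
    ∀ h i, A.mul (γ h x) (γ i x) = (h + i).choose h • γ (h + i) x
  add : ∀ p m x y, A.Bihom p m x → A.Bihom p m y → Even p → 0 < p →
    ∀ i, γ i (x + y) = ∑ j ∈ Finset.range (i + 1), A.mul (γ j x) (γ (i - j) y)
  mul_odd : ∀ p q m m' x y, A.Bihom p m x → A.Bihom q m' y → Odd p → Odd q →
    ∀ i, 2 ≤ i → γ i (A.mul x y) = 0
  mul_even : ∀ p q m m' x y, A.Bihom p m x → A.Bihom q m' y → Even p → Even q → 0 < q →
    ∀ i, 2 ≤ i → γ i (A.mul x y) = A.mul (A.pow x i) (γ i y)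
  comp : ∀ p m x, A.Bihom p m x → Even p → 0 < p → ∀ h i, 1 ≤ h →
    γ i (γ h x) =
      ((h * i).factorial / (i.factorial * h.factorial ^ i)) • γ (h * i) x
  d_succ : ∀ p m x, A.Bihom p m x → Even p → 0 < p →
    ∀ i, A.d (γ (i + 1) x) = A.mul (γ i x) (A.d x)

/-- `A` with divided powers `γ` is a DG `Γ`-algebra. -/
structure IsDGGammaAlgebra (A : DGData.{u, v} k n) (γ : ℕ → A.Carrier → A.Carrier) : Prop where
  isDGAlgebra : A.IsDGAlgebra
  isDividedPowers : A.IsDividedPowers γ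

/-- The complex of `A` is a resolution of `R / I`: it is exact in positive homological degrees,
and some surjection `A_0 → R / I` has kernel `∂ A_1`. -/
def IsResolution (A : DGData.{u, v} k n) (I : Ideal (Poly k n)) : Prop :=
  (∀ p, ∀ x ∈ A.part (p + 1), A.d x = 0 → ∃ y ∈ A.part (p + 2), A.d y = x) ∧
  ∃ ε : A.part 0 →ₗ[Poly k n] (Poly k n ⧸ I), Function.Surjective ε ∧
    ∀ x : A.part 0, ε x = 0 ↔ ∃ y ∈ A.part 1, A.d y = (x : A.Carrier)

/-- Maps of DG `Γ`-algebras: `R`-linear maps that respect the bigrading, the differential, the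
unit, the product and the divided powers. -/
structure IsDGGammaHom (A A' : DGData.{u, v} k n) (γ : ℕ → A.Carrier → A.Carrier)
    (γ' : ℕ → A'.Carrier → A'.Carrier) (φ : A.Carrier →ₗ[Poly k n] A'.Carrier) : Prop where
  bihom : ∀ p m x, A.Bihom p m x → A'.Bihom p m (φ x)
  d : ∀ x, φ (A.d x) = A'.d (φ x)
  one : φ A.one = A'.one
  mul : ∀ x y, φ (A.mul x y) = A'.mul (φ x) (φ y)
  dp : ∀ p m x, A.Bihom p m x → Even p → 0 < p → ∀ i, φ (γ i x) = γ' i (φ x)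

end DGData

section Star

variable {k : Type v} [Field k] {n r : ℕ}

/-- The least common multiple of the multidegrees of the basis elements `J 1, …, J r`. -/
def lcmDeg (F : Fin r → DGData.{u, v} k n) (J : ∀ i, (F i).B) : Fin n →₀ ℕ :=
  Finset.univ.sup fun i => (F i).mdeg (J i)

/-- For bihomogeneous `f i = ∑_b α_{i,b} (m_{f i} / m_b) b` with `α_{i,b} ∈ k`, the element
`∑_K (∏_i α_{i,K i}) (M / lcm_i m_{K i}) K`
of multidegree `M` of the free module on the tuples `K` of basis elements. The scalar `α_{i,b}`
is the value at `(1, …, 1)` of the coefficient of `b` in `f i`. -/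
def tens (F : Fin r → DGData.{u, v} k n) (M : Fin n →₀ ℕ) (f : ∀ i, (F i).Carrier) :
    (∀ i, (F i).B) →₀ Poly k n :=
  ∑ K ∈ Fintype.piFinset (fun i => (f i).support),
    Finsupp.single K (MvPolynomial.monomial (M - lcmDeg F K)
      (∏ i, MvPolynomial.eval (fun _ => (1 : k)) (f i (K i))))

/-- The element `f_1 * ⋯ * f_r`, for `f i` bihomogeneous of multidegree `m i`; its multidegree is
the least common multiple of the `m i`. If all `f i` are basis elements, it is the corresponding
basis element of `F_1 * ⋯ * F_r`. -/
def star (F : Fin r → DGData.{u, v} k n) (m : Fin r → (Fin n →₀ ℕ)) (f : ∀ i, (F i).Carrier) :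
    (∀ i, (F i).B) →₀ Poly k n :=
  tens F (Finset.univ.sup m) f

/-- The differential of `F_1 * ⋯ * F_r`: on basis elements,
`∂(f_1 * ⋯ * f_r) = ∑_i (-1)^{|f_1| + ⋯ + |f_{i-1}|} ∑_j α_{i,j}
  ([m_{f_1}, …, m_{f_r}] / [m_{f_1}, …, m_{a_{i,j}}, …, m_{f_r}]) f_1 * ⋯ * a_{i,j} * ⋯ * f_r`,
where `∂ f_i = ∑_j α_{i,j} (m_{f_i} / m_{a_{i,j}}) a_{i,j}`. -/
def starD (F : Fin r → DGData.{u, v} k n) :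
    ((∀ i, (F i).B) →₀ Poly k n) →ₗ[Poly k n] ((∀ i, (F i).B) →₀ Poly k n) :=
  Finsupp.linearCombination (Poly k n) fun J =>
    ∑ i, (-1 : Poly k n) ^ (∑ l ∈ Finset.univ.filter (fun l => l < i), (F l).hdeg (J l)) •
      tens F (lcmDeg F J)
        (Function.update (fun l => (F l).basisElt (J l)) i ((F i).d ((F i).basisElt (J i))))

/-- The product of `F_1 * ⋯ * F_r`: on basis elements,
`(f_1 * ⋯ * f_r)(f_1' * ⋯ * f_r') = (-1)^{∑_i |f_i'| ∑_{j > i} |f_j|} ∑ α_{1,j_1} ⋯ α_{r,j_r}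
  ([m_{f_1}, …, m_{f_r}][m_{f_1'}, …, m_{f_r'}] / [m_{a_{1,j_1}}, …, m_{a_{r,j_r}}])
  a_{1,j_1} * ⋯ * a_{r,j_r}`,
where `f_i f_i' = ∑_j α_{i,j} (m_{f_i} m_{f_i'} / m_{a_{i,j}}) a_{i,j}`. -/
def starMul (F : Fin r → DGData.{u, v} k n) :
    ((∀ i, (F i).B) →₀ Poly k n) →ₗ[Poly k n]
      ((∀ i, (F i).B) →₀ Poly k n) →ₗ[Poly k n] ((∀ i, (F i).B) →₀ Poly k n) :=
  Finsupp.linearCombination (Poly k n) fun J =>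
    Finsupp.linearCombination (Poly k n) fun J' =>
      (-1 : Poly k n) ^ (∑ i, (F i).hdeg (J' i) *
          ∑ j ∈ Finset.univ.filter (fun j => i < j), (F j).hdeg (J j)) •
        tens F (lcmDeg F J + lcmDeg F J')
          (fun i => (F i).mul ((F i).basisElt (J i)) ((F i).basisElt (J' i)))

/-- The generalized Taylor complex `F_1 * ⋯ * F_r` with its product. Its underlying module is
`F_1 ⊗ ⋯ ⊗ F_r`, the free module on the tuples of basis elements; the tuple `J` has
homological degree `∑ |J i|` and multidegree the least common multiple of the `m_{J i}`. -/
abbrev genTaylor (F : Fin r → DGData.{u, v} k n) : DGData.{u, v} k n where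
  B := ∀ i, (F i).B
  hdeg J := ∑ i, (F i).hdeg (J i)
  mdeg J := lcmDeg F J
  d := starD F
  mul := starMul F
  one := star F (fun _ => 0) (fun i => (F i).one)

/-- The inclusion `F_i → F_1 * ⋯ * F_r`, `f ↦ 1 * ⋯ * 1 * f * 1 * ⋯ * 1`. -/
def incl (F : Fin r → DGData.{u, v} k n) (i : Fin r) :
    (F i).Carrier →ₗ[Poly k n] (genTaylor F).Carrier :=
  Finsupp.linearCombination (Poly k n) fun b =>
    star F (Pi.single i ((F i).mdeg b))
      (Function.update (fun l => (F l).one) i ((F i).basisElt b))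

end Star

end GenTaylor

end

noncomputable section

namespace GenTaylor

/-! ### Specialization of all variables to `1` -/

section Specialization

variable {k : Type v} [Field k] {n : ℕ}

/-! Set all variables equal to 1. In a bihomogeneous element of known multidegree the exponent of
every coefficient is forced, so only scalars remain to be remembered: `Bihom.ext_ev` says that two
bihomogeneous elements of the same multidegree with the same specialization are equal. The grading
by multidegree becomes a filtration (`leK`, `bi`), and the lcm's in the definition of F_1 * ⋯ * F_r
disappear: its specialization is the ordinary tensor product of DG algebras over k with the Koszul
signs. The DG axioms are thus sign computations on tensors over k (`dK_dK_tk`, `dK_mulK_tk`,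
`sgnM_add_sgnM`), carried back by `isDGAlgebra_of_basis`. Divided powers also pass between the two
levels, by `isDP_dpOf` and `isDividedPowers_dpLift`.

Over k the even part E is a commutative ring. The possible sequences 1, x, x^{(2)}, … in E are the
exponential sequences; they form an E-module `ExpMod E`, with multiplication of generating series as
addition and a acting by a^i on the i-th term. The rule for (x+y)^{(i)} then says that x ↦
(x^{(i)})_i is additive, and the rule for (xy)^{(i)} with even factors says that it is E-linear. So
the divided powers are prescribed on basis tensors and extended additively (`gamT`). For a tensor
with even factors the prescribed sequence does not depend on the slot carrying the divided power,
because f^i = i! f^{(i)} (`tnSeq_eq_tnSeq`). A tensor with an odd factor gets the sequence 1, z, 0,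
0, …, since z² = 0. The formulas for arbitrary tensors and for products follow by multiadditivity
(`gamT_tn`, `triv_gamT_tn`, `gamT_mul`, `triv_gamT_mul`).

The rule for (x^{(h)})^{(i)} is not additive in x. Its additive step is an identity between two
exponential sequences, which is checked in ℚ[X_0, X_1] and transferred to E through the integral
span of the divided power monomials (`eq_of_mem_dpGraph`, `coeff_prod_dpComp`).

For uniqueness, a tensor is up to sign the product of an included factor and the tensor of the
remaining ones. The rules for (xy)^{(i)} therefore force the values on basis tensors
(`IsDP.tn_even`, `IsDP.tn_odd`), and additivity forces the rest (`IsDP.eq_dpT`). -/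

/-- Evaluation of a polynomial at `(1, …, 1)`. -/
def evalOne : Poly k n →+* k := MvPolynomial.eval fun _ => (1 : k)

@[simp] lemma evalOne_monomial (m : Fin n →₀ ℕ) (c : k) :
    evalOne (MvPolynomial.monomial m c) = c := by
  simp [evalOne, MvPolynomial.eval_monomial, Finsupp.prod]

@[simp] lemma evalOne_C (c : k) : evalOne (MvPolynomial.C c : Poly k n) = c := by
  simp [evalOne]

/-- Coefficientwise evaluation at `(1, …, 1)` of an element of a free module. -/
def ev {B : Type u} : (B →₀ Poly k n) →+ (B →₀ k) :=
  Finsupp.mapRange.addMonoidHom evalOne.toAddMonoidHom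

@[simp] lemma ev_apply {B : Type u} (x : B →₀ Poly k n) (b : B) : ev x b = evalOne (x b) := rfl

@[simp] lemma ev_single {B : Type u} (b : B) (p : Poly k n) :
    ev (Finsupp.single b p) = Finsupp.single b (evalOne p) := by
  simp [ev]

@[simp] lemma ev_smul {B : Type u} (p : Poly k n) (x : B →₀ Poly k n) :
    ev (p • x) = evalOne p • ev x := by
  ext b; simp

lemma ev_neg_one_pow_smul {B : Type u} (e : ℕ) (x : B →₀ Poly k n) :
    ev ((-1 : Poly k n) ^ e • x) = (-1 : k) ^ e • ev x := by
  simp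

/-- Extension of scalars from `k` to the polynomial ring. -/
def constCoeff {B : Type u} : (B →₀ k) →+ (B →₀ Poly k n) :=
  Finsupp.mapRange.addMonoidHom (MvPolynomial.C (σ := Fin n) (R := k)).toAddMonoidHom

@[simp] lemma constCoeff_apply {B : Type u} (x : B →₀ k) (b : B) :
    (constCoeff x : B →₀ Poly k n) b = MvPolynomial.C (x b) := rfl

@[simp] lemma constCoeff_single {B : Type u} (b : B) (c : k) :
    (constCoeff (Finsupp.single b c) : B →₀ Poly k n) =
      Finsupp.single b (MvPolynomial.C c) := by
  simp [constCoeff]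

lemma constCoeff_smul {B : Type u} (c : k) (x : B →₀ k) :
    (constCoeff (c • x) : B →₀ Poly k n) = (MvPolynomial.C c : Poly k n) • constCoeff x := by
  ext1 b; simp

@[simp] lemma ev_constCoeff {B : Type u} (x : B →₀ k) :
    ev (constCoeff x : B →₀ Poly k n) = x := by
  ext b; simp

/-- By linearity it is enough to treat p · e_b, and p has the same value at (1, …, 1) as the
constant p(1, …, 1). Hence every R-linear map descends along `ev`. -/
lemma ev_linearMap_constCoeff_ev {B B' : Type u}
    (φ : (B →₀ Poly k n) →ₗ[Poly k n] (B' →₀ Poly k n)) (x : B →₀ Poly k n) :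
    ev (φ (constCoeff (ev x))) = ev (φ x) := by
  induction x using Finsupp.induction_linear with
  | zero => simp
  | add x y hx hy => simp [hx, hy]
  | single b p =>
    have h : ∀ q : Poly k n, Finsupp.single b q = q • Finsupp.single b (1 : Poly k n) := by simp
    rw [ev_single, constCoeff_single, h, h p, φ.map_smul, φ.map_smul]
    simp

/-- The homogenization of multidegree `m` of a vector with coefficients in `k`. -/
def homog {B : Type u} (mdeg : B → (Fin n →₀ ℕ)) (m : Fin n →₀ ℕ) :
    (B →₀ k) →+ (B →₀ Poly k n) where
  toFun y :=
    { support := y.support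
      toFun := fun b => MvPolynomial.monomial (m - mdeg b) (y b)
      mem_support_toFun := by simp }
  map_zero' := by ext1 b; simp
  map_add' x y := by ext1 b; simp

@[simp] lemma homog_apply {B : Type u} (mdeg : B → (Fin n →₀ ℕ)) (m : Fin n →₀ ℕ) (y : B →₀ k)
    (b : B) : homog mdeg m y b = MvPolynomial.monomial (m - mdeg b) (y b) := rfl

@[simp] lemma ev_homog {B : Type u} (mdeg : B → (Fin n →₀ ℕ)) (m : Fin n →₀ ℕ) (y : B →₀ k) :
    ev (homog mdeg m y) = y := by
  ext b; simp

end Specialization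

/-! ### Bihomogeneous elements and their recovery from the specialization -/

namespace DGData

variable {k : Type v} [Field k] {n : ℕ} {A A' : DGData.{u, v} k n}

/-- The vectors over `k` of homological degree `p`. -/
def partK (A : DGData.{u, v} k n) (p : ℕ) : Submodule k (A.B →₀ k) :=
  Finsupp.supported k k {b | A.hdeg b = p}

/-- The vectors over `k` supported in multidegrees dividing `m`. -/
def leK (A : DGData.{u, v} k n) (m : Fin n →₀ ℕ) : Submodule k (A.B →₀ k) :=
  Finsupp.supported k k {b | A.mdeg b ≤ m}

lemma mem_partK {p : ℕ} {x : A.B →₀ k} : x ∈ A.partK p ↔ ∀ b, x b ≠ 0 → A.hdeg b = p := by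
  simp [partK, Finsupp.mem_supported, Set.subset_def]

lemma mem_leK {m : Fin n →₀ ℕ} {x : A.B →₀ k} : x ∈ A.leK m ↔ ∀ b, x b ≠ 0 → A.mdeg b ≤ m := by
  simp [leK, Finsupp.mem_supported, Set.subset_def]

lemma mem_part {p : ℕ} {x : A.Carrier} : x ∈ A.part p ↔ ∀ b, x b ≠ 0 → A.hdeg b = p := by
  simp [part, Finsupp.mem_supported, Set.subset_def]

lemma single_mem_partK (b : A.B) (c : k) : Finsupp.single b c ∈ A.partK (A.hdeg b) :=
  Finsupp.single_mem_supported k c rfl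

lemma single_mem_leK (b : A.B) (c : k) : Finsupp.single b c ∈ A.leK (A.mdeg b) :=
  Finsupp.single_mem_supported k c (le_refl (A.mdeg b))

lemma leK_mono {m m' : Fin n →₀ ℕ} (h : m ≤ m') : A.leK m ≤ A.leK m' :=
  Finsupp.supported_mono fun _ hb => le_trans hb h

lemma ev_mem_partK {p : ℕ} {x : A.Carrier} (hx : x ∈ A.part p) : ev x ∈ A.partK p :=
  mem_partK.2 fun b hb => mem_part.1 hx b fun h => hb (by simp [h])

lemma constCoeff_mem_part {p : ℕ} {x : A.B →₀ k} (hx : x ∈ A.partK p) :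
    (constCoeff x : A.Carrier) ∈ A.part p :=
  mem_part.2 fun b hb => mem_partK.1 hx b fun h => hb (by simp [h])

/-- All partial sums stay in degree p, so the additive step may use facts that hold only for
homogeneous elements, such as graded commutativity. -/
lemma partK_induction {p : ℕ} {P : (A.B →₀ k) → Prop} (h0 : P 0)
    (hs : ∀ b c, A.hdeg b = p → P (Finsupp.single b c))
    (ha : ∀ x y, x ∈ A.partK p → y ∈ A.partK p → P x → P y → P (x + y)) :
    ∀ x ∈ A.partK p, P x := by
  intro x hx
  have h : ∀ s : Finset A.B, (∀ b ∈ s, A.hdeg b = p) →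
      (∑ b ∈ s, Finsupp.single b (x b) ∈ A.partK p) ∧ P (∑ b ∈ s, Finsupp.single b (x b)) := by
    classical
    intro s
    induction s using Finset.induction_on with
    | empty => exact fun _ => ⟨by simp, by simpa using h0⟩
    | insert b s hb ih =>
      intro h
      obtain ⟨h1, h2⟩ := ih fun b hb => h b (Finset.mem_insert_of_mem hb)
      have hbp := h b (Finset.mem_insert_self _ _)
      have h3 : Finsupp.single b (x b) ∈ A.partK p := hbp ▸ single_mem_partK b (x b)
      rw [Finset.sum_insert hb]
      exact ⟨add_mem h3 h1, ha _ _ h3 h1 (hs b _ hbp) h2⟩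
  have := (h x.support fun b hb => mem_partK.1 hx b (by simpa using hb)).2
  rwa [show ∑ b ∈ x.support, Finsupp.single b (x b) = x from Finsupp.sum_single x] at this

lemma exists_mem_leK (x : A.B →₀ k) : ∃ m, x ∈ A.leK m :=
  ⟨x.support.sup A.mdeg, mem_leK.2 fun _ hb => Finset.le_sup (f := A.mdeg) (by simpa using hb)⟩

/-- The homogenization of multidegree `m` of a vector with coefficients in `k`. -/
abbrev hom (A : DGData.{u, v} k n) (m : Fin n →₀ ℕ) : (A.B →₀ k) →+ A.Carrier := homog A.mdeg m

/-- The coefficient of b is a scalar times the monomial of exponent m - m_b; specialization forgets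
only this monomial, which m determines. -/
lemma Bihom.hom_ev {p : ℕ} {m : Fin n →₀ ℕ} {x : A.Carrier} (hx : A.Bihom p m x) :
    A.hom m (ev x) = x := by
  ext1 b
  by_cases hb : x b = 0
  · simp [hb]
  · obtain ⟨-, -, c, hc⟩ := hx b hb
    simp [hc]

lemma Bihom.ev_mem_partK {p : ℕ} {m : Fin n →₀ ℕ} {x : A.Carrier} (hx : A.Bihom p m x) :
    ev x ∈ A.partK p :=
  mem_partK.2 fun b hb => (hx b fun h => hb (by simp [h])).1

lemma Bihom.mem_part {p : ℕ} {m : Fin n →₀ ℕ} {x : A.Carrier} (hx : A.Bihom p m x) :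
    x ∈ A.part p :=
  DGData.mem_part.2 fun b hb => (hx b hb).1

lemma Bihom.ev_mem_leK {p : ℕ} {m : Fin n →₀ ℕ} {x : A.Carrier} (hx : A.Bihom p m x) :
    ev x ∈ A.leK m :=
  mem_leK.2 fun b hb => (hx b fun h => hb (by simp [h])).2.1

lemma bihom_hom {p : ℕ} {m : Fin n →₀ ℕ} {y : A.B →₀ k} (hp : y ∈ A.partK p) (hm : y ∈ A.leK m) :
    A.Bihom p m (A.hom m y) := by
  intro b hb
  have hb' : y b ≠ 0 := fun h => hb (by simp [h])
  exact ⟨mem_partK.1 hp b hb', mem_leK.1 hm b hb', y b, rfl⟩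

/-- The reduction to the field k on which everything rests. Only the multidegrees have to match, so
homological degrees written in different forms need no reconciliation. -/
lemma Bihom.ext_ev {p p' : ℕ} {m : Fin n →₀ ℕ} {x y : A.Carrier} (hx : A.Bihom p m x)
    (hy : A.Bihom p' m y) (h : ev x = ev y) : x = y := by
  rw [← hx.hom_ev, ← hy.hom_ev, h]

lemma bihom_zero (p : ℕ) (m : Fin n →₀ ℕ) : A.Bihom p m 0 := fun _ hb => (hb rfl).elim

lemma bihom_iff {p : ℕ} {m : Fin n →₀ ℕ} {x : A.Carrier} :
    A.Bihom p m x ↔ ev x ∈ A.partK p ∧ ev x ∈ A.leK m ∧ A.hom m (ev x) = x :=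
  ⟨fun h => ⟨h.ev_mem_partK, h.ev_mem_leK, h.hom_ev⟩, fun h => h.2.2 ▸ bihom_hom h.1 h.2.1⟩

lemma Bihom.add {p : ℕ} {m : Fin n →₀ ℕ} {x y : A.Carrier} (hx : A.Bihom p m x)
    (hy : A.Bihom p m y) : A.Bihom p m (x + y) := by
  rw [bihom_iff] at *
  simp only [map_add]
  exact ⟨add_mem hx.1 hy.1, add_mem hx.2.1 hy.2.1, by rw [hx.2.2, hy.2.2]⟩

lemma Bihom.sum {ι : Type*} {s : Finset ι} {p : ℕ} {m : Fin n →₀ ℕ} {x : ι → A.Carrier}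
    (hx : ∀ i ∈ s, A.Bihom p m (x i)) : A.Bihom p m (∑ i ∈ s, x i) := by
  classical
  induction s using Finset.induction_on with
  | empty => simpa using bihom_zero p m
  | insert a s ha ih =>
    rw [Finset.sum_insert ha]
    exact (hx a (by simp)).add (ih fun i hi => hx i (by simp [hi]))

lemma Bihom.monomial_smul {p : ℕ} {m m' : Fin n →₀ ℕ} {x : A.Carrier} (hx : A.Bihom p m x)
    (c : k) : A.Bihom p (m' + m) (MvPolynomial.monomial m' c • x) := by
  intro b hb
  have hb' : x b ≠ 0 := fun h => hb (by simp [h])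
  obtain ⟨h1, h2, c', h3⟩ := hx b hb'
  exact ⟨h1, h2.trans le_add_self, c * c', by
    rw [Finsupp.smul_apply, h3, smul_eq_mul, MvPolynomial.monomial_mul, add_tsub_assoc_of_le h2]⟩

lemma Bihom.const_smul {p : ℕ} {m : Fin n →₀ ℕ} {x : A.Carrier} (hx : A.Bihom p m x) (c : k) :
    A.Bihom p m ((MvPolynomial.C c : Poly k n) • x) := by
  simpa using hx.monomial_smul (m' := 0) c

lemma Bihom.neg_one_pow_smul {p : ℕ} {m : Fin n →₀ ℕ} {x : A.Carrier} (hx : A.Bihom p m x)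
    (e : ℕ) : A.Bihom p m ((-1 : Poly k n) ^ e • x) := by
  simpa using hx.const_smul ((-1) ^ e)

lemma bihom_basisElt (b : A.B) : A.Bihom (A.hdeg b) (A.mdeg b) (A.basisElt b) := by
  intro b' hb'
  obtain rfl : b = b' := by
    by_contra h
    exact hb' (Finsupp.single_eq_of_ne' h)
  exact ⟨rfl, le_refl (A.mdeg b), 1, by simp [basisElt]⟩

@[simp] lemma ev_basisElt (b : A.B) : ev (A.basisElt b) = Finsupp.single b 1 := by
  simp [basisElt]

lemma Bihom.eq_sum {p : ℕ} {m : Fin n →₀ ℕ} {x : A.Carrier} (hx : A.Bihom p m x) :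
    x = ∑ b ∈ (ev x).support, MvPolynomial.monomial (m - A.mdeg b) (ev x b) • A.basisElt b := by
  classical
  conv_lhs => rw [← hx.hom_ev]
  ext1 b
  simp only [homog_apply, basisElt, Finsupp.smul_single, smul_eq_mul, mul_one,
    Finsupp.finsetSum_apply]
  by_cases hb : b ∈ (ev x).support
  · rw [Finset.sum_eq_single b] <;> simp +contextual

  · rw [Finset.sum_eq_zero]
    · have : ev x b = 0 := by simpa using hb
      rw [this]; simp
    · intro b' hb'
      exact Finsupp.single_eq_of_ne' (by rintro rfl; exact hb hb')

/-- A linear map that is bihomogeneous on basis elements is bihomogeneous. -/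
lemma bihom_map_of_basisElt {p q : ℕ} {φ : A.Carrier →ₗ[Poly k n] A'.Carrier}
    {δ : Fin n →₀ ℕ}
    (h : ∀ b, A.hdeg b = p → A'.Bihom q (A.mdeg b + δ) (φ (A.basisElt b)))
    {m : Fin n →₀ ℕ} {x : A.Carrier} (hx : A.Bihom p m x) : A'.Bihom q (m + δ) (φ x) := by
  rw [hx.eq_sum, map_sum]
  refine Bihom.sum fun b hb => ?_
  have hb' : ev x b ≠ 0 := by simpa using hb
  rw [map_smul]
  have := (h b (mem_partK.1 hx.ev_mem_partK b hb')).monomial_smul (m' := m - A.mdeg b) (ev x b)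
  rwa [← add_assoc, tsub_add_cancel_of_le (mem_leK.1 hx.ev_mem_leK b hb')] at this

lemma part_induction {p : ℕ} {P : A.Carrier → Prop} (h0 : P 0)
    (hs : ∀ b, A.hdeg b = p → P (A.basisElt b))
    (hc : ∀ (c : Poly k n) x, x ∈ A.part p → P x → P (c • x))
    (ha : ∀ x y, x ∈ A.part p → y ∈ A.part p → P x → P y → P (x + y)) :
    ∀ x ∈ A.part p, P x := by
  intro x hx
  have hx' := hx
  rw [part, Finsupp.supported_eq_span_single] at hx
  have e : Submodule.span (Poly k n) ((fun b : A.B => Finsupp.single b (1 : Poly k n)) ''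
      {b | A.hdeg b = p}) = A.part p := by rw [part, Finsupp.supported_eq_span_single]
  induction hx using Submodule.span_induction with
  | mem x h => obtain ⟨b, hb, rfl⟩ := h; exact hs b hb
  | zero => exact h0
  | add x y hx hy h1 h2 =>
    rw [e] at hx hy
    exact ha x y hx hy (h1 hx) (h2 hy)
  | smul c x hx h => rw [e] at hx; exact hc c x hx (h hx)

/-! ### The structure over `k` obtained by specialization -/

/-- The differential over `k`. -/
def dK (A : DGData.{u, v} k n) : (A.B →₀ k) →ₗ[k] (A.B →₀ k) where
  toFun y := ev (A.d (constCoeff y))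
  map_add' x y := by simp
  map_smul' c x := by simp [constCoeff_smul]

/-- The product over `k`. -/
def mulK (A : DGData.{u, v} k n) : (A.B →₀ k) →ₗ[k] (A.B →₀ k) →ₗ[k] (A.B →₀ k) :=
  LinearMap.mk₂ k (fun x y => ev (A.mul (constCoeff x) (constCoeff y)))
    (by intros; simp) (by intros; simp [constCoeff_smul])
    (by intros; simp) (by intros; simp [constCoeff_smul])

/-- The unit over `k`. -/
def oneK (A : DGData.{u, v} k n) : A.B →₀ k := ev A.one

@[simp] lemma dK_ev (x : A.Carrier) : A.dK (ev x) = ev (A.d x) :=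
  ev_linearMap_constCoeff_ev A.d x

@[simp] lemma mulK_ev (x y : A.Carrier) : A.mulK (ev x) (ev y) = ev (A.mul x y) := by
  have h1 := ev_linearMap_constCoeff_ev (A.mul (constCoeff (ev x))) y
  have h2 := ev_linearMap_constCoeff_ev (A.mul.flip y) x
  exact h1.trans h2

lemma dK_single (b : A.B) : A.dK (Finsupp.single b 1) = ev (A.d (A.basisElt b)) := by
  rw [← dK_ev, ev_basisElt]

lemma mulK_single (b b' : A.B) : A.mulK (Finsupp.single b 1) (Finsupp.single b' 1) =
    ev (A.mul (A.basisElt b) (A.basisElt b')) := by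
  rw [← mulK_ev, ev_basisElt, ev_basisElt]

end DGData

end GenTaylor

namespace GenTaylor

/-! ### The differential graded `k`-algebra underlying a DG algebra -/

/-- The algebra over `k` obtained from a DG algebra over `R` by specializing all variables to
`1`. -/
def Deh {k : Type v} [Field k] {n : ℕ} (A : DGData.{u, v} k n) (_ : A.IsDGAlgebra) :
    Type (max u v) := A.B →₀ k

namespace Deh

open DGData

variable {k : Type v} [Field k] {n : ℕ} {A : DGData.{u, v} k n} {hA : A.IsDGAlgebra}

instance : AddCommGroup (Deh A hA) := inferInstanceAs (AddCommGroup (A.B →₀ k))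

instance : Module k (Deh A hA) := inferInstanceAs (Module k (A.B →₀ k))

lemma exists_ev_eq (x : Deh A hA) : ∃ x' : A.Carrier, x = ev x' :=
  ⟨constCoeff (show A.B →₀ k from x), (ev_constCoeff (show A.B →₀ k from x)).symm⟩

instance : Ring (Deh A hA) :=
  { (inferInstance : AddCommGroup (Deh A hA)) with
  mul x y := A.mulK x y
  one := A.oneK
  left_distrib x y z := (A.mulK x).map_add y z
  right_distrib x y z := congrArg (fun f => f z) (A.mulK.map_add x y)
  zero_mul x := congrArg (fun f => f x) A.mulK.map_zero
  mul_zero x := (A.mulK x).map_zero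
  mul_assoc x y z := by
    obtain ⟨x, rfl⟩ := exists_ev_eq x
    obtain ⟨y, rfl⟩ := exists_ev_eq y
    obtain ⟨z, rfl⟩ := exists_ev_eq z
    change A.mulK (A.mulK (ev x) (ev y)) (ev z) = A.mulK (ev x) (A.mulK (ev y) (ev z))
    simp [hA.mul_assoc]
  one_mul x := by
    obtain ⟨x, rfl⟩ := exists_ev_eq x
    change A.mulK (ev A.one) (ev x) = ev x
    simp [hA.one_mul]
  mul_one x := by
    obtain ⟨x, rfl⟩ := exists_ev_eq x
    change A.mulK (ev x) (ev A.one) = ev x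
    simp [hA.mul_one] }

instance : Algebra k (Deh A hA) :=
  Algebra.ofModule (fun c x y => congrArg (fun f => f y) (A.mulK.map_smul c x))
    (fun c x y => (A.mulK x).map_smul c y)

/-- Specialization of all variables to `1`. -/
def of (hA : A.IsDGAlgebra) : A.Carrier →+ Deh A hA := ev

lemma of_surjective : Function.Surjective (of hA) := fun x => (exists_ev_eq x).imp fun _ h => h.symm

lemma of_mul (x y : A.Carrier) : of hA (A.mul x y) = of hA x * of hA y := (mulK_ev x y).symm

lemma of_one : of hA A.one = 1 := rfl

lemma of_pow (x : A.Carrier) (i : ℕ) : of hA (A.pow x i) = of hA x ^ i := by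
  induction i with
  | zero => rw [pow_zero]; rfl
  | succ i ih => rw [pow_succ', ← ih, ← of_mul]; rfl

lemma of_smul (p : Poly k n) (x : A.Carrier) : of hA (p • x) = evalOne p • of hA x := ev_smul p x

/-- The basis vectors. -/
def sg (hA : A.IsDGAlgebra) (b : A.B) : Deh A hA := Finsupp.single b (1 : k)

lemma single_eq_smul_sg (b : A.B) (c : k) :
    (show Deh A hA from Finsupp.single b c) = c • sg hA b := by
  change Finsupp.single b c = c • Finsupp.single b (1 : k)
  simp

/-- The differential. -/
def d (hA : A.IsDGAlgebra) : Deh A hA →ₗ[k] Deh A hA := A.dK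

lemma of_d (x : A.Carrier) : of hA (A.d x) = d hA (of hA x) := (dK_ev x).symm

/-- The component of homological degree `p`. -/
def part (hA : A.IsDGAlgebra) (p : ℕ) : Submodule k (Deh A hA) := A.partK p

/-- The component of homological degree `p` of the filtration by multidegree. -/
def bi (hA : A.IsDGAlgebra) (p : ℕ) (m : Fin n →₀ ℕ) : Submodule k (Deh A hA) :=
  A.partK p ⊓ A.leK m

lemma bi_le_part {p : ℕ} {m : Fin n →₀ ℕ} : bi hA p m ≤ part hA p := inf_le_left

lemma bi_mono {p : ℕ} {m m' : Fin n →₀ ℕ} (h : m ≤ m') : bi hA p m ≤ bi hA p m' :=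
  inf_le_inf_left _ (leK_mono h)

lemma of_mem_bi {p : ℕ} {m : Fin n →₀ ℕ} {x : A.Carrier} (hx : A.Bihom p m x) :
    of hA x ∈ bi hA p m := ⟨hx.ev_mem_partK, hx.ev_mem_leK⟩

lemma of_mem_part {p : ℕ} {x : A.Carrier} (hx : x ∈ A.part p) :
    of hA x ∈ part hA p := ev_mem_partK hx

lemma exists_of_mem_bi {p : ℕ} {m : Fin n →₀ ℕ} {x : Deh A hA} (hx : x ∈ bi hA p m) :
    ∃ x', A.Bihom p m x' ∧ x = of hA x' :=
  ⟨_, bihom_hom hx.1 hx.2, (ev_homog _ _ _).symm⟩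

lemma exists_mem_part {p : ℕ} {x : Deh A hA} (hx : x ∈ part hA p) :
    ∃ x', x' ∈ A.part p ∧ x = of hA x' :=
  ⟨_, constCoeff_mem_part hx, (ev_constCoeff _).symm⟩

lemma exists_mem_bi {p : ℕ} {x : Deh A hA} (hx : x ∈ part hA p) : ∃ m, x ∈ bi hA p m :=
  (exists_mem_leK (A := A) x).imp fun _ hm => ⟨hx, hm⟩

lemma sg_mem_bi (b : A.B) : sg hA b ∈ bi hA (A.hdeg b) (A.mdeg b) :=
  ⟨single_mem_partK b 1, single_mem_leK b 1⟩

lemma sg_mem_part (b : A.B) : sg hA b ∈ part hA (A.hdeg b) := single_mem_partK b 1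

lemma part_induction {p : ℕ} {P : Deh A hA → Prop} (h0 : P 0)
    (hs : ∀ (c : k) b, A.hdeg b = p → P (c • sg hA b))
    (ha : ∀ x y, x ∈ part hA p → y ∈ part hA p → P x → P y → P (x + y)) :
    ∀ x ∈ part hA p, P x :=
  partK_induction h0 (fun b c h => by have := hs c b h; rwa [← single_eq_smul_sg] at this) ha

lemma induction {P : Deh A hA → Prop} (h0 : P 0)
    (hs : ∀ (c : k) b, P (c • sg hA b))
    (ha : ∀ x y, P x → P y → P (x + y)) (x : Deh A hA) : P x := by
  refine Finsupp.induction_linear (motive := P) x h0 ha fun b c => ?_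
  have := hs c b
  rwa [← single_eq_smul_sg] at this

lemma bi_induction {p : ℕ} {m : Fin n →₀ ℕ} {P : Deh A hA → Prop} (h0 : P 0)
    (hs : ∀ (c : k) b, A.hdeg b = p → A.mdeg b ≤ m → P (c • sg hA b))
    (ha : ∀ x y, P x → P y → P (x + y)) : ∀ x ∈ bi hA p m, P x := by
  intro x hx
  have h : ∀ s : Finset A.B, (∀ b ∈ s, A.hdeg b = p ∧ A.mdeg b ≤ m) →
      P (∑ b ∈ s, (show A.B →₀ k from x) b • sg hA b) := by
    classical
    intro s
    induction s using Finset.induction_on with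
    | empty => exact fun _ => by simpa using h0
    | insert b s hb ih =>
      intro h
      rw [Finset.sum_insert hb]
      have := h b (Finset.mem_insert_self _ _)
      exact ha _ _ (hs _ b this.1 this.2) (ih fun b hb => h b (Finset.mem_insert_of_mem hb))
  have := h (Finsupp.support (show A.B →₀ k from x)) fun b hb =>
    ⟨mem_partK.1 hx.1 b (Finsupp.mem_support_iff.1 hb), mem_leK.1 hx.2 b (Finsupp.mem_support_iff.1 hb)⟩
  simp_rw [← single_eq_smul_sg] at this
  have e : ∑ b ∈ Finsupp.support (show A.B →₀ k from x),
      Finsupp.single b ((show A.B →₀ k from x) b) = x := Finsupp.sum_single _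
  exact e ▸ this

lemma one_mem_bi : (1 : Deh A hA) ∈ bi hA 0 0 := of_mem_bi hA.one_bihom

lemma one_mem_part : (1 : Deh A hA) ∈ part hA 0 := bi_le_part one_mem_bi

lemma mul_mem_bi {p q : ℕ} {m m' : Fin n →₀ ℕ} {x y : Deh A hA} (hx : x ∈ bi hA p m)
    (hy : y ∈ bi hA q m') : x * y ∈ bi hA (p + q) (m + m') := by
  obtain ⟨x, hx', rfl⟩ := exists_of_mem_bi hx
  obtain ⟨y, hy', rfl⟩ := exists_of_mem_bi hy
  rw [← of_mul]
  exact of_mem_bi (hA.mul_bihom _ _ _ _ _ _ hx' hy')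

lemma mul_mem_part {p q : ℕ} {x y : Deh A hA} (hx : x ∈ part hA p) (hy : y ∈ part hA q) :
    x * y ∈ part hA (p + q) := by
  obtain ⟨m, hx⟩ := exists_mem_bi hx
  obtain ⟨m', hy⟩ := exists_mem_bi hy
  exact bi_le_part (mul_mem_bi hx hy)

lemma pow_mem_bi {p : ℕ} {m : Fin n →₀ ℕ} {x : Deh A hA} (hx : x ∈ bi hA p m) (i : ℕ) :
    x ^ i ∈ bi hA (i * p) (i • m) := by
  induction i with
  | zero => simpa using one_mem_bi
  | succ i ih =>
    rw [pow_succ, add_mul, one_mul, succ_nsmul]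
    exact mul_mem_bi ih hx

lemma pow_mem_part {p : ℕ} {x : Deh A hA} (hx : x ∈ part hA p) (i : ℕ) :
    x ^ i ∈ part hA (i * p) := by
  obtain ⟨m, hx⟩ := exists_mem_bi hx
  exact bi_le_part (pow_mem_bi hx i)

lemma d_eq_zero {x : Deh A hA} (hx : x ∈ part hA 0) : d hA x = 0 := by
  obtain ⟨x, hx', rfl⟩ := exists_mem_part hx
  rw [← of_d, hA.d_zero x hx', map_zero]

lemma d_mem_bi {p : ℕ} {m : Fin n →₀ ℕ} {x : Deh A hA} (hx : x ∈ bi hA p m) :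
    d hA x ∈ bi hA (p - 1) m := by
  cases p with
  | zero => rw [d_eq_zero (bi_le_part hx)]; exact zero_mem _
  | succ p =>
    obtain ⟨x, hx', rfl⟩ := exists_of_mem_bi hx
    rw [← of_d]
    exact of_mem_bi (hA.d_bihom _ _ _ hx')

lemma d_mem_part {p : ℕ} {x : Deh A hA} (hx : x ∈ part hA p) : d hA x ∈ part hA (p - 1) := by
  obtain ⟨m, hx⟩ := exists_mem_bi hx
  exact bi_le_part (d_mem_bi hx)

lemma d_d (x : Deh A hA) : d hA (d hA x) = 0 := by
  obtain ⟨x, rfl⟩ := of_surjective x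
  rw [← of_d, ← of_d, hA.d_d, map_zero]

lemma leibniz {p : ℕ} {x : Deh A hA} (hx : x ∈ part hA p) (y : Deh A hA) :
    d hA (x * y) = d hA x * y + (-1 : k) ^ p • (x * d hA y) := by
  obtain ⟨x, hx', rfl⟩ := exists_mem_part hx
  obtain ⟨y, rfl⟩ := of_surjective y
  rw [← of_mul, ← of_d, hA.leibniz p x hx', map_add, of_mul, of_smul, of_mul, of_d, of_d]
  simp

lemma mul_comm_smul {p q : ℕ} {x y : Deh A hA} (hx : x ∈ part hA p) (hy : y ∈ part hA q) :
    x * y = (-1 : k) ^ (p * q) • (y * x) := by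
  obtain ⟨x, hx', rfl⟩ := exists_mem_part hx
  obtain ⟨y, hy', rfl⟩ := exists_mem_part hy
  rw [← of_mul, hA.mul_comm p q x hx' y hy', of_smul, of_mul]
  simp

lemma mul_self_eq_zero {p : ℕ} (hp : Odd p) {x : Deh A hA} (hx : x ∈ part hA p) : x * x = 0 := by
  obtain ⟨x, hx', rfl⟩ := exists_mem_part hx
  rw [← of_mul, hA.sq_zero p hp x hx', map_zero]

lemma commute_sg {b : A.B} (hb : Even (A.hdeg b)) (y : Deh A hA) : Commute (sg hA b) y := by
  refine induction (P := fun y => Commute (sg hA b) y) (Commute.zero_right _) (fun c b' => ?_)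
    (fun x y => Commute.add_right) y
  refine Commute.smul_right ?_ c
  have := mul_comm_smul (sg_mem_part (hA := hA) b) (sg_mem_part b')
  rwa [Even.neg_one_pow (hb.mul_right _), one_smul] at this

lemma commute_of_mem_part {p : ℕ} (hp : Even p) {x : Deh A hA} (hx : x ∈ part hA p)
    (y : Deh A hA) : Commute x y :=
  part_induction (P := fun x => Commute x y) (Commute.zero_left _)
    (fun c _ hb => (commute_sg (hb ▸ hp) y).smul_left c) (fun _ _ _ _ => Commute.add_left) x hx

lemma neg_comm {p q : ℕ} (hp : Odd p) (hq : Odd q) {x y : Deh A hA} (hx : x ∈ part hA p)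
    (hy : y ∈ part hA q) : x * y = -(y * x) := by
  rw [mul_comm_smul hx hy, Odd.neg_one_pow (hp.mul hq), neg_one_smul]

/-! ### The even part -/

lemma even_induction {P : Deh A hA → Prop} (h0 : P 0)
    (hs : ∀ (c : k) b, Even (A.hdeg b) → P (c • sg hA b))
    (ha : ∀ x y, P x → P y → P (x + y)) {x : Deh A hA}
    (hx : x ∈ Submodule.span k (sg hA '' {b | Even (A.hdeg b)})) : P x := by
  -- `P` is not assumed stable under scalars, so the induction runs over all multiples of x and is
  -- specialized at c = 1.
  refine Submodule.span_induction (p := fun x _ => ∀ c : k, P (c • x)) ?_ ?_ ?_ ?_ hx 1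
    |> fun h => by rwa [one_smul] at h
  · rintro _ ⟨b, hb, rfl⟩ c
    exact hs c b hb
  · intro c; rwa [smul_zero]
  · intro x y _ _ h1 h2 c
    rw [smul_add]
    exact ha _ _ (h1 c) (h2 c)
  · intro a x _ h c
    rw [smul_smul]
    exact h _

lemma mem_span_of_mem_part {p : ℕ} (hp : Even p) {x : Deh A hA} (hx : x ∈ part hA p) :
    x ∈ Submodule.span k (sg hA '' {b | Even (A.hdeg b)}) :=
  part_induction (P := fun x => x ∈ Submodule.span k (sg hA '' {b | Even (A.hdeg b)}))
    (zero_mem _)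
    (fun c b hb => Submodule.smul_mem _ c (Submodule.subset_span ⟨b, by simpa [hb], rfl⟩))
    (fun _ _ _ _ => add_mem) x hx

/-- The subalgebra of elements of even homological degree. -/
def evenPart (hA : A.IsDGAlgebra) : Subalgebra k (Deh A hA) :=
  (Submodule.span k (sg hA '' {b | Even (A.hdeg b)})).toSubalgebra
    (mem_span_of_mem_part Even.zero one_mem_part) fun x y hx hy => by
      refine even_induction (P := fun x => x * y ∈ _) ?_ ?_ ?_ hx
      · rw [zero_mul]; exact zero_mem _
      · intro c b hb
        refine even_induction (P := fun y => (c • sg hA b) * y ∈ _) ?_ ?_ ?_ hy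
        · rw [mul_zero]; exact zero_mem _
        · intro c' b' hb'
          rw [smul_mul_smul_comm]
          exact Submodule.smul_mem _ _ (mem_span_of_mem_part (hb.add hb')
            (mul_mem_part (sg_mem_part _) (sg_mem_part _)))
        · intro x y hx hy; rw [mul_add]; exact add_mem hx hy
      · intro x y hx hy; rw [add_mul]; exact add_mem hx hy

lemma mem_evenPart {p : ℕ} (hp : Even p) {x : Deh A hA} (hx : x ∈ part hA p) :
    x ∈ evenPart hA := mem_span_of_mem_part hp hx

lemma commute_of_mem_evenPart {x : Deh A hA} (hx : x ∈ evenPart hA) (y : Deh A hA) :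
    Commute x y :=
  even_induction (P := fun x => Commute x y) (Commute.zero_left _)
    (fun c _ hb => (commute_sg hb y).smul_left c) (fun _ _ => Commute.add_left) hx

/-- Even elements are central by graded commutativity. This gives the commutative coefficient ring
over which exponential sequences form a module. -/
instance : CommRing (evenPart hA) :=
  { (inferInstance : Ring (evenPart hA)) with
    mul_comm := fun x y => Subtype.ext (commute_of_mem_evenPart x.2 y.1) }

end Deh

end GenTaylor

namespace GenTaylor

/-! ### Checking the axioms of a DG algebra on basis elements -/

namespace DGData

variable {k : Type v} [Field k] {n : ℕ} {A : DGData.{u, v} k n}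

lemma carrier_induction {P : A.Carrier → Prop} (h0 : P 0) (hs : ∀ b, P (A.basisElt b))
    (hc : ∀ (c : Poly k n) x, P x → P (c • x)) (ha : ∀ x y, P x → P y → P (x + y))
    (x : A.Carrier) : P x := by
  refine Finsupp.induction_linear x h0 ha fun b c => ?_
  have := hc c _ (hs b)
  rwa [basisElt, Finsupp.smul_single, smul_eq_mul, mul_one] at this

/-- The identities other than x² = 0 are (multi)linear over R, hence reduce to basis elements; there
both sides are bihomogeneous of one multidegree and can be compared over k. Bihomogeneity itself is
invisible after specialization and is therefore required over R. -/
theorem isDGAlgebra_of_basis (finite_part : ∀ p, {b | A.hdeg b = p}.Finite)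
    (hd : ∀ b, A.Bihom (A.hdeg b - 1) (A.mdeg b) (A.d (A.basisElt b)))
    (hd0 : ∀ b, A.hdeg b = 0 → A.d (A.basisElt b) = 0)
    (hmul : ∀ b b', A.Bihom (A.hdeg b + A.hdeg b') (A.mdeg b + A.mdeg b')
      (A.mul (A.basisElt b) (A.basisElt b')))
    (hone : A.Bihom 0 0 A.one)
    (dd : ∀ b, A.dK (A.dK (Finsupp.single b 1)) = 0)
    (one_mul : ∀ b, A.mulK A.oneK (Finsupp.single b 1) = Finsupp.single b 1)
    (mul_one : ∀ b, A.mulK (Finsupp.single b 1) A.oneK = Finsupp.single b 1)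
    (assoc : ∀ b b' b'', A.mulK (A.mulK (Finsupp.single b 1) (Finsupp.single b' 1))
        (Finsupp.single b'' 1) =
      A.mulK (Finsupp.single b 1) (A.mulK (Finsupp.single b' 1) (Finsupp.single b'' 1)))
    (leibniz : ∀ b b', A.dK (A.mulK (Finsupp.single b 1) (Finsupp.single b' 1)) =
      A.mulK (A.dK (Finsupp.single b 1)) (Finsupp.single b' 1) +
        (-1 : k) ^ A.hdeg b • A.mulK (Finsupp.single b 1) (A.dK (Finsupp.single b' 1)))
    (comm : ∀ b b', A.mulK (Finsupp.single b 1) (Finsupp.single b' 1) =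
      (-1 : k) ^ (A.hdeg b * A.hdeg b') • A.mulK (Finsupp.single b' 1) (Finsupp.single b 1))
    (sq : ∀ b, Odd (A.hdeg b) → A.mulK (Finsupp.single b 1) (Finsupp.single b 1) = 0) :
    A.IsDGAlgebra := by
  have hd' : ∀ p m x, A.Bihom p m x → A.Bihom (p - 1) m (A.d x) := fun p m x hx => by
    have := bihom_map_of_basisElt (φ := A.d) (q := p - 1) (δ := 0)
      (fun b hb => by rw [add_zero, ← hb]; exact hd b) hx
    rwa [add_zero] at this
  have hm1 : ∀ b q m' y, A.Bihom q m' y →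
      A.Bihom (A.hdeg b + q) (A.mdeg b + m') (A.mul (A.basisElt b) y) := fun b q m' y hy => by
    have := bihom_map_of_basisElt (φ := A.mul (A.basisElt b)) (q := A.hdeg b + q)
      (δ := A.mdeg b) (fun b' hb' => by rw [← hb', add_comm (A.mdeg b')]; exact hmul b b') hy
    rwa [add_comm m'] at this
  have hm : ∀ p q m m' x y, A.Bihom p m x → A.Bihom q m' y →
      A.Bihom (p + q) (m + m') (A.mul x y) := fun p q m m' x y hx hy =>
    bihom_map_of_basisElt (φ := A.mul.flip y) (fun b hb => by rw [← hb]; exact hm1 b _ _ _ hy) hx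
  have hb := bihom_basisElt (A := A)
  have hcomm : ∀ p q, ∀ x ∈ A.part p, ∀ y ∈ A.part q,
      A.mul x y = (-1 : Poly k n) ^ (p * q) • A.mul y x := by
    intro p q x hx y hy
    refine part_induction (P := fun x => A.mul x y = (-1 : Poly k n) ^ (p * q) • A.mul y x)
      (by simp) (fun b hbp => ?_) (fun c x _ h => by simp [h, smul_comm c])
      (fun x x' _ _ h h' => by simp [h, h']) x hx
    refine part_induction (P := fun y => A.mul (A.basisElt b) y =
        (-1 : Poly k n) ^ (p * q) • A.mul y (A.basisElt b))
      (by simp) (fun b' hbq => ?_) (fun c x _ h => by simp [h, smul_comm c])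
      (fun x x' _ _ h h' => by simp [h, h']) y hy
    refine (hm _ _ _ _ _ _ (hb b) (hb b')).ext_ev
      (p' := A.hdeg b' + A.hdeg b) (Bihom.neg_one_pow_smul ?_ _) ?_
    · rw [add_comm (A.mdeg b)]; exact hm _ _ _ _ _ _ (hb b') (hb b)
    · rw [ev_neg_one_pow_smul, ← mulK_single, ← mulK_single, comm, ← hbp, ← hbq]
  refine
    { finite_part := finite_part
      d_bihom := fun p m x hx => hd' (p + 1) m x hx
      d_zero := part_induction (by simp) hd0 (fun c x _ h => by simp [h])
        (fun x y _ _ h h' => by simp [h, h'])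
      d_d := ?_
      one_bihom := hone
      mul_bihom := hm
      one_mul := ?_
      mul_one := ?_
      mul_assoc := ?_
      leibniz := ?_
      mul_comm := hcomm
      sq_zero := ?_ }
  · refine carrier_induction (by simp) (fun b => ?_) (fun c x h => by simp [h])
      (fun x y h h' => by simp [h, h'])
    refine (hd' _ _ _ (hd b)).ext_ev (bihom_zero 0 _) ?_
    rw [← dK_ev, ← dK_ev, ev_basisElt, dd, map_zero]
  · refine carrier_induction (by simp) (fun b => ?_) (fun c x h => by simp [h])
      (fun x y h h' => by simp [h, h'])
    refine Bihom.ext_ev (m := 0 + A.mdeg b) (hm _ _ _ _ _ _ hone (hb b)) (by simpa using hb b) ?_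
    rw [← mulK_ev, ev_basisElt]
    exact one_mul b
  · refine carrier_induction (by simp) (fun b => ?_) (fun c x h => by simp [h])
      (fun x y h h' => by simp [h, h'])
    refine Bihom.ext_ev (m := A.mdeg b + 0) (hm _ _ _ _ _ _ (hb b) hone) (by simpa using hb b) ?_
    rw [← mulK_ev, ev_basisElt]
    exact mul_one b
  · intro x y z
    refine carrier_induction
      (P := fun x => A.mul (A.mul x y) z = A.mul x (A.mul y z)) (by simp) (fun b => ?_)
      (fun c x h => by simp [h]) (fun x y h h' => by simp [h, h']) x
    refine carrier_induction
      (P := fun y => A.mul (A.mul (A.basisElt b) y) z = A.mul (A.basisElt b) (A.mul y z))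
      (by simp) (fun b' => ?_) (fun c x h => by simp [h]) (fun x y h h' => by simp [h, h']) y
    refine carrier_induction
      (P := fun z => A.mul (A.mul (A.basisElt b) (A.basisElt b')) z =
        A.mul (A.basisElt b) (A.mul (A.basisElt b') z))
      (by simp) (fun b'' => ?_) (fun c x h => by simp [h]) (fun x y h h' => by simp [h, h']) z
    refine (hm _ _ _ _ _ _ (hm _ _ _ _ _ _ (hb b) (hb b')) (hb b'')).ext_ev
      (p' := A.hdeg b + (A.hdeg b' + A.hdeg b'')) ?_ ?_
    · rw [add_assoc]; exact hm _ _ _ _ _ _ (hb b) (hm _ _ _ _ _ _ (hb b') (hb b''))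
    · simp only [← mulK_ev, ev_basisElt]
      exact assoc b b' b''
  · intro p x hx y
    refine part_induction (P := fun x => A.d (A.mul x y) =
        A.mul (A.d x) y + (-1 : Poly k n) ^ p • A.mul x (A.d y)) (by simp) (fun b hbp => ?_)
      (fun c x _ h => by simp [h, smul_comm c])
      (fun x x' _ _ h h' => by simp only [map_add, LinearMap.add_apply, h, h', smul_add]; abel) x hx
    refine carrier_induction (P := fun y => A.d (A.mul (A.basisElt b) y) =
        A.mul (A.d (A.basisElt b)) y + (-1 : Poly k n) ^ p • A.mul (A.basisElt b) (A.d y))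
      (by simp) (fun b' => ?_)
      (fun c x h => by simp [h, smul_comm c])
      (fun x x' h h' => by simp only [map_add, h, h', smul_add]; abel) y
    have h1 := hd' _ _ _ (hm _ _ _ _ _ _ (hb b) (hb b'))
    have h2 := hm _ _ _ _ _ _ (hd b) (hb b')
    have h3 := (hm _ _ _ _ _ _ (hb b) (hd b')).neg_one_pow_smul p
    -- The truncated degrees of the two summands on the right differ if one factor has degree 0, so
    -- the three terms are compared as homogenizations in their common multidegree.
    rw [← h1.hom_ev, ← h2.hom_ev, ← h3.hom_ev, ← map_add, ev_neg_one_pow_smul]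
    congr 1
    have := leibniz b b'
    rw [hbp] at this
    simpa only [← mulK_ev, ← dK_ev, ev_basisElt] using this
  · intro p hp
    have : ∀ x ∈ A.part p, A.mul x x = 0 := by
      refine part_induction (by simp) (fun b hbp => ?_) (fun c x _ h => by simp [h])
        (fun x y hx hy h h' => ?_)
      · refine (hm _ _ _ _ _ _ (hb b) (hb b)).ext_ev (bihom_zero 0 _) ?_
        rw [← mulK_single, sq b (hbp ▸ hp), map_zero]
      -- Squaring is not additive, but the cross terms xy and yx of odd elements cancel.
      · have := hcomm p p x hx y hy
        rw [Odd.neg_one_pow (hp.mul hp), neg_one_smul] at this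
        simp [h, h', this]
    exact this

end DGData

/-! ### Tensors of coordinate vectors -/

section Tensor

variable {k : Type v} [Field k] {r : ℕ} {B B' : Fin r → Type u}

/-- The tensor `f_1 ⊗ ⋯ ⊗ f_r` of coordinate vectors. -/
def tk (f : ∀ l, B l →₀ k) : (∀ l, B l) →₀ k :=
  Finsupp.onFinset (Fintype.piFinset fun l => (f l).support) (fun K => ∏ l, f l (K l)) fun K hK => by
    rw [Fintype.mem_piFinset]
    exact fun l => Finsupp.mem_support_iff.2 fun h => hK (Finset.prod_eq_zero (Finset.mem_univ l) h)

@[simp] lemma tk_apply (f : ∀ l, B l →₀ k) (K : ∀ l, B l) : tk f K = ∏ l, f l (K l) := rfl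

lemma tk_eq_sum (f : ∀ l, B l →₀ k) : tk f =
    ∑ K ∈ Fintype.piFinset fun l => (f l).support, Finsupp.single K (∏ l, f l (K l)) := by
  classical
  ext K
  rw [Finsupp.finsetSum_apply]
  simp only [tk_apply, Finsupp.single_apply, Finset.sum_ite_eq', Fintype.mem_piFinset]
  split_ifs with h
  · rfl
  · push Not at h
    obtain ⟨l, hl⟩ := h
    exact Finset.prod_eq_zero (Finset.mem_univ l) (by simpa using hl)

lemma prod_update_apply (f : ∀ l, B l →₀ k) (i : Fin r) (x : B i →₀ k) (K : ∀ l, B l) :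
    ∏ l, Function.update f i x l (K l) = x (K i) * ∏ l ∈ Finset.univ.erase i, f l (K l) := by
  classical
  rw [← Finset.mul_prod_erase _ _ (Finset.mem_univ i), Function.update_self]
  congr 1
  refine Finset.prod_congr rfl fun l hl => ?_
  rw [Function.update_of_ne (Finset.ne_of_mem_erase hl)]

lemma tk_update_add (f : ∀ l, B l →₀ k) (i : Fin r) (x y : B i →₀ k) :
    tk (Function.update f i (x + y)) =
      tk (Function.update f i x) + tk (Function.update f i y) := by
  ext K
  simp only [tk_apply, Finsupp.add_apply, prod_update_apply, add_mul]

lemma tk_update_smul (f : ∀ l, B l →₀ k) (i : Fin r) (c : k) (x : B i →₀ k) :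
    tk (Function.update f i (c • x)) = c • tk (Function.update f i x) := by
  ext K
  simp only [tk_apply, Finsupp.smul_apply, prod_update_apply, smul_eq_mul, mul_assoc]

lemma tk_smul (c : Fin r → k) (f : ∀ l, B l →₀ k) :
    tk (fun l => c l • f l) = (∏ l, c l) • tk f := by
  ext K
  simp [Finset.prod_mul_distrib]

lemma tk_eq_zero {f : ∀ l, B l →₀ k} (i : Fin r) (h : f i = 0) : tk f = 0 := by
  ext K
  exact Finset.prod_eq_zero (Finset.mem_univ i) (by simp [h])

lemma tk_single (J : ∀ l, B l) : tk (fun l => Finsupp.single (J l) (1 : k)) =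
    Finsupp.single J 1 := by
  classical
  ext K
  rw [tk_apply]
  by_cases h : J = K
  · subst h; simp
  · rw [Finsupp.single_eq_of_ne' h]
    obtain ⟨l, hl⟩ := Function.ne_iff.1 h
    exact Finset.prod_eq_zero (Finset.mem_univ l) (Finsupp.single_eq_of_ne' hl)

/-- The tensor product of linear maps, in coordinates. -/
def tmap (φ : ∀ l, (B l →₀ k) →ₗ[k] (B' l →₀ k)) : ((∀ l, B l) →₀ k) →ₗ[k] ((∀ l, B' l) →₀ k) :=
  Finsupp.linearCombination k fun K => tk fun l => φ l (Finsupp.single (K l) 1)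

lemma tmap_single (φ : ∀ l, (B l →₀ k) →ₗ[k] (B' l →₀ k)) (K : ∀ l, B l) :
    tmap φ (Finsupp.single K 1) = tk fun l => φ l (Finsupp.single (K l) 1) := by
  simp [tmap]

/-- In each coordinate this is distributivity: a sum over tuples of products equals a product of
sums. -/
lemma tmap_tk (φ : ∀ l, (B l →₀ k) →ₗ[k] (B' l →₀ k)) (f : ∀ l, B l →₀ k) :
    tmap φ (tk f) = tk fun l => φ l (f l) := by
  classical
  rw [tk_eq_sum, map_sum]
  simp only [tmap, Finsupp.linearCombination_single]
  ext K'
  simp only [Finsupp.finsetSum_apply, Finsupp.smul_apply, tk_apply, smul_eq_mul,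
    ← Finset.prod_mul_distrib]
  rw [← Finset.prod_univ_sum (fun l => (f l).support)
    (fun l b => f l b * φ l (Finsupp.single b 1) (K' l))]
  refine Finset.prod_congr rfl fun l _ => ?_
  conv_rhs => rw [← Finsupp.sum_single (f l), Finsupp.sum, map_sum, Finsupp.finsetSum_apply]
  refine Finset.sum_congr rfl fun b _ => ?_
  have : Finsupp.single b (f l b) = f l b • Finsupp.single b (1 : k) := by simp
  rw [this, map_smul, Finsupp.smul_apply, smul_eq_mul]

/-- The Koszul signs depend on the degrees of the factors, so a formula with fixed signs holds only
on basis tuples of prescribed degrees; `S` is the set of these tuples. -/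
lemma eq_of_forall_single {α β : Type u} {S : Set α} {φ ψ : (α →₀ k) →ₗ[k] (β →₀ k)}
    (h : ∀ b ∈ S, φ (Finsupp.single b 1) = ψ (Finsupp.single b 1)) {x : α →₀ k}
    (hx : ∀ b, x b ≠ 0 → b ∈ S) : φ x = ψ x := by
  rw [← Finsupp.sum_single x, Finsupp.sum, map_sum, map_sum]
  refine Finset.sum_congr rfl fun b hb => ?_
  have : Finsupp.single b (x b) = x b • Finsupp.single b (1 : k) := by simp
  rw [this, map_smul, map_smul, h b (hx b (by simpa using hb))]

lemma apply_ne_zero_of_tk {f : ∀ l, B l →₀ k} {K : ∀ l, B l} (h : tk f K ≠ 0) (l : Fin r) :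
    f l (K l) ≠ 0 :=
  fun h0 => h (Finset.prod_eq_zero (Finset.mem_univ l) h0)

end Tensor

/-! ### Signs -/

section Sign

variable {r : ℕ}

/-- The exponent `∑_{l < i} p_l` in the differential. -/
def sgnD (p : Fin r → ℕ) (i : Fin r) : ℕ := ∑ l ∈ Finset.univ.filter (fun l => l < i), p l

/-- The exponent `∑_i q_i ∑_{j > i} p_j` in the product. -/
def sgnM (p q : Fin r → ℕ) : ℕ := ∑ i, q i * ∑ j ∈ Finset.univ.filter (fun j => i < j), p j

lemma sgnD_add (p q : Fin r → ℕ) (i : Fin r) : sgnD (p + q) i = sgnD p i + sgnD q i :=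
  Finset.sum_add_distrib

lemma sgnM_add_left (p p' q : Fin r → ℕ) : sgnM (p + p') q = sgnM p q + sgnM p' q := by
  simp only [sgnM, Pi.add_apply, Finset.sum_add_distrib, mul_add]

lemma sgnM_add_right (p q q' : Fin r → ℕ) : sgnM p (q + q') = sgnM p q + sgnM p q' := by
  simp only [sgnM, Pi.add_apply, Finset.sum_add_distrib, add_mul]

lemma sgnD_single_of_lt {i j : Fin r} (h : i < j) : sgnD (Pi.single i 1) j = 1 := by
  rw [sgnD, Finset.sum_eq_single i] <;> simp +contextual [h]

lemma sgnD_single_of_le {i j : Fin r} (h : j ≤ i) : sgnD (Pi.single i 1) j = 0 :=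
  Finset.sum_eq_zero fun l hl => by
    rw [Pi.single_eq_of_ne]
    exact ((Finset.mem_filter.1 hl).2.trans_le h).ne

lemma sgnM_single_left (i : Fin r) (q : Fin r → ℕ) : sgnM (Pi.single i 1) q = sgnD q i := by
  simp only [sgnM, sgnD, Finset.sum_filter]
  refine Finset.sum_congr rfl fun a _ => ?_
  rw [Finset.sum_eq_single i] <;> simp +contextual

lemma sgnM_single_right (i : Fin r) (p : Fin r → ℕ) :
    sgnM p (Pi.single i 1) = ∑ j ∈ Finset.univ.filter (fun j => i < j), p j := by
  rw [sgnM, Finset.sum_eq_single i] <;> simp +contextual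

lemma sum_eq_sgnD_add (p : Fin r → ℕ) (i : Fin r) :
    ∑ l, p l = sgnD p i + p i + ∑ j ∈ Finset.univ.filter (fun j => i < j), p j := by
  rw [sgnD, ← Finset.sum_filter_add_sum_filter_not Finset.univ (fun l => l < i)]
  rw [add_assoc]
  congr 1
  rw [← Finset.add_sum_erase _ _ (show i ∈ Finset.univ.filter (fun l => ¬ l < i) by simp)]
  congr 1
  refine Finset.sum_congr ?_ fun _ _ => rfl
  ext l
  simp only [Finset.mem_erase, Finset.mem_filter, Finset.mem_univ, true_and, not_lt]
  exact ⟨fun h => lt_of_le_of_ne h.2 h.1.symm, fun h => ⟨h.ne', h.le⟩⟩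

/-- The terms p_j q_i of the product on the right are sorted into j > i, j < i and j = i. This
yields the sign of graded commutativity for the tensor product. -/
lemma sgnM_add_sgnM (p q : Fin r → ℕ) :
    sgnM p q + sgnM q p + ∑ l, p l * q l = (∑ l, p l) * ∑ l, q l := by
  have h : sgnM q p = ∑ i, q i * sgnD p i := by
    simp only [sgnM, sgnD, Finset.sum_filter, Finset.mul_sum]
    rw [Finset.sum_comm]
    refine Finset.sum_congr rfl fun i _ => Finset.sum_congr rfl fun j _ => ?_
    split_ifs <;> simp [mul_comm]
  rw [h, sgnM, ← Finset.sum_add_distrib, ← Finset.sum_add_distrib, mul_comm, Finset.sum_mul]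
  refine Finset.sum_congr rfl fun i _ => ?_
  rw [sum_eq_sgnD_add p i]
  ring

/-- Used with additivity of the sign exponents to compare signs before and after a differential
lowers the i-th degree. -/
lemma exists_eq_add_single {p : Fin r → ℕ} {i : Fin r} (h : p i ≠ 0) :
    p = Function.update p i (p i - 1) + Pi.single i 1 := by
  ext l
  by_cases hl : l = i
  · subst hl; simp; omega
  · simp [hl]

/-- Swapping the indices pairs the off-diagonal terms. The diagonal needs its own hypothesis, since
t = -t does not give t = 0 in characteristic 2. -/
lemma sum_antisymm {M : Type*} [AddCommGroup M] {ι : Type*} [Fintype ι] (T : ι → ι → M)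
    (h0 : ∀ i, T i i = 0) (h : ∀ i j, i ≠ j → T i j = -T j i) : ∑ i, ∑ j, T i j = 0 := by
  classical
  rw [← Finset.sum_product' (Finset.univ : Finset ι) Finset.univ T]
  refine Finset.sum_involution (fun x _ => (x.2, x.1)) ?_ ?_ ?_ ?_
  · rintro ⟨i, j⟩ -
    by_cases hij : i = j
    · subst hij; simp [h0]
    · simp [h i j hij]
  · rintro ⟨i, j⟩ - hne heq
    simp only [Prod.mk.injEq] at heq
    rw [heq.1] at hne
    exact hne (h0 _)
  · simp
  · simp

end Sign

end GenTaylor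

namespace GenTaylor

/-! ### The generalized Taylor complex is a DG algebra -/

section Taylor

open DGData

variable {k : Type v} [Field k] {n r : ℕ} {F : Fin r → DGData.{u, v} k n}

/-- Separates the two ingredients of F_1 * ⋯ * F_r: an ordinary tensor over k, and a homogenization
that inserts all the lcm's. -/
lemma tens_eq (M : Fin n →₀ ℕ) (f : ∀ l, (F l).Carrier) :
    tens F M f = (genTaylor F).hom M (tk fun l => ev (f l)) := by
  classical
  ext1 K
  rw [tens, Finsupp.finsetSum_apply]
  simp only [homog_apply, tk_apply, ev_apply, Finsupp.single_apply, Finset.sum_ite_eq',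
    Fintype.mem_piFinset]
  split_ifs with h
  · rfl
  · push Not at h
    obtain ⟨l, hl⟩ := h
    rw [Finset.prod_eq_zero (Finset.mem_univ l), map_zero]
    simpa using congrArg evalOne (Finsupp.notMem_support_iff.1 hl)

@[simp] lemma ev_tens (M : Fin n →₀ ℕ) (f : ∀ l, (F l).Carrier) :
    ev (tens F M f) = tk fun l => ev (f l) := by
  rw [tens_eq, ev_homog]

lemma tk_mem_partK {p : Fin r → ℕ} {f : ∀ l, (F l).B →₀ k} (hf : ∀ l, f l ∈ (F l).partK (p l)) :
    tk f ∈ (genTaylor F).partK (∑ l, p l) :=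
  mem_partK.2 fun K hK => show ∑ l, (F l).hdeg (K l) = _ from
    Finset.sum_congr rfl fun l _ => mem_partK.1 (hf l) _ (apply_ne_zero_of_tk hK l)

lemma tk_mem_leK {m : Fin r → (Fin n →₀ ℕ)} {f : ∀ l, (F l).B →₀ k}
    (hf : ∀ l, f l ∈ (F l).leK (m l)) : tk f ∈ (genTaylor F).leK (Finset.univ.sup m) :=
  mem_leK.2 fun K hK => Finset.sup_mono_fun (f := fun l => (F l).mdeg (K l)) fun l _ =>
    mem_leK.1 (hf l) _ (apply_ne_zero_of_tk hK l)

/-- Any multiple `M` of the lcm is allowed: in the product, the lcm of the m_l m'_l may be a proper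
divisor of the product of the two lcm's. -/
lemma bihom_tens {p : Fin r → ℕ} {m : Fin r → (Fin n →₀ ℕ)} {M : Fin n →₀ ℕ}
    {f : ∀ l, (F l).Carrier} (hf : ∀ l, (F l).Bihom (p l) (m l) (f l))
    (hM : Finset.univ.sup m ≤ M) : (genTaylor F).Bihom (∑ l, p l) M (tens F M f) := by
  rw [tens_eq]
  exact bihom_hom (tk_mem_partK fun l => (hf l).ev_mem_partK)
    (leK_mono hM (tk_mem_leK fun l => (hf l).ev_mem_leK))

lemma bihom_star {p : Fin r → ℕ} {m : Fin r → (Fin n →₀ ℕ)} {f : ∀ l, (F l).Carrier}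
    (hf : ∀ l, (F l).Bihom (p l) (m l) (f l)) :
    (genTaylor F).Bihom (∑ l, p l) (Finset.univ.sup m) (star F m f) :=
  bihom_tens hf le_rfl

lemma starD_basisElt (J : ∀ l, (F l).B) : starD F ((genTaylor F).basisElt J) =
    ∑ i, (-1 : Poly k n) ^ sgnD (fun l => (F l).hdeg (J l)) i •
      tens F (lcmDeg F J)
        (Function.update (fun l => (F l).basisElt (J l)) i ((F i).d ((F i).basisElt (J i)))) := by
  simp only [starD, DGData.basisElt, Finsupp.linearCombination_single, one_smul, sgnD]

lemma starMul_basisElt (J J' : ∀ l, (F l).B) :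
    starMul F ((genTaylor F).basisElt J) ((genTaylor F).basisElt J') =
    (-1 : Poly k n) ^ sgnM (fun l => (F l).hdeg (J l)) (fun l => (F l).hdeg (J' l)) •
      tens F (lcmDeg F J + lcmDeg F J')
        (fun i => (F i).mul ((F i).basisElt (J i)) ((F i).basisElt (J' i))) := by
  simp only [starMul, DGData.basisElt, Finsupp.linearCombination_single, one_smul, sgnM]

lemma dK_genTaylor_single (J : ∀ l, (F l).B) :
    (genTaylor F).dK (Finsupp.single J 1) =
    ∑ i, (-1 : k) ^ sgnD (fun l => (F l).hdeg (J l)) i •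
      tk (Function.update (fun l => Finsupp.single (J l) 1) i
        ((F i).dK (Finsupp.single (J i) 1))) := by
  have := dK_single (A := genTaylor F) J
  rw [this, starD_basisElt, map_sum]
  refine Finset.sum_congr rfl fun i _ => ?_
  rw [ev_neg_one_pow_smul, ev_tens, dK_single]
  congr 2
  ext1 l
  by_cases h : l = i
  · subst h; simp
  · simp [Function.update_of_ne h]

lemma mulK_genTaylor_single (J J' : ∀ l, (F l).B) :
    (genTaylor F).mulK (Finsupp.single J 1) (Finsupp.single J' 1) =
    (-1 : k) ^ sgnM (fun l => (F l).hdeg (J l)) (fun l => (F l).hdeg (J' l)) •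
      tk fun l => (F l).mulK (Finsupp.single (J l) 1) (Finsupp.single (J' l) 1) := by
  have := mulK_single (A := genTaylor F) J J'
  rw [this, starMul_basisElt, ev_neg_one_pow_smul, ev_tens]
  simp only [mulK_single]

lemma hdeg_eq_of_tk {p : Fin r → ℕ} {f : ∀ l, (F l).B →₀ k} (hf : ∀ l, f l ∈ (F l).partK (p l))
    (K : ∀ l, (F l).B) (hK : tk f K ≠ 0) : K ∈ {K | (fun l => (F l).hdeg (K l)) = p} :=
  funext fun l => mem_partK.1 (hf l) _ (apply_ne_zero_of_tk hK l)

/-- Once the degrees p are fixed the signs are constants, and both sides come from linear maps: the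
right one from the signed sum of the maps id ⊗ ⋯ ⊗ ∂ ⊗ ⋯ ⊗ id. These agree on the basis tuples
involved. -/
lemma dK_tk {p : Fin r → ℕ} {f : ∀ l, (F l).B →₀ k} (hf : ∀ l, f l ∈ (F l).partK (p l)) :
    (genTaylor F).dK (tk f) =
      ∑ i, (-1 : k) ^ sgnD p i • tk (Function.update f i ((F i).dK (f i))) := by
  let φ : Fin r → ∀ l, ((F l).B →₀ k) →ₗ[k] ((F l).B →₀ k) := fun i =>
    Function.update (fun l => LinearMap.id) i (F i).dK
  have hφ : ∀ i (g : ∀ l, (F l).B →₀ k), (fun l => φ i l (g l)) =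
      Function.update g i ((F i).dK (g i)) := by
    intro i g
    ext1 l
    by_cases h : l = i
    · subst h; simp [φ]
    · simp [φ, Function.update_of_ne h]
  rw [eq_of_forall_single (φ := (genTaylor F).dK)
    (ψ := ∑ i, (-1 : k) ^ sgnD p i • tmap (φ i)) ?_ (hdeg_eq_of_tk hf)]
  · simp only [LinearMap.sum_apply, LinearMap.smul_apply, tmap_tk, hφ]
  · rintro K rfl
    rw [dK_genTaylor_single]
    simp only [LinearMap.sum_apply, LinearMap.smul_apply, tmap_single,
      hφ _ (fun l => Finsupp.single (K l) 1)]

lemma mulK_tk {p q : Fin r → ℕ} {f g : ∀ l, (F l).B →₀ k} (hf : ∀ l, f l ∈ (F l).partK (p l))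
    (hg : ∀ l, g l ∈ (F l).partK (q l)) :
    (genTaylor F).mulK (tk f) (tk g) =
      (-1 : k) ^ sgnM p q • tk fun l => (F l).mulK (f l) (g l) := by
  have h1 : ∀ J : ∀ l, (F l).B, (fun l => (F l).hdeg (J l)) = p →
      (genTaylor F).mulK (Finsupp.single J 1) (tk g) =
        (-1 : k) ^ sgnM p q • tk fun l => (F l).mulK (Finsupp.single (J l) 1) (g l) := by
    rintro J rfl
    rw [eq_of_forall_single (φ := (genTaylor F).mulK (Finsupp.single J 1))
      (ψ := (-1 : k) ^ sgnM (fun l => (F l).hdeg (J l)) q •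
        tmap fun l => (F l).mulK (Finsupp.single (J l) 1)) ?_ (hdeg_eq_of_tk hg)]
    · simp only [LinearMap.smul_apply, tmap_tk]
    · rintro K rfl
      rw [mulK_genTaylor_single]
      simp only [LinearMap.smul_apply, tmap_single]
  have h2 := eq_of_forall_single (φ := (genTaylor F).mulK.flip (tk g))
    (ψ := (-1 : k) ^ sgnM p q • tmap fun l => (F l).mulK.flip (g l)) ?_ (hdeg_eq_of_tk hf)
  · simpa only [LinearMap.smul_apply, tmap_tk, LinearMap.flip_apply] using h2
  · intro K hK
    rw [LinearMap.flip_apply, h1 K hK]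
    simp only [LinearMap.smul_apply, tmap_single, LinearMap.flip_apply]

lemma oneK_genTaylor : (genTaylor F).oneK = tk fun l => (F l).oneK :=
  ev_tens _ _

lemma finite_part_genTaylor (hF : ∀ l, (F l).IsDGAlgebra) (p : ℕ) :
    {J | (genTaylor F).hdeg J = p}.Finite := by
  have h : ∀ l, {b | (F l).hdeg b ≤ p}.Finite := fun l => by
    refine ((Set.finite_Iic p).biUnion fun q _ => (hF l).finite_part q).subset fun b hb => ?_
    simpa using hb
  refine (Set.Finite.pi' h).subset fun J hJ l => ?_
  exact (Finset.single_le_sum (f := fun l => (F l).hdeg (J l)) (fun _ _ => Nat.zero_le _)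
    (Finset.mem_univ l)).trans_eq hJ

lemma update_mem_partK {p : Fin r → ℕ} {f : ∀ l, (F l).B →₀ k}
    (hf : ∀ l, f l ∈ (F l).partK (p l)) (i : Fin r) {q : ℕ} {x : (F i).B →₀ k}
    (hx : x ∈ (F i).partK q) (l : Fin r) :
    Function.update f i x l ∈ (F l).partK (Function.update p i q l) := by
  by_cases h : l = i
  · subst h; simpa using hx
  · simpa [Function.update_of_ne h] using hf l

/-- The diagonal terms vanish by ∂² = 0 in each factor. For i < j, applying ∂ in slot i first lowers
the sign exponent at j by one, while applying it in slot j first leaves the exponent at i alone; so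
the two orders cancel. -/
lemma dK_dK_tk (hF : ∀ l, (F l).IsDGAlgebra) {p : Fin r → ℕ} {f : ∀ l, (F l).B →₀ k}
    (hf : ∀ l, f l ∈ (F l).partK (p l)) : (genTaylor F).dK ((genTaylor F).dK (tk f)) = 0 := by
  have hd : ∀ i, (F i).dK (f i) ∈ (F i).partK (p i - 1) :=
    fun i => Deh.d_mem_part (hA := hF i) (hf i)
  have hd0 : ∀ i, p i = 0 → (F i).dK (f i) = 0 :=
    fun i h => Deh.d_eq_zero (hA := hF i) (by have := hf i; rwa [h] at this)
  rw [dK_tk hf, map_sum]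
  simp only [map_smul, dK_tk (update_mem_partK hf _ (hd _)), Finset.smul_sum, smul_smul]
  refine sum_antisymm _ (fun i => ?_) fun i j hij => ?_
  · rw [tk_eq_zero i, smul_zero]
    simp only [Function.update_self]
    exact Deh.d_d (hA := hF i) (f i)
  · rw [Function.update_of_ne hij.symm, Function.update_of_ne hij, Function.update_comm hij]
    -- In degree 0 the truncated p_i - 1 would give a wrong sign, but the term vanishes there.
    by_cases hi : p i = 0
    · rw [tk_eq_zero i (by simp [hd0 i hi])]; simp
    by_cases hj : p j = 0
    · rw [tk_eq_zero j (by simp [hd0 j hj, Function.update_of_ne hij.symm])]; simp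
    rw [← neg_smul]
    congr 1
    have key : ∀ i j : Fin r, i < j → p i ≠ 0 → p j ≠ 0 →
        (-1 : k) ^ sgnD p i * (-1) ^ sgnD (Function.update p i (p i - 1)) j =
        -((-1 : k) ^ sgnD p j * (-1) ^ sgnD (Function.update p j (p j - 1)) i) := by
      intro i j hij hi hj
      have h1 : sgnD p j = sgnD (Function.update p i (p i - 1)) j + 1 := by
        conv_lhs => rw [exists_eq_add_single hi, sgnD_add, sgnD_single_of_lt hij]
      have h2 : sgnD p i = sgnD (Function.update p j (p j - 1)) i := by
        conv_lhs => rw [exists_eq_add_single hj, sgnD_add, sgnD_single_of_le hij.le, add_zero]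
      rw [h1, ← h2]
      ring
    rcases lt_or_gt_of_ne hij with h | h
    · exact key i j h hi hj
    · rw [key j i h hj hi, neg_neg]

lemma tk_update_sum_apply (f : ∀ l, (F l).B →₀ k) (i : Fin r) (x y : (F i).B →₀ k) (c : k) :
    tk (Function.update f i (x + c • y)) =
      tk (Function.update f i x) + c • tk (Function.update f i y) := by
  rw [tk_update_add, tk_update_smul]

lemma dK_mulK_tk (hF : ∀ l, (F l).IsDGAlgebra) {p q : Fin r → ℕ} {f g : ∀ l, (F l).B →₀ k}
    (hf : ∀ l, f l ∈ (F l).partK (p l)) (hg : ∀ l, g l ∈ (F l).partK (q l)) :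
    (genTaylor F).dK ((genTaylor F).mulK (tk f) (tk g)) =
      (genTaylor F).mulK ((genTaylor F).dK (tk f)) (tk g) +
        (-1 : k) ^ (∑ l, p l) • (genTaylor F).mulK (tk f) ((genTaylor F).dK (tk g)) := by
  have hfg : ∀ l, (F l).mulK (f l) (g l) ∈ (F l).partK ((p + q) l) :=
    fun l => Deh.mul_mem_part (hA := hF l) (hf l) (hg l)
  have hdf : ∀ i, (F i).dK (f i) ∈ (F i).partK (p i - 1) :=
    fun i => Deh.d_mem_part (hA := hF i) (hf i)
  have hdg : ∀ i, (F i).dK (g i) ∈ (F i).partK (q i - 1) :=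
    fun i => Deh.d_mem_part (hA := hF i) (hg i)
  have hl : ∀ i, (F i).dK ((F i).mulK (f i) (g i)) = (F i).mulK ((F i).dK (f i)) (g i) +
      (-1 : k) ^ p i • (F i).mulK (f i) ((F i).dK (g i)) :=
    fun i => Deh.leibniz (hA := hF i) (hf i) (g i)
  rw [mulK_tk hf hg, map_smul, dK_tk hfg, dK_tk hf, dK_tk hg]
  simp only [map_sum, LinearMap.sum_apply, map_smul, LinearMap.smul_apply, Finset.smul_sum,
    mulK_tk (update_mem_partK hf _ (hdf _)) hg, mulK_tk hf (update_mem_partK hg _ (hdg _)),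
    ← Finset.sum_add_distrib]
  refine Finset.sum_congr rfl fun i _ => ?_
  have e1 : (fun l => (F l).mulK (Function.update f i ((F i).dK (f i)) l) (g l)) =
      Function.update (fun l => (F l).mulK (f l) (g l)) i
        ((F i).mulK ((F i).dK (f i)) (g i)) := by
    ext1 l
    by_cases h : l = i
    · subst h; simp
    · simp [Function.update_of_ne h]
  have e2 : (fun l => (F l).mulK (f l) (Function.update g i ((F i).dK (g i)) l)) =
      Function.update (fun l => (F l).mulK (f l) (g l)) i
        ((F i).mulK (f i) ((F i).dK (g i))) := by
    ext1 l
    by_cases h : l = i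
    · subst h; simp
    · simp [Function.update_of_ne h]
  rw [e1, e2, hl, tk_update_sum_apply, smul_add, smul_add, smul_smul, smul_smul, smul_smul,
    smul_smul, smul_smul, smul_smul, sgnD_add]
  congr 1
  -- Either ∂f_i = 0, or lowering p_i by one lowers the product sign exponent by the sum of the q_l
  -- with l < i, which is the discrepancy between the two differential signs.
  · by_cases hi : p i = 0
    · have : (F i).dK (f i) = 0 :=
        Deh.d_eq_zero (hA := hF i) (by have := hf i; rwa [hi] at this)
      rw [this, tk_eq_zero i (by simp)]
      simp
    · have h1 : sgnM p q = sgnM (Function.update p i (p i - 1)) q + sgnD q i := by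
        conv_lhs => rw [exists_eq_add_single hi, sgnM_add_left, sgnM_single_left]
      rw [h1]
      congr 1
      have h2 : ((-1 : k) ^ sgnD q i) * (-1) ^ sgnD q i = 1 := by
        rw [← pow_add, Even.neg_one_pow ⟨_, rfl⟩]
      rw [pow_add, pow_add]
      linear_combination
        ((-1 : k) ^ sgnM (Function.update p i (p i - 1)) q) * (-1) ^ sgnD p i * h2
  -- Here lowering q_i lowers the exponent by the sum of the p_j with j > i; together with the part
  -- up to i this makes up the total degree of f.
  · by_cases hi : q i = 0
    · have : (F i).dK (g i) = 0 :=
        Deh.d_eq_zero (hA := hF i) (by have := hg i; rwa [hi] at this)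
      rw [this, tk_eq_zero i (by simp)]
      simp
    · have h1 : sgnM p q = sgnM p (Function.update q i (q i - 1)) +
          ∑ j ∈ Finset.univ.filter (fun j => i < j), p j := by
        conv_lhs => rw [exists_eq_add_single hi, sgnM_add_right, sgnM_single_right]
      rw [h1, sum_eq_sgnD_add p i]
      congr 1
      ring

theorem isDGAlgebra_genTaylor (hF : ∀ l, (F l).IsDGAlgebra) : (genTaylor F).IsDGAlgebra := by
  have hs : ∀ (J : ∀ l, (F l).B) l,
      Finsupp.single (J l) (1 : k) ∈ (F l).partK ((F l).hdeg (J l)) :=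
    fun J l => single_mem_partK _ _
  have h1 : ∀ l, (F l).oneK ∈ (F l).partK ((0 : Fin r → ℕ) l) :=
    fun l => Deh.one_mem_part (hA := hF l)
  have hm : ∀ {J J' : ∀ l, (F l).B} l, (F l).mulK (Finsupp.single (J l) (1 : k))
      (Finsupp.single (J' l) 1) ∈
        (F l).partK (((fun l => (F l).hdeg (J l)) + fun l => (F l).hdeg (J' l)) l) :=
    fun l => Deh.mul_mem_part (hA := hF l) (hs _ l) (hs _ l)
  refine isDGAlgebra_of_basis (finite_part_genTaylor hF) ?_ ?_ ?_ ?_ ?_ ?_ ?_ ?_ ?_ ?_ ?_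
  · intro J
    change (genTaylor F).Bihom _ _ (starD F ((genTaylor F).basisElt J))
    rw [starD_basisElt]
    refine Bihom.sum fun i _ => Bihom.neg_one_pow_smul ?_ _
    by_cases hi : (F i).hdeg (J i) = 0
    · have h0 : (F i).d ((F i).basisElt (J i)) = 0 :=
        (hF i).d_zero _ (hi ▸ (bihom_basisElt (J i)).mem_part)
      rw [tens_eq, tk_eq_zero i (by simp [h0]), map_zero]
      exact bihom_zero _ _
    · have e : (genTaylor F).hdeg J - 1 =
          ∑ l, Function.update (fun l => (F l).hdeg (J l)) i ((F i).hdeg (J i) - 1) l := by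
        have := congrArg (fun p => ∑ l, p l)
          (exists_eq_add_single (p := fun l => (F l).hdeg (J l)) hi)
        simp only [Pi.add_apply, Finset.sum_add_distrib, Finset.sum_pi_single',
          Finset.mem_univ, if_true] at this
        change ∑ l, (F l).hdeg (J l) - 1 = _
        omega
      rw [e]
      refine bihom_tens (m := fun l => (F l).mdeg (J l)) (fun l => ?_) le_rfl
      by_cases h : l = i
      · subst h
        simp only [Function.update_self]
        refine (hF l).d_bihom _ _ _ ?_
        rw [Nat.sub_add_cancel (Nat.pos_of_ne_zero hi)]
        exact bihom_basisElt _
      · simp only [Function.update_of_ne h]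
        exact bihom_basisElt _
  · intro J hJ
    change starD F ((genTaylor F).basisElt J) = 0
    rw [starD_basisElt]
    refine Finset.sum_eq_zero fun i _ => ?_
    have hi : (F i).hdeg (J i) = 0 := Finset.sum_eq_zero_iff.1 hJ i (Finset.mem_univ i)
    have h0 : (F i).d ((F i).basisElt (J i)) = 0 :=
      (hF i).d_zero _ (hi ▸ (bihom_basisElt (J i)).mem_part)
    rw [tens_eq, tk_eq_zero i (by simp [h0]), map_zero, smul_zero]
  · intro J J'
    change (genTaylor F).Bihom _ _ (starMul F ((genTaylor F).basisElt J)
      ((genTaylor F).basisElt J'))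
    rw [starMul_basisElt]
    refine Bihom.neg_one_pow_smul ?_ _
    change (genTaylor F).Bihom (∑ l, (F l).hdeg (J l) + ∑ l, (F l).hdeg (J' l)) _ _
    rw [← Finset.sum_add_distrib]
    refine bihom_tens (m := fun l => (F l).mdeg (J l) + (F l).mdeg (J' l)) (fun l =>
      (hF l).mul_bihom _ _ _ _ _ _ (bihom_basisElt _) (bihom_basisElt _)) ?_
    -- The lcm of the products m_l m'_l divides the product of the lcm's.
    exact Finset.sup_le fun l _ => add_le_add
      (Finset.le_sup (f := fun l => (F l).mdeg (J l)) (Finset.mem_univ l))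
      (Finset.le_sup (f := fun l => (F l).mdeg (J' l)) (Finset.mem_univ l))
  · have := bihom_star (F := F) (p := fun _ => 0) (m := fun _ => 0)
      fun l => (hF l).one_bihom
    have h0 : (Finset.univ.sup fun _ : Fin r => (0 : Fin n →₀ ℕ)) = 0 :=
      le_antisymm (Finset.sup_le fun _ _ => le_rfl) zero_le
    rwa [h0, Finset.sum_const_zero] at this
  · intro J
    rw [← tk_single J]
    exact dK_dK_tk hF (hs J)
  · intro J
    rw [oneK_genTaylor, ← tk_single J, mulK_tk h1 (hs J)]
    have : sgnM 0 (fun l => (F l).hdeg (J l)) = 0 := by simp [sgnM]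
    rw [this, pow_zero, one_smul]
    congr 1
    ext1 l
    exact one_mul (M := Deh (F l) (hF l)) _
  · intro J
    rw [oneK_genTaylor, ← tk_single J, mulK_tk (hs J) h1]
    have : sgnM (fun l => (F l).hdeg (J l)) 0 = 0 := by simp [sgnM]
    rw [this, pow_zero, one_smul]
    congr 1
    ext1 l
    exact mul_one (M := Deh (F l) (hF l)) _
  · intro J J' J''
    rw [← tk_single J, ← tk_single J', ← tk_single J'', mulK_tk (hs J) (hs J'),
      mulK_tk (hs J') (hs J''), map_smul, map_smul, LinearMap.smul_apply,
      mulK_tk hm (hs J''), mulK_tk (hs J) hm, sgnM_add_left, sgnM_add_right, smul_smul, smul_smul]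
    congr 1
    · ring
    · congr 1
      ext1 l
      exact mul_assoc (G := Deh (F l) (hF l)) _ _ _
  · intro J J'
    rw [← tk_single J, ← tk_single J']
    exact dK_mulK_tk hF (hs J) (hs J')
  · intro J J'
    rw [← tk_single J, ← tk_single J', mulK_tk (hs J) (hs J'), mulK_tk (hs J') (hs J)]
    have e : (fun l => (F l).mulK (Finsupp.single (J l) (1 : k)) (Finsupp.single (J' l) 1)) =
        fun l => (-1 : k) ^ ((F l).hdeg (J l) * (F l).hdeg (J' l)) •
          (F l).mulK (Finsupp.single (J' l) (1 : k)) (Finsupp.single (J l) 1) := by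
      ext1 l
      exact Deh.mul_comm_smul (hA := hF l) (hs J l) (hs J' l)
    rw [e, tk_smul, smul_smul, smul_smul, Finset.prod_pow_eq_pow_sum]
    congr 1
    have h := sgnM_add_sgnM (fun l => (F l).hdeg (J l)) (fun l => (F l).hdeg (J' l))
    change _ = (-1 : k) ^ ((∑ l, (F l).hdeg (J l)) * ∑ l, (F l).hdeg (J' l)) * _
    rw [← h, pow_add, pow_add]
    have h2 : ∀ e : ℕ, ((-1 : k) ^ e) * (-1) ^ e = 1 := fun e => by
      rw [← pow_add, Even.neg_one_pow ⟨_, rfl⟩]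
    linear_combination (-(-1 : k) ^ sgnM (fun l => (F l).hdeg (J l)) (fun l => (F l).hdeg (J' l)) *
      (-1) ^ (∑ l, (F l).hdeg (J l) * (F l).hdeg (J' l))) *
      h2 (sgnM (fun l => (F l).hdeg (J' l)) (fun l => (F l).hdeg (J l)))
  · intro J hJ
    obtain ⟨l, hl⟩ : ∃ l, Odd ((F l).hdeg (J l)) := by
      by_contra h
      push Not at h
      have : Even (∑ l, (F l).hdeg (J l)) :=
        Finset.even_sum _ fun l _ => Nat.not_odd_iff_even.1 (h l)
      exact Nat.not_even_iff_odd.2 hJ this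
    rw [← tk_single J, mulK_tk (hs J) (hs J), tk_eq_zero l, smul_zero]
    exact Deh.mul_self_eq_zero (hA := hF l) hl (hs J l)

end Taylor

end GenTaylor

namespace GenTaylor

/-! ### Exponential sequences -/

section Exponential

open PowerSeries Finset.HasAntidiagonal

/-- The coefficient `(hi)! / (i! (h!)^i)` of an iterated divided power. -/
def dpComp (h i : ℕ) : ℕ := (h * i).factorial / (i.factorial * h.factorial ^ i)

/-- The natural-number division in `dpComp` is exact: it counts the partitions of a set of hi
elements into i blocks of size h. -/
lemma dpComp_mul {h : ℕ} (hh : 1 ≤ h) (i : ℕ) :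
    dpComp h i * h.factorial ^ i * i.factorial = (h * i).factorial := by
  have := Nat.uniformBell_mul_eq i (n := h) (by omega)
  rwa [Nat.uniformBell_eq_div i (by omega), mul_comm (h.factorial ^ i) i.factorial,
    mul_comm i h] at this

/-! ### Divided powers in commutative ℚ-algebras -/

section DividedPower

variable {Q : Type*} [CommRing Q] [Algebra ℚ Q]

/-- The divided power `x^i / i!` in a commutative `ℚ`-algebra. -/
def dpQ (x : Q) (i : ℕ) : Q := coeff i (rescale x (exp Q))

lemma dpQ_eq (x : Q) (i : ℕ) : dpQ x i = ((i.factorial : ℚ)⁻¹) • x ^ i := by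
  rw [dpQ, coeff_rescale, coeff_exp, one_div, Algebra.smul_def, mul_comm]

lemma dpQ_mul (x : Q) (i j : ℕ) : dpQ x i * dpQ x j = (i + j).choose i • dpQ x (i + j) := by
  rw [dpQ_eq, dpQ_eq, dpQ_eq, smul_mul_smul_comm, ← pow_add, ← Nat.cast_smul_eq_nsmul ℚ, smul_smul]
  congr 1
  have h : ((i + j).choose i : ℚ) * i.factorial * j.factorial = (i + j).factorial := by
    have := Nat.add_choose_mul_factorial_mul_factorial i j
    rw [← Nat.choose_symm_add] at this
    exact_mod_cast this
  have h1 : (i.factorial : ℚ) ≠ 0 := by positivity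
  have h2 : (j.factorial : ℚ) ≠ 0 := by positivity
  have h3 : ((i + j).factorial : ℚ) ≠ 0 := by positivity
  field_simp
  rw [← h]
  ring

lemma dpQ_dpQ (x : Q) {h : ℕ} (hh : 1 ≤ h) (i : ℕ) :
    dpQ (dpQ x h) i = dpComp h i • dpQ x (h * i) := by
  rw [dpQ_eq, dpQ_eq, dpQ_eq, smul_pow, ← pow_mul, ← Nat.cast_smul_eq_nsmul ℚ, smul_smul, smul_smul]
  congr 1
  have h0 : (dpComp h i : ℚ) * h.factorial ^ i * i.factorial = (h * i).factorial := by
    exact_mod_cast dpComp_mul hh i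
  have h1 : (i.factorial : ℚ) ≠ 0 := by positivity
  have h2 : (h.factorial : ℚ) ≠ 0 := by positivity
  have h3 : ((h * i).factorial : ℚ) ≠ 0 := by positivity
  rw [inv_pow]
  field_simp
  rw [← h0]
  ring

lemma dpQ_mul_left (a x : Q) (i : ℕ) : dpQ (a * x) i = a ^ i * dpQ x i := by
  rw [dpQ_eq, dpQ_eq, mul_pow, mul_smul_comm]

lemma dpQ_add (x y : Q) (i : ℕ) :
    dpQ (x + y) i = ∑ ab ∈ antidiagonal i, dpQ x ab.1 * dpQ y ab.2 := by
  rw [dpQ, ← exp_mul_exp_eq_exp_add, coeff_mul]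
  rfl

end DividedPower

/-! ### Transferring identities from ℚ[X_0, X_1] to exponential sequences -/

variable {E : Type*} [CommRing E]

/-- `e` is the sequence of divided powers of some element. -/
structure IsExpSeq (e : ℕ → E) : Prop where
  zero : e 0 = 1
  mul : ∀ i j, e i * e j = (i + j).choose i • e (i + j)

abbrev QQ : Type := MvPolynomial (Fin 2) ℚ

/-- Pairs of a divided power monomial in two variables over `ℚ` and its value at two sequences. -/
def dpPair (f g : ℕ → E) (s : Fin 2 →₀ ℕ) : QQ × E :=
  (dpQ (MvPolynomial.X 0) (s 0) * dpQ (MvPolynomial.X 1) (s 1), f (s 0) * g (s 1))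

/-- The first component is a nonzero rational multiple of a monomial, so distinct s give linearly
independent elements. -/
lemma dpPair_fst (f g : ℕ → E) (s : Fin 2 →₀ ℕ) : (dpPair f g s).1 =
    MvPolynomial.monomial s (((s 0).factorial : ℚ)⁻¹ * ((s 1).factorial : ℚ)⁻¹) := by
  rw [dpPair, dpQ_eq, dpQ_eq, smul_mul_smul_comm, MvPolynomial.monomial_eq, Finsupp.prod_fintype,
    Fin.prod_univ_two, MvPolynomial.smul_eq_C_mul]
  simp

lemma dpPair_mul {f g : ℕ → E} (hf : IsExpSeq f) (hg : IsExpSeq g) (s t : Fin 2 →₀ ℕ) :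
    dpPair f g s * dpPair f g t =
      (((s 0 + t 0).choose (s 0) * (s 1 + t 1).choose (s 1) : ℕ) : ℤ) • dpPair f g (s + t) := by
  rw [Nat.cast_smul_eq_nsmul ℤ]
  ext1
  · simp only [dpPair, Prod.fst_mul, Prod.smul_fst, Finsupp.add_apply]
    rw [mul_mul_mul_comm, dpQ_mul, dpQ_mul, smul_mul_smul_comm]
  · simp only [dpPair, Prod.snd_mul, Prod.smul_snd, Finsupp.add_apply]
    rw [mul_mul_mul_comm, hf.mul, hg.mul, smul_mul_smul_comm]

/-- The graph of the homomorphism from the free divided power ring in two variables that is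
given by two exponential sequences. -/
def dpGraph {f g : ℕ → E} (hf : IsExpSeq f) (hg : IsExpSeq g) : Subalgebra ℤ (QQ × E) :=
  (Submodule.span ℤ (Set.range (dpPair f g))).toSubalgebra
    (Submodule.subset_span ⟨0, by
      ext1
      · rw [dpPair_fst]; simp
      · simp [dpPair, hf.zero, hg.zero]⟩)
    (fun x y hx hy => by
      induction hx using Submodule.span_induction with
      | zero => rw [zero_mul]; exact zero_mem _
      | add x x' _ _ h h' => rw [add_mul]; exact add_mem h h'
      | smul c x _ h => rw [smul_mul_assoc]; exact Submodule.smul_mem _ _ h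
      | mem x hx =>
        obtain ⟨s, rfl⟩ := hx
        induction hy using Submodule.span_induction with
        | zero => rw [mul_zero]; exact zero_mem _
        | add x x' _ _ h h' => rw [mul_add]; exact add_mem h h'
        | smul c x _ h => rw [mul_smul_comm]; exact Submodule.smul_mem _ _ h
        | mem y hy =>
          obtain ⟨t, rfl⟩ := hy
          rw [dpPair_mul hf hg]
          exact Submodule.smul_mem _ _ (Submodule.subset_span ⟨_, rfl⟩))

lemma mem_dpGraph_left {f g : ℕ → E} (hf : IsExpSeq f) (hg : IsExpSeq g) (i : ℕ) :
    (dpQ (MvPolynomial.X 0) i, f i) ∈ dpGraph hf hg :=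
  Submodule.subset_span ⟨Finsupp.single 0 i, by simp [dpPair, hg.zero, dpQ_eq]⟩

lemma mem_dpGraph_right {f g : ℕ → E} (hf : IsExpSeq f) (hg : IsExpSeq g) (i : ℕ) :
    (dpQ (MvPolynomial.X 1) i, g i) ∈ dpGraph hf hg :=
  Submodule.subset_span ⟨Finsupp.single 1 i, by simp [dpPair, hf.zero, dpQ_eq]⟩

/-- The divided power monomials are ℤ-independent in ℚ[X_0, X_1], so an integral combination with
first component 0 is trivial and has second component 0. Thus an identity proved with denominators
over ℚ holds in a ring E of any characteristic, provided that both sides are followed inside the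
graph. -/
lemma eq_of_mem_dpGraph {f g : ℕ → E} {hf : IsExpSeq f} {hg : IsExpSeq g} {q : QQ} {x y : E}
    (hx : (q, x) ∈ dpGraph hf hg) (hy : (q, y) ∈ dpGraph hf hg) : x = y := by
  have h := sub_mem hx hy
  rw [Prod.mk_sub_mk, sub_self] at h
  obtain ⟨c, hc⟩ := Finsupp.mem_span_range_iff_exists_finsupp.1 h
  have h1 : c.sum (fun s a => a • (dpPair f g s).1) = 0 := by
    have := congrArg Prod.fst hc
    rwa [Finsupp.sum, Prod.fst_sum] at this
  have hc0 : c = 0 := by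
    ext s
    have := congrArg (MvPolynomial.coeff s) h1
    rw [Finsupp.sum, MvPolynomial.coeff_sum, Finset.sum_eq_single s] at this
    · rw [dpPair_fst, ← Int.cast_smul_eq_zsmul ℚ, MvPolynomial.coeff_smul,
        MvPolynomial.coeff_monomial, if_pos rfl, MvPolynomial.coeff_zero, smul_eq_mul] at this
      have h1 : ((s 0).factorial : ℚ) ≠ 0 := by positivity
      have h2 : ((s 1).factorial : ℚ) ≠ 0 := by positivity
      have := (mul_eq_zero.1 this).resolve_right (by positivity)
      exact_mod_cast this
    · intro t _ hts
      rw [dpPair_fst, ← Int.cast_smul_eq_zsmul ℚ, MvPolynomial.coeff_smul,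
        MvPolynomial.coeff_monomial, if_neg hts, smul_zero]
    · intro hs
      rw [Finsupp.notMem_support_iff.1 hs, zero_smul, MvPolynomial.coeff_zero]
  rw [hc0, Finsupp.sum_zero_index] at hc
  exact sub_eq_zero.1 (congrArg Prod.snd hc).symm

lemma mem_dpGraph_conv {f g : ℕ → E} (hf : IsExpSeq f) (hg : IsExpSeq g) (i : ℕ) :
    (dpQ (MvPolynomial.X 0 + MvPolynomial.X 1) i,
      ∑ ab ∈ antidiagonal i, f ab.1 * g ab.2) ∈ dpGraph hf hg := by
  rw [dpQ_add]
  have := sum_mem (S := dpGraph hf hg) (t := antidiagonal i) (f := fun ab =>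
    (dpQ (MvPolynomial.X 0) ab.1, f ab.1) * (dpQ (MvPolynomial.X 1) ab.2, g ab.2))
    fun ab _ => mul_mem (mem_dpGraph_left hf hg _) (mem_dpGraph_right hf hg _)
  rwa [show ∑ ab ∈ antidiagonal i, (dpQ (MvPolynomial.X 0) ab.1, f ab.1) *
      (dpQ (MvPolynomial.X 1) ab.2, g ab.2) = ((_ : QQ), (_ : E)) from
    Prod.ext Prod.fst_sum Prod.snd_sum] at this

/-- The convolution corresponds to the divided powers of X_0 + X_1, for which the product rule holds
over ℚ. -/
lemma IsExpSeq.conv {f g : ℕ → E} (hf : IsExpSeq f) (hg : IsExpSeq g) :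
    IsExpSeq fun i => ∑ ab ∈ antidiagonal i, f ab.1 * g ab.2 where
  zero := by simp [hf.zero, hg.zero]
  mul i j := by
    have h1 := mul_mem (mem_dpGraph_conv hf hg i) (mem_dpGraph_conv hf hg j)
    have h2 := nsmul_mem (mem_dpGraph_conv hf hg (i + j)) ((i + j).choose i)
    rw [Prod.mk_mul_mk, dpQ_mul] at h1
    exact eq_of_mem_dpGraph h1 h2

/-- The pairs of power series whose pairs of coefficients lie in `dpGraph`. -/
def dpSeries {f g : ℕ → E} (hf : IsExpSeq f) (hg : IsExpSeq g) : Submonoid (QQ⟦X⟧ × E⟦X⟧) where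
  carrier := {z | ∀ i, (coeff i z.1, coeff i z.2) ∈ dpGraph hf hg}
  one_mem' i := by
    simp only [Prod.fst_one, Prod.snd_one, coeff_one]
    split_ifs
    · exact one_mem _
    · exact zero_mem _
  mul_mem' {y z} hy hz i := by
    simp only [Prod.fst_mul, Prod.snd_mul, coeff_mul]
    have := sum_mem (S := dpGraph hf hg) (t := antidiagonal i) (f := fun ab =>
      (coeff ab.1 y.1, coeff ab.1 y.2) * (coeff ab.2 z.1, coeff ab.2 z.2))
      fun ab _ => mul_mem (hy _) (hz _)
    rwa [show ∑ ab ∈ antidiagonal i, (coeff ab.1 y.1, coeff ab.1 y.2) *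
        (coeff ab.2 z.1, coeff ab.2 z.2) = ((_ : QQ), (_ : E)) from
      Prod.ext Prod.fst_sum Prod.snd_sum] at this

lemma mem_dpSeries_iff {f g : ℕ → E} {hf : IsExpSeq f} {hg : IsExpSeq g} {q : QQ} {s : E⟦X⟧} :
    (rescale q (exp QQ), s) ∈ dpSeries hf hg ↔ ∀ i, (dpQ q i, coeff i s) ∈ dpGraph hf hg :=
  Iff.rfl

lemma prod_rescale_exp {Q ι : Type*} [CommRing Q] [Algebra ℚ Q] (s : Finset ι) (x : ι → Q) :
    ∏ a ∈ s, rescale (x a) (exp Q) = rescale (∑ a ∈ s, x a) (exp Q) := by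
  classical
  induction s using Finset.induction_on with
  | empty => simp [constantCoeff_exp]
  | insert a s ha ih => rw [Finset.prod_insert ha, Finset.sum_insert ha, ih,
      exp_mul_exp_eq_exp_add]

lemma prod_mk {ι M N : Type*} [CommMonoid M] [CommMonoid N] (s : Finset ι) (x : ι → M)
    (y : ι → N) : ∏ a ∈ s, (x a, y a) = (∏ a ∈ s, x a, ∏ a ∈ s, y a) :=
  Prod.ext Prod.fst_prod Prod.snd_prod

/-- The divided powers of a divided power of a sum. -/
lemma coeff_prod_dpComp {f g : ℕ → E} (hf : IsExpSeq f) (hg : IsExpSeq g) {h : ℕ} (hh : 1 ≤ h)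
    (φ : ℕ × ℕ → E⟦X⟧)
    (h1 : ∀ ab ∈ antidiagonal h, 1 ≤ ab.2 → ∀ i,
      coeff i (φ ab) = f ab.1 ^ i * (dpComp ab.2 i • g (ab.2 * i)))
    (h2 : ∀ i, coeff i (φ (h, 0)) = dpComp h i • f (h * i)) (i : ℕ) :
    coeff i (∏ ab ∈ antidiagonal h, φ ab) =
      dpComp h i • ∑ ab ∈ antidiagonal (h * i), f ab.1 * g ab.2 := by
  -- Each factor φ(a, b) is the counterpart in E of exp(X_0^{(a)} X_1^{(b)} t). If b = 0, the
  -- divided power falls on the first sequence instead of the second, whence the separate hypothesis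
  -- `h2`.
  have hS : ∀ ab ∈ antidiagonal h, (rescale (dpQ (MvPolynomial.X 0) ab.1 *
      dpQ (MvPolynomial.X 1) ab.2) (exp QQ), φ ab) ∈ dpSeries hf hg := by
    rintro ⟨a, b⟩ hab
    rw [mem_dpSeries_iff]
    intro i
    by_cases hb : 1 ≤ b
    · rw [h1 _ hab hb, dpQ_mul_left, dpQ_dpQ _ hb]
      have h5 := mul_mem (pow_mem (mem_dpGraph_left hf hg a) i)
        (nsmul_mem (mem_dpGraph_right hf hg (b * i)) (dpComp b i))
      rwa [Prod.pow_mk, Prod.smul_mk, Prod.mk_mul_mk] at h5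
    · have hb0 : b = 0 := by omega
      have ha : a = h := by
        have := mem_antidiagonal.1 hab
        omega
      have h0 : dpQ (MvPolynomial.X 1 : QQ) 0 = 1 := by simp [dpQ_eq]
      rw [ha, hb0, h2, h0, mul_one, dpQ_dpQ _ hh]
      have h5 := nsmul_mem (mem_dpGraph_left hf hg (h * i)) (dpComp h i)
      rwa [Prod.smul_mk] at h5
  have h3 := prod_mem (S := dpSeries hf hg) hS
  -- Over ℚ the exponentials multiply to exp((X_0 + X_1)^{(h)} t), whose coefficients are iterated
  -- divided powers of X_0 + X_1.
  rw [prod_mk, prod_rescale_exp, ← dpQ_add, mem_dpSeries_iff] at h3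
  have h4 := h3 i
  rw [dpQ_dpQ _ hh] at h4
  exact eq_of_mem_dpGraph h4 (nsmul_mem (mem_dpGraph_conv hf hg (h * i)) (dpComp h i))

/-- The power series whose coefficients form an exponential sequence. -/
def expSubmonoid (E : Type*) [CommRing E] : Submonoid E⟦X⟧ where
  carrier := {f | IsExpSeq fun i => coeff i f}
  one_mem' :=
    { zero := by simp
      mul := fun i j => by
        simp only [coeff_one]
        by_cases hi : i = 0
        · subst hi; simp
        · simp [hi] }
  mul_mem' {f g} hf hg := by
    have := IsExpSeq.conv hf hg
    simp only [← coeff_mul] at this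
    exact this

/-- The module of exponential sequences. -/
def ExpMod (E : Type*) [CommRing E] : Type _ := Additive (expSubmonoid E)

/-! ### The module of exponential sequences, and sequences that vanish from index 2 on -/

namespace ExpMod

instance : AddCommMonoid (ExpMod E) := inferInstanceAs (AddCommMonoid (Additive (expSubmonoid E)))

/-- The power series of an exponential sequence. -/
def ser (f : ExpMod E) : E⟦X⟧ := (Additive.toMul (show Additive (expSubmonoid E) from f)).1

/-- The terms of an exponential sequence. -/
def cf (f : ExpMod E) (i : ℕ) : E := coeff i f.ser

lemma isExpSeq (f : ExpMod E) : IsExpSeq f.cf :=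
  (Additive.toMul (show Additive (expSubmonoid E) from f)).2

/-- The element of `ExpMod E` given by an exponential sequence. -/
def mk (e : ℕ → E) (he : IsExpSeq e) : ExpMod E :=
  Additive.ofMul (⟨PowerSeries.mk e, by simpa [expSubmonoid] using he⟩ : expSubmonoid E)

@[simp] lemma cf_mk (e : ℕ → E) (he : IsExpSeq e) (i : ℕ) : (mk e he).cf i = e i :=
  coeff_mk i e

@[ext] lemma ext {f g : ExpMod E} (h : ∀ i, f.cf i = g.cf i) : f = g :=
  Subtype.ext (PowerSeries.ext h)

lemma ser_add (f g : ExpMod E) : (f + g).ser = f.ser * g.ser := rfl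

lemma ser_zero : (0 : ExpMod E).ser = 1 := rfl

lemma ser_sum {ι : Type*} (s : Finset ι) (f : ι → ExpMod E) :
    (∑ i ∈ s, f i).ser = ∏ i ∈ s, (f i).ser := by
  classical
  induction s using Finset.induction_on with
  | empty => rfl
  | insert a s ha ih => rw [Finset.sum_insert ha, Finset.prod_insert ha, ser_add, ih]

lemma cf_add (f g : ExpMod E) (i : ℕ) :
    (f + g).cf i = ∑ ab ∈ antidiagonal i, f.cf ab.1 * g.cf ab.2 :=
  coeff_mul i f.ser g.ser

@[simp] lemma cf_zero_right (f : ExpMod E) : f.cf 0 = 1 := f.isExpSeq.zero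

lemma cf_one_add (f g : ExpMod E) : (f + g).cf 1 = f.cf 1 + g.cf 1 := by
  rw [cf_add, Finset.Nat.sum_antidiagonal_eq_sum_range_succ_mk]
  simp [Finset.sum_range_succ, add_comm]

lemma cf_zero (i : ℕ) : (0 : ExpMod E).cf i = if i = 0 then 1 else 0 := by
  rw [cf, ser_zero, coeff_one]

lemma cf_zero_of_pos {i : ℕ} (hi : 0 < i) : (0 : ExpMod E).cf i = 0 := by
  rw [cf_zero, if_neg hi.ne']

instance : SMul E (ExpMod E) where
  smul a f := mk (fun i => a ^ i * f.cf i)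
    { zero := by simp
      mul := fun i j => by
        rw [mul_mul_mul_comm, f.isExpSeq.mul, ← pow_add, mul_smul_comm] }

@[simp] lemma cf_smul (a : E) (f : ExpMod E) (i : ℕ) : (a • f).cf i = a ^ i * f.cf i :=
  cf_mk _ _ i

/-- Additivity in the scalar is the binomial theorem, the binomial coefficients being absorbed by
f_j f_{i-j} = C(i,j) f_i. The action encodes the rule (ax)^{(i)} = a^i x^{(i)}. -/
instance : Module E (ExpMod E) where
  one_smul f := by ext i; simp
  mul_smul a b f := by ext i; simp [mul_pow, mul_assoc]
  smul_zero a := by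
    ext i
    by_cases hi : i = 0 <;> simp [cf_zero, hi]
  smul_add a f g := by
    ext i
    rw [cf_smul, cf_add, cf_add, Finset.mul_sum]
    refine Finset.sum_congr rfl fun ab hab => ?_
    rw [← mem_antidiagonal.1 hab, cf_smul, cf_smul]
    ring
  add_smul a b f := by
    ext i
    rw [cf_add, cf_smul, add_pow, Finset.sum_mul, Finset.Nat.sum_antidiagonal_eq_sum_range_succ_mk]
    refine Finset.sum_congr rfl fun j hj => ?_
    have hj' : j + (i - j) = i := by
      have := Finset.mem_range.1 hj
      omega
    rw [cf_smul, cf_smul, mul_mul_mul_comm, f.isExpSeq.mul, hj', nsmul_eq_mul]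
    ring
  zero_smul f := by
    ext i
    by_cases hi : i = 0 <;> simp [cf_zero, hi]

/-- The sequence `1, z, 0, 0, …` for an element `z` of square zero. -/
def lin (z : E) (hz : z * z = 0) : ExpMod E :=
  mk (fun i => if i = 0 then 1 else if i = 1 then z else 0)
    { zero := by simp
      mul := fun i j => by
        rcases i with _ | _ | i
        · simp
        · rcases j with _ | _ | j <;> simp [hz]
        · simp; omega }

@[simp] lemma cf_lin_one (z : E) (hz : z * z = 0) : (lin z hz).cf 1 = z := by simp [lin]

lemma cf_lin_of_two_le (z : E) (hz : z * z = 0) {i : ℕ} (hi : 2 ≤ i) : (lin z hz).cf i = 0 := by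
  rw [lin, cf_mk, if_neg (by omega), if_neg (by omega)]

lemma _root_.GenTaylor.IsExpSeq.map {E' : Type*} [CommRing E'] {e : ℕ → E} (he : IsExpSeq e)
    (φ : E →+* E') : IsExpSeq fun i => φ (e i) where
  zero := by rw [he.zero, map_one]
  mul i j := by rw [← map_mul, he.mul, map_nsmul]

/-- Base change of exponential sequences. -/
def map {E' : Type*} [CommRing E'] (φ : E →+* E') : ExpMod E →+ ExpMod E' where
  toFun f := mk (fun i => φ (f.cf i)) (f.isExpSeq.map φ)
  map_zero' := by
    ext i
    by_cases hi : i = 0 <;> simp [cf_zero, hi]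
  map_add' f g := by
    ext i
    simp [cf_add]

@[simp] lemma cf_map {E' : Type*} [CommRing E'] (φ : E →+* E') (f : ExpMod E) (i : ℕ) :
    (map φ f).cf i = φ (f.cf i) := cf_mk _ (f.isExpSeq.map φ) i

lemma map_smul' {E' : Type*} [CommRing E'] (φ : E →+* E') (a : E) (f : ExpMod E) :
    map φ (a • f) = φ a • map φ f := by
  ext i; simp

/-- All terms of index at least `2` vanish. -/
def Triv (f : ExpMod E) : Prop := ∀ i, 2 ≤ i → f.cf i = 0

lemma Triv.zero : Triv (0 : ExpMod E) := fun _ hi => cf_zero_of_pos (by omega)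

lemma Triv.smul {f : ExpMod E} (hf : Triv f) (a : E) : Triv (a • f) := fun i hi => by
  rw [cf_smul, hf i hi, mul_zero]

/-- In a convolution of index at least 2, the only term not containing a vanishing entry is f_1 g_1
in index 2. -/
lemma Triv.add {f g : ExpMod E} (hf : Triv f) (hg : Triv g) (h : f.cf 1 * g.cf 1 = 0) :
    Triv (f + g) := fun i hi => by
  rw [cf_add]
  refine Finset.sum_eq_zero fun ab hab => ?_
  have := mem_antidiagonal.1 hab
  by_cases h1 : 2 ≤ ab.1
  · rw [hf _ h1, zero_mul]
  by_cases h2 : 2 ≤ ab.2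
  · rw [hg _ h2, mul_zero]
  rw [show ab.1 = 1 by omega, show ab.2 = 1 by omega, h]

lemma Triv.ext {f g : ExpMod E} (hf : Triv f) (hg : Triv g) (h : f.cf 1 = g.cf 1) : f = g := by
  ext i
  rcases i with _ | _ | i
  · simp
  · exact h
  · rw [hf _ (by omega), hg _ (by omega)]

lemma cf_one_pow (f : ExpMod E) (i : ℕ) : f.cf 1 ^ i = i.factorial • f.cf i := by
  induction i with
  | zero => simp
  | succ i ih =>
    rw [pow_succ, ih, smul_mul_assoc, f.isExpSeq.mul, smul_smul, Nat.factorial_succ,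
      Nat.choose_succ_self_right, mul_comm]

end ExpMod

end Exponential

end GenTaylor

namespace GenTaylor

/-! ### Divided powers on the specialized algebra -/

namespace Deh

open DGData

variable {k : Type v} [Field k] {n : ℕ} {A : DGData.{u, v} k n} {hA : A.IsDGAlgebra}

/-- `g` is a system of divided powers on the specialized algebra. -/
structure IsDP (hA : A.IsDGAlgebra) (g : ℕ → Deh A hA → Deh A hA) : Prop where
  zero : ∀ p, ∀ x ∈ part hA p, Even p → 0 < p → g 0 x = 1
  one : ∀ p, ∀ x ∈ part hA p, Even p → 0 < p → g 1 x = x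
  mem_bi : ∀ p m, ∀ x ∈ bi hA p m, Even p → 0 < p → ∀ i, g i x ∈ bi hA (i * p) (i • m)
  mul : ∀ p, ∀ x ∈ part hA p, Even p → 0 < p →
    ∀ h i, g h x * g i x = (h + i).choose h • g (h + i) x
  add : ∀ p, ∀ x ∈ part hA p, ∀ y ∈ part hA p, Even p → 0 < p →
    ∀ i, g i (x + y) = ∑ j ∈ Finset.range (i + 1), g j x * g (i - j) y
  mul_odd : ∀ p q, ∀ x ∈ part hA p, ∀ y ∈ part hA q, Odd p → Odd q →
    ∀ i, 2 ≤ i → g i (x * y) = 0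
  mul_even : ∀ p q, ∀ x ∈ part hA p, ∀ y ∈ part hA q, Even p → Even q → 0 < q →
    ∀ i, 2 ≤ i → g i (x * y) = x ^ i * g i y
  comp : ∀ p, ∀ x ∈ part hA p, Even p → 0 < p → ∀ h i, 1 ≤ h →
    g i (g h x) = dpComp h i • g (h * i) x
  d_succ : ∀ p, ∀ x ∈ part hA p, Even p → 0 < p → ∀ i, d hA (g (i + 1) x) = g i x * d hA x

/-! #### Specializing divided powers -/

/-- The specialization of a system of divided powers. -/
def dpOf (hA : A.IsDGAlgebra) (γ : ℕ → A.Carrier → A.Carrier) (i : ℕ) (y : Deh A hA) : Deh A hA :=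
  of hA (γ i (A.hom ((Finsupp.support (show A.B →₀ k from y)).sup A.mdeg) y))

lemma pow_monomial_smul_one (hA : A.IsDGAlgebra) (p : Poly k n) (i : ℕ) :
    A.pow (p • A.one) i = p ^ i • A.one := by
  induction i with
  | zero => rw [pow_zero, one_smul]; rfl
  | succ i ih =>
    change A.mul (p • A.one) (A.pow (p • A.one) i) = _
    rw [ih, map_smul, map_smul, LinearMap.smul_apply, hA.one_mul, smul_smul, pow_succ]

/-- `dpOf` lifts a vector in the least possible multidegree s. A lift in multidegree m is the
monomial of exponent m - s times that one, and (ay)^{(i)} = a^i y^{(i)} for a of degree 0 shows that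
their divided powers differ by a monomial, which specializes to 1. -/
lemma dpOf_of {γ : ℕ → A.Carrier → A.Carrier} (hγ : A.IsDividedPowers γ) {p : ℕ}
    {m : Fin n →₀ ℕ} {x : A.Carrier} (hx : A.Bihom p m x) (hp : Even p) (hp0 : 0 < p) (i : ℕ) :
    dpOf hA γ i (of hA x) = of hA (γ i x) := by
  set s := (Finsupp.support (show A.B →₀ k from of hA x)).sup A.mdeg with hs
  have hle : s ≤ m := Finset.sup_le fun b hb =>
    mem_leK.1 hx.ev_mem_leK b (Finsupp.mem_support_iff.1 hb)
  have hy : A.Bihom p s (A.hom s (of hA x)) := bihom_hom hx.ev_mem_partK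
    (mem_leK.2 fun b hb => Finset.le_sup (f := A.mdeg) (Finsupp.mem_support_iff.2 hb))
  have hoy : of hA (A.hom s (of hA x)) = of hA x := ev_homog _ _ _
  change of hA (γ i (A.hom s (of hA x))) = _
  set y := A.hom s (of hA x)
  have h1 : A.Bihom 0 (m - s) (MvPolynomial.monomial (m - s) (1 : k) • A.one) := by
    have := hA.one_bihom.monomial_smul (m' := m - s) 1
    rwa [add_zero] at this
  have hxy : x = A.mul (MvPolynomial.monomial (m - s) (1 : k) • A.one) y := by
    have h2 := hA.mul_bihom _ _ _ _ _ _ h1 hy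
    rw [tsub_add_cancel_of_le hle] at h2
    refine hx.ext_ev h2 ?_
    change of hA x = of hA _
    rw [of_mul, of_smul, hoy, of_one]
    simp
  -- The product rule is an axiom only from i = 2 on.
  rcases Nat.lt_or_ge i 2 with hi | hi
  · interval_cases i
    · rw [hγ.zero _ _ _ hx hp hp0, hγ.zero _ _ _ hy hp hp0]
    · rw [hγ.one _ _ _ hx hp hp0, hγ.one _ _ _ hy hp hp0, hoy]
  · conv_rhs => rw [hxy]
    rw [hγ.mul_even _ _ _ _ _ _ h1 hy Even.zero hp hp0 i hi, of_mul,
      pow_monomial_smul_one hA, of_smul, of_one]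
    simp

lemma exists_of_mem_bi₂ {p : ℕ} {x y : Deh A hA} (hx : x ∈ part hA p) (hy : y ∈ part hA p) :
    ∃ m x' y', A.Bihom p m x' ∧ A.Bihom p m y' ∧ x = of hA x' ∧ y = of hA y' := by
  obtain ⟨m, hx⟩ := exists_mem_bi hx
  obtain ⟨m', hy⟩ := exists_mem_bi hy
  obtain ⟨x', h1, h2⟩ := exists_of_mem_bi (bi_mono (m' := m ⊔ m') le_sup_left hx)
  obtain ⟨y', h3, h4⟩ := exists_of_mem_bi (bi_mono (m' := m ⊔ m') le_sup_right hy)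
  exact ⟨_, x', y', h1, h3, h2, h4⟩

lemma exists_bihom {p : ℕ} {x : Deh A hA} (hx : x ∈ part hA p) :
    ∃ m x', A.Bihom p m x' ∧ x = of hA x' := by
  obtain ⟨m, hx⟩ := exists_mem_bi hx
  exact ⟨m, exists_of_mem_bi hx⟩

theorem isDP_dpOf {γ : ℕ → A.Carrier → A.Carrier} (hγ : A.IsDividedPowers γ) :
    IsDP hA (dpOf hA γ) where
  zero p x hx hp hp0 := by
    obtain ⟨m, x, hx', rfl⟩ := exists_bihom hx
    rw [dpOf_of hγ hx' hp hp0, hγ.zero p m x hx' hp hp0, of_one]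
  one p x hx hp hp0 := by
    obtain ⟨m, x, hx', rfl⟩ := exists_bihom hx
    rw [dpOf_of hγ hx' hp hp0, hγ.one p m x hx' hp hp0]
  mem_bi p m x hx hp hp0 i := by
    obtain ⟨x, hx', rfl⟩ := exists_of_mem_bi hx
    rw [dpOf_of hγ hx' hp hp0]
    exact of_mem_bi (hγ.bihom p m x hx' hp hp0 i)
  mul p x hx hp hp0 h i := by
    obtain ⟨m, x, hx', rfl⟩ := exists_bihom hx
    rw [dpOf_of hγ hx' hp hp0, dpOf_of hγ hx' hp hp0, dpOf_of hγ hx' hp hp0, ← of_mul,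
      hγ.mul p m x hx' hp hp0, map_nsmul]
  add p x hx y hy hp hp0 i := by
    obtain ⟨m, x, y, hx', hy', rfl, rfl⟩ := exists_of_mem_bi₂ hx hy
    rw [← map_add, dpOf_of hγ (hx'.add hy') hp hp0, hγ.add p m x y hx' hy' hp hp0, map_sum]
    refine Finset.sum_congr rfl fun j _ => ?_
    rw [of_mul, dpOf_of hγ hx' hp hp0, dpOf_of hγ hy' hp hp0]
  mul_odd p q x hx y hy hp hq i hi := by
    obtain ⟨m, x, hx', rfl⟩ := exists_bihom hx
    obtain ⟨m', y, hy', rfl⟩ := exists_bihom hy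
    rw [← of_mul, dpOf_of hγ (hA.mul_bihom _ _ _ _ _ _ hx' hy') (hp.add_odd hq)
      (Nat.add_pos_left hp.pos _), hγ.mul_odd _ _ _ _ _ _ hx' hy' hp hq i hi, map_zero]
  mul_even p q x hx y hy hp hq hq0 i hi := by
    obtain ⟨m, x, hx', rfl⟩ := exists_bihom hx
    obtain ⟨m', y, hy', rfl⟩ := exists_bihom hy
    rw [← of_mul, dpOf_of hγ (hA.mul_bihom _ _ _ _ _ _ hx' hy') (hp.add hq)
      (Nat.add_pos_right _ hq0), hγ.mul_even _ _ _ _ _ _ hx' hy' hp hq hq0 i hi, of_mul, of_pow,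
      dpOf_of hγ hy' hq hq0]
  comp p x hx hp hp0 h i hh := by
    obtain ⟨m, x, hx', rfl⟩ := exists_bihom hx
    rw [dpOf_of hγ hx' hp hp0, dpOf_of hγ (hγ.bihom p m x hx' hp hp0 h) (hp.mul_left h)
      (Nat.mul_pos hh hp0), hγ.comp p m x hx' hp hp0 h i hh, map_nsmul, dpOf_of hγ hx' hp hp0]
    rfl
  d_succ p x hx hp hp0 i := by
    obtain ⟨m, x, hx', rfl⟩ := exists_bihom hx
    rw [dpOf_of hγ hx' hp hp0, dpOf_of hγ hx' hp hp0, ← of_d, ← of_d,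
      hγ.d_succ p m x hx' hp hp0, of_mul]

/-! #### Elementary consequences of the axioms -/

namespace IsDP

variable {g : ℕ → Deh A hA → Deh A hA}

lemma mem_part (hg : IsDP hA g) {p : ℕ} {x : Deh A hA} (hx : x ∈ part hA p) (hp : Even p)
    (hp0 : 0 < p) (i : ℕ) : g i x ∈ part hA (i * p) := by
  obtain ⟨m, hx⟩ := exists_mem_bi hx
  exact bi_le_part (hg.mem_bi p m x hx hp hp0 i)

lemma map_zero (hg : IsDP hA g) {i : ℕ} (hi : 0 < i) : g i 0 = 0 := by
  have h0 : (0 : Deh A hA) ∈ part hA 2 := zero_mem _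
  rcases Nat.lt_or_ge i 2 with h | h
  · obtain rfl : i = 1 := by omega
    exact hg.one 2 0 h0 even_two two_pos
  · have := hg.mul_even 2 2 0 h0 0 h0 even_two even_two two_pos i h
    rwa [mul_zero, zero_pow hi.ne', zero_mul] at this

/-- A scalar is the degree-0 element c · 1, to which the rule for a product of even elements
applies. -/
lemma smul (hg : IsDP hA g) {p : ℕ} {x : Deh A hA} (hx : x ∈ part hA p) (hp : Even p)
    (hp0 : 0 < p) (c : k) (i : ℕ) : g i (c • x) = c ^ i • g i x := by
  have hc := Submodule.smul_mem (part hA p) c hx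
  rcases Nat.lt_or_ge i 2 with h | h
  · interval_cases i
    · rw [hg.zero p x hx hp hp0, hg.zero p _ hc hp hp0, pow_zero, one_smul]
    · rw [hg.one p x hx hp hp0, hg.one p _ hc hp hp0, pow_one]
  · have h1 : c • (1 : Deh A hA) ∈ part hA 0 := Submodule.smul_mem _ c one_mem_part
    have := hg.mul_even 0 p _ h1 x hx Even.zero hp hp0 i h
    rwa [smul_mul_assoc, one_mul, smul_pow, one_pow, smul_mul_assoc, one_mul] at this

lemma mul_even' (hg : IsDP hA g) {p q : ℕ} {x y : Deh A hA} (hx : x ∈ part hA p)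
    (hy : y ∈ part hA q) (hp : Even p) (hq : Even q) (hq0 : 0 < q) (i : ℕ) :
    g i (x * y) = x ^ i * g i y := by
  rcases Nat.lt_or_ge i 2 with h | h
  · have hxy := mul_mem_part hx hy
    interval_cases i
    · rw [hg.zero _ _ hxy (hp.add hq) (Nat.add_pos_right _ hq0), hg.zero _ _ hy hq hq0, pow_zero,
        one_mul]
    · rw [hg.one _ _ hxy (hp.add hq) (Nat.add_pos_right _ hq0), hg.one _ _ hy hq hq0, pow_one]
  · exact hg.mul_even p q x hx y hy hp hq hq0 i h

end IsDP

/-! #### Lifting divided powers -/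

/-- One nonzero coefficient reveals m as m_b plus its exponent. Lifting divided powers from k
requires the multidegree to be read off the element itself. -/
lemma Bihom_mdeg_unique {p p' : ℕ} {m m' : Fin n →₀ ℕ} {x : A.Carrier} (hx : A.Bihom p m x)
    (hx' : A.Bihom p' m' x) (h0 : x ≠ 0) : m = m' := by
  obtain ⟨b, hb⟩ := Finsupp.ne_iff.1 h0
  obtain ⟨-, h1, c, h2⟩ := hx b hb
  obtain ⟨-, h3, c', h4⟩ := hx' b hb
  have hc : c ≠ 0 := by
    rintro rfl
    exact hb (by simp [h2])
  have hc' : c' ≠ 0 := by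
    rintro rfl
    exact hb (by simp [h4])
  have h5 : m - A.mdeg b = m' - A.mdeg b := by
    have h6 := congrArg (MvPolynomial.coeff (m - A.mdeg b)) (h2.symm.trans h4)
    rw [MvPolynomial.coeff_monomial, MvPolynomial.coeff_monomial, if_pos rfl] at h6
    by_contra hne
    rw [if_neg (Ne.symm hne)] at h6
    exact hc h6
  rw [← tsub_add_cancel_of_le h1, h5, tsub_add_cancel_of_le h3]

open Classical in
/-- A multidegree of a bihomogeneous element. -/
def mdegOf (x : A.Carrier) : Fin n →₀ ℕ :=
  if h : ∃ m p, A.Bihom p m x then h.choose else 0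

lemma mdegOf_eq {p : ℕ} {m : Fin n →₀ ℕ} {x : A.Carrier} (hx : A.Bihom p m x) (h0 : x ≠ 0) :
    mdegOf x = m := by
  have h : ∃ m p, A.Bihom p m x := ⟨m, p, hx⟩
  rw [mdegOf, dif_pos h]
  exact Bihom_mdeg_unique h.choose_spec.choose_spec hx h0

/-- The lift of a system of divided powers on the specialized algebra. -/
def dpLift (hA : A.IsDGAlgebra) (g : ℕ → Deh A hA → Deh A hA) (i : ℕ) (x : A.Carrier) :
    A.Carrier :=
  A.hom (i • mdegOf x) (g i (of hA x))

lemma dpLift_eq {g : ℕ → Deh A hA → Deh A hA} (hg : IsDP hA g) {p : ℕ}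
    {m : Fin n →₀ ℕ} {x : A.Carrier} (hx : A.Bihom p m x) (i : ℕ) :
    dpLift hA g i x = A.hom (i • m) (g i (of hA x)) := by
  -- Zero has every multidegree, which is harmless: for i = 0 the multidegree i • m does not depend
  -- on m, and for i > 0 the value is 0.
  by_cases h0 : x = 0
  · rcases Nat.eq_zero_or_pos i with rfl | hi
    · simp [dpLift]
    · rw [dpLift, h0, _root_.map_zero, hg.map_zero hi]
      exact (_root_.map_zero (A.hom _)).trans (_root_.map_zero (A.hom _)).symm
  · rw [dpLift, mdegOf_eq hx h0]

lemma of_dpLift (g : ℕ → Deh A hA → Deh A hA) (i : ℕ) (x : A.Carrier) :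
    of hA (dpLift hA g i x) = g i (of hA x) := ev_homog _ _ _

lemma bihom_dpLift {g : ℕ → Deh A hA → Deh A hA} (hg : IsDP hA g) {p : ℕ}
    {m : Fin n →₀ ℕ} {x : A.Carrier} (hx : A.Bihom p m x) (hp : Even p) (hp0 : 0 < p) (i : ℕ) :
    A.Bihom (i * p) (i • m) (dpLift hA g i x) := by
  rw [dpLift_eq hg hx]
  have := hg.mem_bi p m _ (of_mem_bi hx) hp hp0 i
  exact bihom_hom this.1 this.2

lemma eq_of_bihom {p p' : ℕ} {m : Fin n →₀ ℕ} {x y : A.Carrier} (hA : A.IsDGAlgebra)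
    (hx : A.Bihom p m x) (hy : A.Bihom p' m y) (h : of hA x = of hA y) : x = y :=
  hx.ext_ev hy h

lemma bihom_nsmul {p : ℕ} {m : Fin n →₀ ℕ} {x : A.Carrier} (hx : A.Bihom p m x) (c : ℕ) :
    A.Bihom p m (c • x) := by
  rw [← Nat.cast_smul_eq_nsmul (Poly k n)]
  have := hx.const_smul c
  rwa [map_natCast] at this

lemma bihom_pow (hA : A.IsDGAlgebra) {p : ℕ} {m : Fin n →₀ ℕ} {x : A.Carrier}
    (hx : A.Bihom p m x) (i : ℕ) : A.Bihom (i * p) (i • m) (A.pow x i) := by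
  induction i with
  | zero =>
    rw [zero_mul, zero_smul]
    exact hA.one_bihom
  | succ i ih =>
    rw [add_mul, one_mul, add_comm, succ_nsmul, add_comm (i • m)]
    exact hA.mul_bihom _ _ _ _ _ _ hx ih

/-- Besides bihomogeneity, which is the filtration condition `mem_bi`, each axiom equates
bihomogeneous elements of one multidegree, so its specialized version suffices. -/
theorem isDividedPowers_dpLift {g : ℕ → Deh A hA → Deh A hA} (hg : IsDP hA g) :
    A.IsDividedPowers (dpLift hA g) where
  zero p m x hx hp hp0 := by
    have h := bihom_dpLift hg hx hp hp0 0
    rw [zero_smul] at h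
    refine eq_of_bihom hA h hA.one_bihom ?_
    rw [of_dpLift, hg.zero p _ (of_mem_part hx.mem_part) hp hp0, of_one]
  one p m x hx hp hp0 := by
    have h := bihom_dpLift hg hx hp hp0 1
    rw [one_smul] at h
    refine eq_of_bihom hA h hx ?_
    rw [of_dpLift, hg.one p _ (of_mem_part hx.mem_part) hp hp0]
  bihom p m x hx hp hp0 i := bihom_dpLift hg hx hp hp0 i
  mul p m x hx hp hp0 h i := by
    have h1 := hA.mul_bihom _ _ _ _ _ _ (bihom_dpLift hg hx hp hp0 h)
      (bihom_dpLift hg hx hp hp0 i)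
    rw [← add_smul] at h1
    refine eq_of_bihom hA h1 (bihom_nsmul (bihom_dpLift hg hx hp hp0 (h + i)) _) ?_
    rw [of_mul, map_nsmul, of_dpLift, of_dpLift, of_dpLift,
      hg.mul p _ (of_mem_part hx.mem_part) hp hp0]
  add p m x y hx hy hp hp0 i := by
    refine eq_of_bihom (p' := i * p) hA (bihom_dpLift hg (hx.add hy) hp hp0 i)
      (Bihom.sum fun j hj => ?_) ?_
    · have h1 := hA.mul_bihom _ _ _ _ _ _ (bihom_dpLift hg hx hp hp0 j)
        (bihom_dpLift hg hy hp hp0 (i - j))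
      have hj : j + (i - j) = i := by
        have := Finset.mem_range.1 hj
        omega
      rwa [← add_smul, ← add_mul, hj] at h1
    · rw [of_dpLift, map_add, map_sum, hg.add p _ (of_mem_part hx.mem_part) _
        (of_mem_part hy.mem_part) hp hp0]
      simp only [of_mul, of_dpLift]
  mul_odd p q m m' x y hx hy hp hq i hi := by
    have h := bihom_dpLift hg (hA.mul_bihom _ _ _ _ _ _ hx hy) (hp.add_odd hq)
      (Nat.add_pos_left hp.pos _) i
    refine eq_of_bihom hA h (bihom_zero 0 _) ?_
    rw [of_dpLift, of_mul, hg.mul_odd p q _ (of_mem_part hx.mem_part) _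
      (of_mem_part hy.mem_part) hp hq i hi, _root_.map_zero]
  mul_even p q m m' x y hx hy hp hq hq0 i hi := by
    have h := bihom_dpLift hg (hA.mul_bihom _ _ _ _ _ _ hx hy) (hp.add hq)
      (Nat.add_pos_right _ hq0) i
    have h' := hA.mul_bihom _ _ _ _ _ _ (bihom_pow hA hx i) (bihom_dpLift hg hy hq hq0 i)
    rw [← smul_add] at h'
    refine eq_of_bihom hA h h' ?_
    rw [of_dpLift, of_mul, of_mul, of_pow, of_dpLift,
      hg.mul_even p q _ (of_mem_part hx.mem_part) _ (of_mem_part hy.mem_part) hp hq hq0 i hi]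
  comp p m x hx hp hp0 h i hh := by
    have h1 := bihom_dpLift hg (bihom_dpLift hg hx hp hp0 h) (hp.mul_left h)
      (Nat.mul_pos hh hp0) i
    rw [smul_smul, mul_comm i h] at h1
    refine eq_of_bihom hA h1 (bihom_nsmul (bihom_dpLift hg hx hp hp0 (h * i)) _) ?_
    rw [map_nsmul, of_dpLift, of_dpLift, of_dpLift,
      hg.comp p _ (of_mem_part hx.mem_part) hp hp0 h i hh]
    rfl
  d_succ p m x hx hp hp0 i := by
    obtain ⟨q, rfl⟩ : ∃ q, p = q + 1 := ⟨p - 1, by omega⟩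
    have h1 : A.Bihom ((i + 1) * (q + 1) - 1) ((i + 1) • m) (A.d (dpLift hA g (i + 1) x)) := by
      refine hA.d_bihom _ _ _ ?_
      rw [Nat.sub_add_cancel (Nat.mul_pos (by omega) hp0)]
      exact bihom_dpLift hg hx hp hp0 (i + 1)
    have h2 := hA.mul_bihom _ _ _ _ _ _ (bihom_dpLift hg hx hp hp0 i) (hA.d_bihom _ _ _ hx)
    rw [← succ_nsmul] at h2
    refine eq_of_bihom hA h1 h2 ?_
    rw [of_d, of_mul, of_d, of_dpLift, of_dpLift,
      hg.d_succ (q + 1) _ (of_mem_part hx.mem_part) hp hp0]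

/-! #### Divided powers as additive maps -/

/-- The additive map with prescribed values on the basis, compatible with scalars of `k`. -/
def gam {E : Type*} [CommRing E] [Algebra k E] (e : A.B → ExpMod E) : Deh A hA →+ ExpMod E :=
  (Finsupp.liftAddHom fun b =>
    { toFun := fun c : k => algebraMap k E c • e b
      map_zero' := by rw [_root_.map_zero, zero_smul]
      map_add' := fun c c' => by rw [map_add, add_smul] } : (A.B →₀ k) →+ ExpMod E)

lemma gam_smul_sg {E : Type*} [CommRing E] [Algebra k E] (e : A.B → ExpMod E) (c : k) (b : A.B) :
    gam e (c • sg hA b) = algebraMap k E c • e b := by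
  rw [← single_eq_smul_sg]
  exact Finsupp.liftAddHom_apply_single _ b c

lemma gam_sg {E : Type*} [CommRing E] [Algebra k E] (e : A.B → ExpMod E) (b : A.B) :
    gam e (sg hA b) = e b := by
  have := gam_smul_sg (hA := hA) e 1 b
  rwa [one_smul, map_one, one_smul] at this

lemma gam_smul {E : Type*} [CommRing E] [Algebra k E] (e : A.B → ExpMod E) (c : k)
    (x : Deh A hA) : gam e (c • x) = algebraMap k E c • gam e x := by
  refine induction (P := fun x => gam e (c • x) = algebraMap k E c • gam e x) (by simp)
    (fun c' b => ?_) (fun x y h h' => by rw [smul_add, map_add, h, h', map_add, smul_add]) x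
  rw [smul_smul, gam_smul_sg, gam_smul_sg, map_mul, mul_smul]

open Classical in
/-- The exponential sequence of the divided powers of a basis element. -/
def dpSeq {g : ℕ → Deh A hA → Deh A hA} (hg : IsDP hA g) (b : A.B) : ExpMod (evenPart hA) :=
  if h : Even (A.hdeg b) ∧ 0 < A.hdeg b then
    ExpMod.mk (fun i => ⟨g i (sg hA b), mem_evenPart (h.1.mul_left i)
        (hg.mem_part (sg_mem_part b) h.1 h.2 i)⟩)
      { zero := Subtype.ext (hg.zero _ _ (sg_mem_part b) h.1 h.2)
        mul := fun i j => Subtype.ext (hg.mul _ _ (sg_mem_part b) h.1 h.2 i j) }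
  else 0

/-- The sum rule makes the given divided powers additive as a map into `ExpMod`, so the additive map
with the same values on the basis reproduces them. -/
lemma coe_cf_gam_dpSeq {g : ℕ → Deh A hA → Deh A hA} (hg : IsDP hA g) {p : ℕ} {x : Deh A hA}
    (hx : x ∈ part hA p) (hp : Even p) (hp0 : 0 < p) (i : ℕ) :
    ((gam (dpSeq hg) x).cf i : Deh A hA) = g i x := by
  have key : ∀ x ∈ part hA p, ∀ i, ((gam (dpSeq hg) x).cf i : Deh A hA) = g i x := by
    refine part_induction (fun i => ?_) (fun c b hb i => ?_) fun x y hx hy h h' i => ?_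
    · rw [_root_.map_zero]
      rcases Nat.eq_zero_or_pos i with rfl | hi
      · rw [hg.zero p 0 (zero_mem _) hp hp0, ExpMod.cf_zero_right]; rfl
      · rw [hg.map_zero hi, ExpMod.cf_zero_of_pos hi]; rfl
    · subst hb
      rw [gam_smul_sg, ExpMod.cf_smul, dpSeq, dif_pos ⟨hp, hp0⟩, ExpMod.cf_mk,
        hg.smul (sg_mem_part b) hp hp0]
      change algebraMap k (Deh A hA) c ^ i * g i (sg hA b) = _
      rw [← map_pow, Algebra.smul_def]
    · rw [map_add, ExpMod.cf_add, hg.add p x hx y hy hp hp0,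
        Finset.Nat.sum_antidiagonal_eq_sum_range_succ_mk, AddSubmonoidClass.coe_finsetSum]
      refine Finset.sum_congr rfl fun j _ => ?_
      rw [← h, ← h']; rfl
  exact key x hx i

end Deh

end GenTaylor

namespace GenTaylor

/-! ### The specialized generalized Taylor algebra -/

namespace Deh

open DGData

/-! ### Even elements and the Leibniz rule for their powers -/

section EvenPart

variable {k : Type v} [Field k] {n : ℕ} {A : DGData.{u, v} k n} {hA : A.IsDGAlgebra}

open Classical in
/-- An element of even degree as an element of the even part. -/
def toE (x : Deh A hA) : evenPart hA := if h : x ∈ evenPart hA then ⟨x, h⟩ else 0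

lemma coe_toE {x : Deh A hA} (h : x ∈ evenPart hA) : (toE x : Deh A hA) = x := by
  rw [toE, dif_pos h]

lemma toE_coe (x : evenPart hA) : toE (x : Deh A hA) = x := Subtype.ext (coe_toE x.2)

lemma coe_toE_of_mem_part {x : Deh A hA} {p : ℕ} (h : x ∈ part hA p) (hp : Even p) :
    (toE x : Deh A hA) = x := coe_toE (mem_evenPart hp h)

lemma toE_add {x y : Deh A hA} (hx : x ∈ evenPart hA) (hy : y ∈ evenPart hA) :
    toE (x + y) = toE x + toE y :=
  Subtype.ext (by rw [coe_toE (add_mem hx hy)]; simp [coe_toE hx, coe_toE hy])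

lemma toE_smul {x : Deh A hA} (hx : x ∈ evenPart hA) (c : k) :
    toE (c • x) = algebraMap k _ c * toE x :=
  Subtype.ext (by
    rw [coe_toE (Subalgebra.smul_mem _ hx c), ← Algebra.smul_def, Subalgebra.coe_smul, coe_toE hx])

lemma toE_zero : toE (0 : Deh A hA) = 0 := toE_coe 0

lemma d_one : d hA 1 = 0 := d_eq_zero one_mem_part

lemma leibniz_even {p : ℕ} (hp : Even p) {x : Deh A hA} (hx : x ∈ part hA p) (y : Deh A hA) :
    d hA (x * y) = d hA x * y + x * d hA y := by
  rw [leibniz hx, hp.neg_one_pow, one_smul]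

lemma d_pow_succ {p : ℕ} (hp : Even p) {x : Deh A hA} (hx : x ∈ part hA p) (i : ℕ) :
    d hA (x ^ (i + 1)) = (i + 1) • (x ^ i * d hA x) := by
  induction i with
  | zero => simp
  | succ i ih =>
    have hc := (commute_of_mem_part hp hx (d hA x)).eq
    rw [pow_succ, leibniz_even (hp.mul_left (i + 1)) (pow_mem_part hx _), ih, smul_mul_assoc,
      mul_assoc, ← hc, ← mul_assoc, ← pow_succ]
    exact (succ_nsmul (x ^ (i + 1) * d hA x) (i + 1)).symm

end EvenPart

/-! ### Tensors over the specialized factors -/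

variable {k : Type v} [Field k] {n r : ℕ} {F : Fin r → DGData.{u, v} k n}
  (hF : ∀ l, (F l).IsDGAlgebra)

/-- The tensor `f_1 ⊗ ⋯ ⊗ f_r`. -/
def tn (f : ∀ l, Deh (F l) (hF l)) : Deh (genTaylor F) (isDGAlgebra_genTaylor hF) :=
  tk (B := fun l => (F l).B) f

variable {hF}

lemma tn_update_add (f : ∀ l, Deh (F l) (hF l)) (i : Fin r) (x y : Deh (F i) (hF i)) :
    tn hF (Function.update f i (x + y)) =
      tn hF (Function.update f i x) + tn hF (Function.update f i y) :=
  tk_update_add (B := fun l => (F l).B) f i x y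

lemma tn_update_smul (f : ∀ l, Deh (F l) (hF l)) (i : Fin r) (c : k) (x : Deh (F i) (hF i)) :
    tn hF (Function.update f i (c • x)) = c • tn hF (Function.update f i x) :=
  tk_update_smul (B := fun l => (F l).B) f i c x

lemma tn_eq_zero {f : ∀ l, Deh (F l) (hF l)} (i : Fin r) (h : f i = 0) : tn hF f = 0 :=
  tk_eq_zero (B := fun l => (F l).B) i h

lemma tn_sg (J : ∀ l, (F l).B) : tn hF (fun l => sg (hF l) (J l)) =
    sg (isDGAlgebra_genTaylor hF) J :=
  tk_single J

lemma tn_one : tn hF 1 = 1 := oneK_genTaylor.symm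

lemma of_star (m : Fin r → (Fin n →₀ ℕ)) (f : ∀ l, (F l).Carrier) :
    of (isDGAlgebra_genTaylor hF) (star F m f) = tn hF fun l => of (hF l) (f l) :=
  ev_tens _ f

lemma tn_mem_bi {p : Fin r → ℕ} {m : Fin r → (Fin n →₀ ℕ)} {f : ∀ l, Deh (F l) (hF l)}
    (hf : ∀ l, f l ∈ bi (hF l) (p l) (m l)) :
    tn hF f ∈ bi (isDGAlgebra_genTaylor hF) (∑ l, p l) (Finset.univ.sup m) :=
  ⟨tk_mem_partK fun l => (hf l).1, tk_mem_leK fun l => (hf l).2⟩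

lemma tn_mem_part {p : Fin r → ℕ} {f : ∀ l, Deh (F l) (hF l)}
    (hf : ∀ l, f l ∈ part (hF l) (p l)) :
    tn hF f ∈ part (isDGAlgebra_genTaylor hF) (∑ l, p l) :=
  tk_mem_partK hf

lemma tn_mul {p q : Fin r → ℕ} {f g : ∀ l, Deh (F l) (hF l)}
    (hf : ∀ l, f l ∈ part (hF l) (p l)) (hg : ∀ l, g l ∈ part (hF l) (q l)) :
    tn hF f * tn hF g = (-1 : k) ^ sgnM p q • tn hF (f * g) :=
  mulK_tk hf hg

lemma d_tn {p : Fin r → ℕ} {f : ∀ l, Deh (F l) (hF l)} (hf : ∀ l, f l ∈ part (hF l) (p l)) :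
    d (isDGAlgebra_genTaylor hF) (tn hF f) =
      ∑ i, (-1 : k) ^ sgnD p i • tn hF (Function.update f i (d (hF i) (f i))) :=
  dK_tk hf

lemma mul_mem_part_pi {p q : Fin r → ℕ} {f g : ∀ l, Deh (F l) (hF l)}
    (hf : ∀ l, f l ∈ part (hF l) (p l)) (hg : ∀ l, g l ∈ part (hF l) (q l)) (l : Fin r) :
    (f * g) l ∈ part (hF l) ((p + q) l) :=
  mul_mem_part (hf l) (hg l)

lemma pow_mem_part_pi {p : Fin r → ℕ} {f : ∀ l, Deh (F l) (hF l)}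
    (hf : ∀ l, f l ∈ part (hF l) (p l)) (i : ℕ) (l : Fin r) :
    (f ^ i) l ∈ part (hF l) (i * p l) :=
  pow_mem_part (hf l) i

lemma update_mem_part {p : Fin r → ℕ} {f : ∀ l, Deh (F l) (hF l)}
    (hf : ∀ l, f l ∈ part (hF l) (p l)) (i : Fin r) {q : ℕ} {x : Deh (F i) (hF i)}
    (hx : x ∈ part (hF i) q) (l : Fin r) :
    Function.update f i x l ∈ part (hF l) (Function.update p i q l) :=
  update_mem_partK hf i hx l

lemma update_mem_part_self {p : Fin r → ℕ} {f : ∀ l, Deh (F l) (hF l)}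
    (hf : ∀ l, f l ∈ part (hF l) (p l)) (i : Fin r) {x : Deh (F i) (hF i)}
    (hx : x ∈ part (hF i) (p i)) (l : Fin r) :
    Function.update f i x l ∈ part (hF l) (p l) := by
  have := update_mem_part hf i hx l
  rwa [Function.update_eq_self] at this

lemma one_mem_part_pi (l : Fin r) : (1 : ∀ l, Deh (F l) (hF l)) l ∈ part (hF l) 0 :=
  one_mem_part

lemma sg_mem_part_pi (J : ∀ l, (F l).B) (l : Fin r) :
    sg (hF l) (J l) ∈ part (hF l) ((F l).hdeg (J l)) :=
  sg_mem_part _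

lemma even_sgnM_left {p : Fin r → ℕ} (hp : ∀ l, Even (p l)) (q : Fin r → ℕ) :
    Even (sgnM p q) :=
  Finset.even_sum _ fun _ _ => (Finset.even_sum _ fun l _ => hp l).mul_left _

lemma tn_mul_even {p q : Fin r → ℕ} {f g : ∀ l, Deh (F l) (hF l)}
    (hf : ∀ l, f l ∈ part (hF l) (p l)) (hg : ∀ l, g l ∈ part (hF l) (q l))
    (hp : ∀ l, Even (p l)) : tn hF f * tn hF g = tn hF (f * g) := by
  rw [tn_mul hf hg, (even_sgnM_left hp q).neg_one_pow, one_smul]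

lemma tn_pow {p : Fin r → ℕ} {f : ∀ l, Deh (F l) (hF l)}
    (hf : ∀ l, f l ∈ part (hF l) (p l)) (hp : ∀ l, Even (p l)) (i : ℕ) :
    tn hF f ^ i = tn hF (f ^ i) := by
  induction i with
  | zero => rw [pow_zero, pow_zero, tn_one]
  | succ i ih =>
    rw [pow_succ, pow_succ, ih, tn_mul_even (pow_mem_part_pi hf i) hf fun l => (hp l).mul_left i]

/-- Induction for multiadditive statements on tuples of homogeneous elements. -/
lemma tuple_induction {p : Fin r → ℕ} {P : (∀ l, Deh (F l) (hF l)) → Prop}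
    (hs : ∀ K : ∀ l, (F l).B, (∀ l, (F l).hdeg (K l) = p l) → P fun l => sg (hF l) (K l))
    (h0 : ∀ f i, (∀ l, f l ∈ part (hF l) (p l)) → f i = 0 → P f)
    (hc : ∀ f i (c : k), (∀ l, f l ∈ part (hF l) (p l)) → P f → P (Function.update f i (c • f i)))
    (ha : ∀ f i x y, (∀ l, f l ∈ part (hF l) (p l)) → x ∈ part (hF i) (p i) →
      y ∈ part (hF i) (p i) → P (Function.update f i x) → P (Function.update f i y) →
      P (Function.update f i (x + y))) :
    ∀ f, (∀ l, f l ∈ part (hF l) (p l)) → P f := by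
  -- The induction is on the set of slots that may still hold a non-basis vector; one slot is
  -- expanded at a time.
  have key : ∀ (s : Finset (Fin r)) (f : ∀ l, Deh (F l) (hF l)), (∀ l, f l ∈ part (hF l) (p l)) →
      (∀ l ∉ s, ∃ b, (F l).hdeg b = p l ∧ f l = sg (hF l) b) → P f := by
    intro s
    induction s using Finset.induction_on with
    | empty =>
      intro f _ h
      choose K hK hK' using fun l => h l (Finset.notMem_empty l)
      rw [show f = fun l => sg (hF l) (K l) from funext hK']
      exact hs K hK
    | insert a s ha' ih =>
      intro f hf h
      have : ∀ x ∈ part (hF a) (p a), P (Function.update f a x) := by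
        refine part_induction ?_ (fun c b hb => ?_) fun x y hx hy h1 h2 => ha f a x y hf hx hy h1 h2
        · exact h0 _ a (update_mem_part_self hf a (zero_mem _)) (by simp)
        · have hb' : sg (hF a) b ∈ part (hF a) (p a) := hb ▸ sg_mem_part b
          have h1 := hc (Function.update f a (sg (hF a) b)) a c (update_mem_part_self hf a hb')
            (ih _ (update_mem_part_self hf a hb') fun l hl => ?_)
          · simpa using h1
          · by_cases hla : l = a
            · subst hla
              exact ⟨b, hb, by simp⟩
            · rw [Function.update_of_ne hla]
              exact h l (by simp [hla, hl])
      have h1 := this (f a) (hf a)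
      rwa [Function.update_eq_self] at h1
  exact fun f hf => key Finset.univ f hf fun l hl => (hl (Finset.mem_univ l)).elim

/-! #### The inclusions -/

lemma sgnM_single_single (l : Fin r) (a b : ℕ) :
    sgnM (Pi.single l a) (Pi.single l b) = 0 := by
  refine Finset.sum_eq_zero fun i _ => ?_
  by_cases hi : i = l
  · subst hi
    rw [Finset.sum_eq_zero, mul_zero]
    intro j hj
    rw [Pi.single_eq_of_ne (Finset.mem_filter.1 hj).2.ne']
  · rw [Pi.single_eq_of_ne hi, zero_mul]

lemma update_one_mem_part (l : Fin r) {p : ℕ} {x : Deh (F l) (hF l)} (hx : x ∈ part (hF l) p)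
    (i : Fin r) : Function.update (1 : ∀ l, Deh (F l) (hF l)) l x i ∈
      part (hF i) ((Pi.single l p : Fin r → ℕ) i) :=
  update_mem_part one_mem_part_pi l hx i

lemma update_mul_update (f g : ∀ l, Deh (F l) (hF l)) (l : Fin r) (x y : Deh (F l) (hF l)) :
    Function.update f l x * Function.update g l y = Function.update (f * g) l (x * y) := by
  ext1 i
  by_cases hi : i = l
  · subst hi; simp
  · simp [Function.update_of_ne hi]

lemma update_pow (f : ∀ l, Deh (F l) (hF l)) (l : Fin r) (x : Deh (F l) (hF l)) (i : ℕ) :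
    Function.update f l x ^ i = Function.update (f ^ i) l (x ^ i) := by
  ext1 a
  by_cases ha : a = l
  · subst ha; simp
  · simp [Function.update_of_ne ha]

variable (hF) in
/-- The inclusion of the `l`-th factor. -/
def iotaLin (l : Fin r) :
    Deh (F l) (hF l) →ₗ[k] Deh (genTaylor F) (isDGAlgebra_genTaylor hF) where
  toFun x := tn hF (Function.update 1 l x)
  map_add' := tn_update_add 1 l
  map_smul' := tn_update_smul 1 l

lemma iotaLin_apply (l : Fin r) (x : Deh (F l) (hF l)) :
    iotaLin hF l x = tn hF (Function.update 1 l x) := rfl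

variable (hF) in
/-- The inclusion of the `l`-th factor. -/
def iota (l : Fin r) :
    Deh (F l) (hF l) →ₐ[k] Deh (genTaylor F) (isDGAlgebra_genTaylor hF) :=
  AlgHom.ofLinearMap (iotaLin hF l)
    ((congrArg (tn hF) (Function.update_eq_self l 1)).trans tn_one)
    (by
      intro x y
      -- The product formula for tensors needs homogeneous entries, hence the passage to basis
      -- vectors; its sign is trivial because both tensors are concentrated in slot l.
      refine induction (P := fun x => iotaLin hF l (x * y) = iotaLin hF l x * iotaLin hF l y)
        (by simp) (fun c b => ?_) (fun x x' h h' => by rw [add_mul, map_add, h, h', map_add,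
          add_mul]) x
      refine induction (P := fun y => iotaLin hF l (c • sg (hF l) b * y) =
          iotaLin hF l (c • sg (hF l) b) * iotaLin hF l y)
        (by simp) (fun c' b' => ?_) (fun x x' h h' => by rw [mul_add, map_add, h, h', map_add,
          mul_add]) y
      rw [smul_mul_smul_comm, map_smul, map_smul, map_smul, smul_mul_smul_comm, iotaLin_apply,
        iotaLin_apply, iotaLin_apply,
        tn_mul (update_one_mem_part l (sg_mem_part b)) (update_one_mem_part l (sg_mem_part b')),
        sgnM_single_single, pow_zero, one_smul, update_mul_update, one_mul])

lemma iota_apply (l : Fin r) (x : Deh (F l) (hF l)) :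
    iota hF l x = tn hF (Function.update 1 l x) := rfl

lemma iota_mem_part (l : Fin r) {p : ℕ} {x : Deh (F l) (hF l)} (hx : x ∈ part (hF l) p) :
    iota hF l x ∈ part (isDGAlgebra_genTaylor hF) p := by
  have := tn_mem_part (update_one_mem_part l hx)
  rwa [Finset.sum_pi_single' l p Finset.univ, if_pos (Finset.mem_univ l)] at this

lemma iota_mem_evenPart (l : Fin r) {x : Deh (F l) (hF l)} (hx : x ∈ evenPart (hF l)) :
    iota hF l x ∈ evenPart (isDGAlgebra_genTaylor hF) :=
  even_induction (P := fun x => iota hF l x ∈ evenPart (isDGAlgebra_genTaylor hF))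
    (by rw [map_zero]; exact zero_mem _)
    (fun c b hb => by
      rw [map_smul]
      exact Subalgebra.smul_mem _ (mem_evenPart hb (iota_mem_part l (sg_mem_part b))) c)
    (fun x y hx hy => by rw [map_add]; exact add_mem hx hy) hx

variable (hF) in
/-- The inclusion of the even part of the `l`-th factor. -/
def iotaE (l : Fin r) : evenPart (hF l) →+* evenPart (isDGAlgebra_genTaylor hF) :=
  (((iota hF l).comp (evenPart (hF l)).val).codRestrict (evenPart (isDGAlgebra_genTaylor hF))
    fun x => iota_mem_evenPart l x.2).toRingHom

@[simp] lemma coe_iotaE (l : Fin r) (x : evenPart (hF l)) :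
    (iotaE hF l x : Deh (genTaylor F) (isDGAlgebra_genTaylor hF)) = iota hF l x := rfl

lemma iota_d (l : Fin r) (x : Deh (F l) (hF l)) :
    iota hF l (d (hF l) x) = d (isDGAlgebra_genTaylor hF) (iota hF l x) := by
  refine induction (P := fun x => iota hF l (d (hF l) x) =
      d (isDGAlgebra_genTaylor hF) (iota hF l x)) (by simp) (fun c b => ?_)
    (fun x y h h' => by simp only [map_add, h, h']) x
  rw [map_smul, map_smul, map_smul, map_smul, iota_apply l (sg (hF l) b),
    d_tn (update_one_mem_part l (sg_mem_part b)), Finset.sum_eq_single l]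
  · have : sgnD (Pi.single l ((F l).hdeg b)) l = 0 := Finset.sum_eq_zero fun j hj => by
      rw [Pi.single_eq_of_ne (Finset.mem_filter.1 hj).2.ne]
    rw [this, pow_zero, one_smul, Function.update_self, Function.update_idem, iota_apply]
  · intro j _ hj
    rw [tn_eq_zero j, smul_zero]
    rw [Function.update_self, Function.update_of_ne hj]
    exact d_one
  · simp

/-- The tensor with the `j`-th factor removed. -/
lemma tn_eq_rest_mul_iota {p : Fin r → ℕ} {f : ∀ l, Deh (F l) (hF l)}
    (hf : ∀ l, f l ∈ part (hF l) (p l)) (j : Fin r) :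
    tn hF (Function.update f j 1) * iota hF j (f j) =
      (-1 : k) ^ sgnM (Function.update p j 0) (Pi.single j (p j)) • tn hF f := by
  rw [iota_apply, tn_mul (update_mem_part hf j one_mem_part) (update_one_mem_part j (hf j)),
    update_mul_update, mul_one, one_mul, Function.update_eq_self]

lemma even_update {p : Fin r → ℕ} (hp : ∀ l, Even (p l)) (j : Fin r) {q : ℕ} (hq : Even q)
    (l : Fin r) : Even (Function.update p j q l) := by
  by_cases h : l = j
  · subst h; simpa
  · simpa [Function.update_of_ne h] using hp l

lemma tn_eq_rest_mul_iota_even {p : Fin r → ℕ} {f : ∀ l, Deh (F l) (hF l)}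
    (hf : ∀ l, f l ∈ part (hF l) (p l)) (hp : ∀ l, Even (p l)) (j : Fin r) :
    tn hF (Function.update f j 1) * iota hF j (f j) = tn hF f := by
  rw [tn_eq_rest_mul_iota hf, (even_sgnM_left (even_update hp j Even.zero) _).neg_one_pow, one_smul]

lemma rest_pow_mul_iota {p : Fin r → ℕ} {f : ∀ l, Deh (F l) (hF l)}
    (hf : ∀ l, f l ∈ part (hF l) (p l)) (hp : ∀ l, Even (p l)) (j : Fin r) (i : ℕ) {q : ℕ}
    {y : Deh (F j) (hF j)} (hy : y ∈ part (hF j) q) :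
    tn hF (Function.update f j 1) ^ i * iota hF j y = tn hF (Function.update (f ^ i) j y) := by
  have h1 := update_mem_part hf j one_mem_part
  have h2 := even_update hp j Even.zero
  rw [tn_pow h1 h2, iota_apply, tn_mul_even (pow_mem_part_pi h1 i) (update_one_mem_part j hy)
    fun l => (h2 l).mul_left i, update_pow, update_mul_update, mul_one, one_pow, one_mul]

end Deh

end GenTaylor

namespace GenTaylor

namespace Deh

open DGData

variable {k : Type v} [Field k] {n r : ℕ} {F : Fin r → DGData.{u, v} k n}
  {hF : ∀ l, (F l).IsDGAlgebra} {g : ∀ l, ℕ → Deh (F l) (hF l) → Deh (F l) (hF l)}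
  (hg : ∀ l, IsDP (hF l) (g l))

/-! ### Divided powers on the specialized generalized Taylor algebra -/

/-- When one slot is altered or differentiated, this supplies an untouched odd slot, where the
product squares an odd element and hence vanishes. -/
lemma exists_odd_ne {p : Fin r → ℕ} (h : Even (∑ l, p l)) {a : Fin r} (ha : Odd (p a)) :
    ∃ b, b ≠ a ∧ Odd (p b) := by
  by_contra hcon
  push Not at hcon
  have h1 : Even (∑ l ∈ Finset.univ.erase a, p l) :=
    Finset.even_sum _ fun l hl => Nat.not_odd_iff_even.1 (hcon l (Finset.ne_of_mem_erase hl))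
  rw [← Finset.add_sum_erase _ _ (Finset.mem_univ a)] at h
  exact Nat.not_even_iff_odd.2 (ha.add_even h1) h

lemma tn_mul_eq_zero {p q : Fin r → ℕ} {e f : ∀ l, Deh (F l) (hF l)}
    (he : ∀ l, e l ∈ part (hF l) (p l)) (hf : ∀ l, f l ∈ part (hF l) (q l)) (b : Fin r)
    (h : e b * f b = 0) : tn hF e * tn hF f = 0 := by
  rw [tn_mul he hf, tn_eq_zero b h, smul_zero]

lemma exists_odd_of_odd_sum {p : Fin r → ℕ} (h : Odd (∑ l, p l)) : ∃ l, Odd (p l) := by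
  by_contra hcon
  push Not at hcon
  exact Nat.not_even_iff_odd.2 h (Finset.even_sum _ fun l _ => Nat.not_odd_iff_even.1 (hcon l))

lemma exists_pos_of_sum_pos {p : Fin r → ℕ} (h : 0 < ∑ l, p l) : ∃ l, 0 < p l := by
  by_contra hcon
  push Not at hcon
  exact h.ne' (Finset.sum_eq_zero fun l _ => Nat.le_zero.1 (hcon l))

/-- The exponential sequence `f_1^i * ⋯ * f_j^{(i)} * ⋯ * f_r^i`. -/
def tnSeq (f : ∀ l, Deh (F l) (hF l)) (j : Fin r) :
    ExpMod (evenPart (isDGAlgebra_genTaylor hF)) :=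
  toE (tn hF (Function.update f j 1)) • ExpMod.map (iotaE hF j) (gam (dpSeq (hg j)) (f j))

lemma coe_cf_tnSeq {p : Fin r → ℕ} {f : ∀ l, Deh (F l) (hF l)}
    (hf : ∀ l, f l ∈ part (hF l) (p l)) (hp : ∀ l, Even (p l)) {j : Fin r} (hj : 0 < p j) (i : ℕ) :
    ((tnSeq hg f j).cf i : Deh (genTaylor F) (isDGAlgebra_genTaylor hF)) =
      tn hF (Function.update (f ^ i) j (g j i (f j))) := by
  rw [tnSeq, ExpMod.cf_smul, ExpMod.cf_map]
  have h1 : tn hF (Function.update f j 1) ∈ evenPart (isDGAlgebra_genTaylor hF) :=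
    mem_evenPart (Finset.even_sum _ fun l _ => even_update hp j Even.zero l)
      (tn_mem_part (update_mem_part hf j one_mem_part))
  rw [← rest_pow_mul_iota hf hp j i ((hg j).mem_part (hf j) (hp j) hj i),
    ← coe_cf_gam_dpSeq (hg j) (hf j) (hp j) hj i, ← coe_iotaE]
  conv_rhs => rw [← coe_toE h1]
  rfl

lemma pow_eq_factorial_nsmul {A : DGData.{u, v} k n} {hA : A.IsDGAlgebra}
    {g : ℕ → Deh A hA → Deh A hA} (hg : IsDP hA g) {p : ℕ} {x : Deh A hA}
    (hx : x ∈ part hA p) (hp : Even p) (hp0 : 0 < p) (i : ℕ) :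
    x ^ i = (i.factorial : k) • g i x := by
  have h := congrArg (Subtype.val) (ExpMod.cf_one_pow (gam (dpSeq hg) x) i)
  have h1 := coe_cf_gam_dpSeq hg hx hp hp0 1
  rw [hg.one p x hx hp hp0] at h1
  change ((gam (dpSeq hg) x).cf 1 : Deh A hA) ^ i = _ at h
  rw [h1] at h
  rw [h, Nat.cast_smul_eq_nsmul, ← coe_cf_gam_dpSeq hg hx hp hp0 i]
  rfl

/-- Since f_b^i = i! f_b^{(i)}, both terms of index i equal i! times the tensor with divided powers
in both slots. The slot can thus be chosen freely, which products and compositions require. -/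
lemma tnSeq_eq_tnSeq {p : Fin r → ℕ} {f : ∀ l, Deh (F l) (hF l)}
    (hf : ∀ l, f l ∈ part (hF l) (p l)) (hp : ∀ l, Even (p l)) {j j' : Fin r} (hj : 0 < p j)
    (hj' : 0 < p j') : tnSeq hg f j = tnSeq hg f j' := by
  by_cases hjj : j = j'
  · rw [hjj]
  have key : ∀ (a b : Fin r) (i : ℕ), a ≠ b → 0 < p a → 0 < p b →
      tn hF (Function.update (f ^ i) a (g a i (f a))) = (i.factorial : k) •
        tn hF (Function.update (Function.update (f ^ i) a (g a i (f a))) b (g b i (f b))) := by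
    intro a b i hab ha hb
    rw [← tn_update_smul, ← pow_eq_factorial_nsmul (hg b) (hf b) (hp b) hb]
    congr 1
    conv_rhs => rw [show f b ^ i = Function.update (f ^ i) a (g a i (f a)) b by
      rw [Function.update_of_ne (Ne.symm hab)]; rfl]
    rw [Function.update_eq_self]
  ext i
  rw [coe_cf_tnSeq hg hf hp hj, coe_cf_tnSeq hg hf hp hj', key j j' i hjj hj hj',
    key j' j i (Ne.symm hjj) hj' hj, Function.update_comm hjj]

lemma sgT_mem_part (J : ∀ l, (F l).B) : sg (isDGAlgebra_genTaylor hF) J ∈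
    part (isDGAlgebra_genTaylor hF) (∑ l, (F l).hdeg (J l)) :=
  sg_mem_part (A := genTaylor F) J

lemma toE_sg_mul_self {J : ∀ l, (F l).B} (h : (∃ l, Odd ((F l).hdeg (J l))) ∧
    Even (∑ l, (F l).hdeg (J l))) :
    toE (sg (isDGAlgebra_genTaylor hF) J) * toE (sg (isDGAlgebra_genTaylor hF) J) = 0 := by
  apply Subtype.ext
  obtain ⟨⟨l, hl⟩, h2⟩ := h
  change (toE (sg (isDGAlgebra_genTaylor hF) J) : Deh (genTaylor F) _) *
    (toE (sg (isDGAlgebra_genTaylor hF) J) : Deh (genTaylor F) _) = 0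
  rw [coe_toE_of_mem_part (sgT_mem_part (hF := hF) J) h2, ← tn_sg (hF := hF)]
  exact tn_mul_eq_zero (hF := hF) (sg_mem_part_pi J) (sg_mem_part_pi J) l
    (mul_self_eq_zero hl (sg_mem_part _))

open Classical in
/-- The exponential sequence of divided powers of a basis element of the generalized Taylor
algebra. -/
def seqT (J : ∀ l, (F l).B) : ExpMod (evenPart (isDGAlgebra_genTaylor hF)) :=
  if h : (∀ l, Even ((F l).hdeg (J l))) ∧ ∃ j, 0 < (F j).hdeg (J j) then
    tnSeq hg (fun l => sg (hF l) (J l)) h.2.choose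
  else if h : (∃ l, Odd ((F l).hdeg (J l))) ∧ Even (∑ l, (F l).hdeg (J l)) then
    ExpMod.lin (toE (sg (isDGAlgebra_genTaylor hF) J)) (toE_sg_mul_self (hF := hF) h)
  else 0

lemma seqT_even {J : ∀ l, (F l).B} (h : ∀ l, Even ((F l).hdeg (J l))) {j : Fin r}
    (hj : 0 < (F j).hdeg (J j)) : seqT hg J = tnSeq hg (fun l => sg (hF l) (J l)) j := by
  have h' : (∀ l, Even ((F l).hdeg (J l))) ∧ ∃ j, 0 < (F j).hdeg (J j) := ⟨h, j, hj⟩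
  rw [seqT, dif_pos h']
  exact tnSeq_eq_tnSeq hg (sg_mem_part_pi J) h h'.2.choose_spec hj

lemma seqT_odd {J : ∀ l, (F l).B} (h : (∃ l, Odd ((F l).hdeg (J l))) ∧
    Even (∑ l, (F l).hdeg (J l))) :
    seqT hg J =
      ExpMod.lin (toE (sg (isDGAlgebra_genTaylor hF) J)) (toE_sg_mul_self (hF := hF) h) := by
  rw [seqT, dif_neg, dif_pos h]
  rintro ⟨h1, -⟩
  obtain ⟨l, hl⟩ := h.1
  exact Nat.not_even_iff_odd.2 hl (h1 l)

/-- The divided powers on the generalized Taylor algebra, as an additive map. -/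
def gamT : Deh (genTaylor F) (isDGAlgebra_genTaylor hF) →+
    ExpMod (evenPart (isDGAlgebra_genTaylor hF)) :=
  gam (A := genTaylor F) (seqT hg)

lemma gamT_smul (c : k) (x : Deh (genTaylor F) (isDGAlgebra_genTaylor hF)) :
    gamT hg (c • x) =
      algebraMap k (evenPart (isDGAlgebra_genTaylor hF)) c • gamT hg x :=
  gam_smul _ c x

lemma gamT_sg (J : ∀ l, (F l).B) : gamT hg (sg (isDGAlgebra_genTaylor hF) J) = seqT hg J :=
  gam_sg (A := genTaylor F) _ J

/-- The divided powers on the generalized Taylor algebra. -/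
def dpT (i : ℕ) (x : Deh (genTaylor F) (isDGAlgebra_genTaylor hF)) :
    Deh (genTaylor F) (isDGAlgebra_genTaylor hF) :=
  (gamT hg x).cf i

lemma basis_cases {p : ℕ} (hp : Even p) (hp0 : 0 < p) (J : ∀ l, (F l).B)
    (hJ : (genTaylor F).hdeg J = p) :
    ((∀ l, Even ((F l).hdeg (J l))) ∧ ∃ j, 0 < (F j).hdeg (J j)) ∨
      ((∃ l, Odd ((F l).hdeg (J l))) ∧ Even (∑ l, (F l).hdeg (J l))) := by
  have hJ' : ∑ l, (F l).hdeg (J l) = p := hJ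
  by_cases h : ∃ l, Odd ((F l).hdeg (J l))
  · exact Or.inr ⟨h, hJ'.symm ▸ hp⟩
  · push Not at h
    exact Or.inl ⟨fun l => Nat.not_odd_iff_even.1 (h l), exists_pos_of_sum_pos (hJ'.symm ▸ hp0)⟩

lemma dpT_sg_even {J : ∀ l, (F l).B} (h : ∀ l, Even ((F l).hdeg (J l))) {j : Fin r}
    (hj : 0 < (F j).hdeg (J j)) (i : ℕ) : dpT hg i (sg (isDGAlgebra_genTaylor hF) J) =
      tn hF (Function.update ((fun l => sg (hF l) (J l)) ^ i) j (g j i (sg (hF j) (J j)))) := by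
  rw [dpT, gamT_sg, seqT_even hg h hj, coe_cf_tnSeq hg (sg_mem_part_pi J) h hj]

lemma dpT_zero_left (x : Deh (genTaylor F) (isDGAlgebra_genTaylor hF)) : dpT hg 0 x = 1 := by
  rw [dpT, ExpMod.cf_zero_right]; rfl

lemma dpT_zero_right {i : ℕ} (hi : 0 < i) : dpT hg i 0 = 0 := by
  rw [dpT, map_zero, ExpMod.cf_zero_of_pos hi]; rfl

lemma dpT_smul (c : k) (i : ℕ) (x : Deh (genTaylor F) (isDGAlgebra_genTaylor hF)) :
    dpT hg i (c • x) = c ^ i • dpT hg i x := by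
  rw [dpT, gamT_smul, ExpMod.cf_smul, ← map_pow, Algebra.smul_def]; rfl

lemma dpT_add (i : ℕ) (x y : Deh (genTaylor F) (isDGAlgebra_genTaylor hF)) :
    dpT hg i (x + y) = ∑ ab ∈ Finset.HasAntidiagonal.antidiagonal i,
      dpT hg ab.1 x * dpT hg ab.2 y := by
  rw [dpT, map_add, ExpMod.cf_add, AddSubmonoidClass.coe_finsetSum]; rfl

lemma dpT_mul (h i : ℕ) (x : Deh (genTaylor F) (isDGAlgebra_genTaylor hF)) :
    dpT hg h x * dpT hg i x = (h + i).choose h • dpT hg (h + i) x :=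
  congrArg Subtype.val ((gamT hg x).isExpSeq.mul h i)

lemma dpT_one {p : ℕ} (hp : Even p) (hp0 : 0 < p) :
    ∀ x ∈ part (isDGAlgebra_genTaylor hF) p, dpT hg 1 x = x := by
  refine part_induction (dpT_zero_right hg one_pos) (fun c J hJ => ?_) fun x y _ _ h h' => ?_
  · rw [dpT_smul, pow_one]
    congr 1
    rcases basis_cases hp hp0 J hJ with ⟨h, j, hj⟩ | h
    · rw [dpT_sg_even hg h hj, (hg j).one _ _ (sg_mem_part _) (h j) hj, pow_one, ← tn_sg]
      congr 1
      exact Function.update_eq_self j _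
    · rw [dpT, gamT_sg, seqT_odd hg h, ExpMod.cf_lin_one,
        coe_toE_of_mem_part (sgT_mem_part (hF := hF) J) h.2]
  · have := congrArg Subtype.val (ExpMod.cf_one_add (gamT hg x) (gamT hg y))
    rw [← map_add] at this
    change dpT hg 1 (x + y) = dpT hg 1 x + dpT hg 1 y at this
    rw [this, h, h']

lemma dpT_sg_mem_bi {p : ℕ} (hp : Even p) (hp0 : 0 < p) (J : ∀ l, (F l).B)
    (hJ : (genTaylor F).hdeg J = p) (i : ℕ) : dpT hg i (sg (isDGAlgebra_genTaylor hF) J) ∈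
      bi (isDGAlgebra_genTaylor hF) (i * p) (i • lcmDeg F J) := by
  rcases basis_cases hp hp0 J hJ with ⟨h, j, hj⟩ | h
  · rw [dpT_sg_even hg h hj]
    have h1 : ∀ l, Function.update ((fun l => sg (hF l) (J l)) ^ i) j (g j i (sg (hF j) (J j))) l ∈
        bi (hF l) (i * (F l).hdeg (J l)) (i • (F l).mdeg (J l)) := by
      intro l
      by_cases hl : l = j
      · subst hl
        rw [Function.update_self]
        exact (hg l).mem_bi _ _ _ (sg_mem_bi _) (h l) hj i
      · rw [Function.update_of_ne hl]
        exact pow_mem_bi (sg_mem_bi _) i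
    have h2 := tn_mem_bi h1
    rw [← Finset.mul_sum] at h2
    have hJ' : ∑ l, (F l).hdeg (J l) = p := hJ
    rw [hJ'] at h2
    -- The lcm of the i-th powers divides the i-th power of the lcm.
    refine bi_mono (Finset.sup_le fun l _ => ?_) h2
    exact nsmul_le_nsmul_right
      (Finset.le_sup (f := fun l => (F l).mdeg (J l)) (Finset.mem_univ l)) i
  · rcases Nat.lt_or_ge i 2 with hi | hi
    · interval_cases i
      · rw [dpT_zero_left, zero_mul, zero_smul]
        exact one_mem_bi
      · rw [dpT_one hg hp hp0 _ (hJ ▸ sg_mem_part (hA := isDGAlgebra_genTaylor hF) J), one_mul,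
          one_smul]
        exact hJ ▸ sg_mem_bi (hA := isDGAlgebra_genTaylor hF) J
    · rw [dpT, gamT_sg, seqT_odd hg h, ExpMod.cf_lin_of_two_le _ _ hi]
      exact zero_mem _

lemma dpT_mem_bi {p : ℕ} (hp : Even p) (hp0 : 0 < p) {m : Fin n →₀ ℕ} :
    ∀ x ∈ bi (isDGAlgebra_genTaylor hF) p m, ∀ i,
      dpT hg i x ∈ bi (isDGAlgebra_genTaylor hF) (i * p) (i • m) := by
  refine bi_induction (fun i => ?_) (fun c J hJ hm i => ?_) fun x y h h' i => ?_
  · rcases Nat.eq_zero_or_pos i with rfl | hi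
    · rw [dpT_zero_left, zero_mul, zero_smul]
      exact one_mem_bi
    · rw [dpT_zero_right hg hi]
      exact zero_mem _
  · rw [dpT_smul]
    exact Submodule.smul_mem _ _ (bi_mono (nsmul_le_nsmul_right hm i)
      (dpT_sg_mem_bi hg hp hp0 J hJ i))
  · rw [dpT_add]
    refine Submodule.sum_mem _ fun ab hab => ?_
    rw [← Finset.HasAntidiagonal.mem_antidiagonal.1 hab, add_mul, add_smul]
    exact mul_mem_bi (h _) (h' _)

lemma dpT_mem_part {p : ℕ} (hp : Even p) (hp0 : 0 < p)
    {x : Deh (genTaylor F) (isDGAlgebra_genTaylor hF)}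
    (hx : x ∈ part (isDGAlgebra_genTaylor hF) p) (i : ℕ) :
    dpT hg i x ∈ part (isDGAlgebra_genTaylor hF) (i * p) := by
  obtain ⟨m, hx⟩ := exists_mem_bi hx
  exact bi_le_part (dpT_mem_bi hg hp hp0 x hx i)

/-! #### Divided powers of tensors -/

/-- Both sides are multiadditive in the entries of f: on the right, slot j enters through the
additive map `gam` and every other slot through the scalar. So basis tensors suffice. -/
lemma gamT_tn {p : Fin r → ℕ} (hp : ∀ l, Even (p l)) {j : Fin r} (hj : 0 < p j) :
    ∀ f : ∀ l, Deh (F l) (hF l), (∀ l, f l ∈ part (hF l) (p l)) →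
      gamT hg (tn hF f) = tnSeq hg f j := by
  have hev : ∀ (f : ∀ l, Deh (F l) (hF l)), (∀ l, f l ∈ part (hF l) (p l)) →
      tn hF (Function.update f j 1) ∈ evenPart (isDGAlgebra_genTaylor hF) := fun f hf =>
    mem_evenPart (Finset.even_sum _ fun l _ => even_update hp j Even.zero l)
      (tn_mem_part (update_mem_part hf j one_mem_part))
  refine tuple_induction (fun K hK => ?_) (fun f i hf hi => ?_) (fun f i c hf h => ?_)
    fun f i x y hf hx hy h h' => ?_
  · rw [tn_sg, gamT_sg]
    exact seqT_even hg (fun l => (hK l).symm ▸ hp l) ((hK j).symm ▸ hj)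
  · rw [tn_eq_zero i hi, map_zero, tnSeq]
    by_cases hij : i = j
    · subst hij
      rw [hi, map_zero, map_zero, smul_zero]
    · rw [tn_eq_zero i (by rw [Function.update_of_ne hij, hi]), toE_zero, zero_smul]
  · rw [tn_update_smul, Function.update_eq_self, gamT_smul, h, tnSeq, tnSeq]
    by_cases hij : i = j
    · subst hij
      rw [Function.update_idem, Function.update_self, gam_smul, ExpMod.map_smul', smul_comm]
      congr 2
      exact Subtype.ext ((iota hF i).commutes c).symm
    · rw [Function.update_comm hij, Function.update_of_ne (Ne.symm hij), tn_update_smul, toE_smul,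
        mul_smul]
      · congr 3
        rw [← Function.update_of_ne hij (1 : Deh (F j) (hF j)) f]
        simp
      · have := hev f hf
        rwa [← Function.update_eq_self i (Function.update f j 1), Function.update_of_ne hij] at this
  · rw [tn_update_add, map_add, h, h', tnSeq, tnSeq, tnSeq]
    by_cases hij : i = j
    · subst hij
      simp only [Function.update_idem, Function.update_self]
      rw [map_add, map_add, smul_add]
    · rw [Function.update_of_ne (Ne.symm hij), Function.update_of_ne (Ne.symm hij),
        Function.update_of_ne (Ne.symm hij), Function.update_comm hij, Function.update_comm hij,
        Function.update_comm hij, tn_update_add, toE_add, add_smul]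
      · have := hev _ (update_mem_part_self hf i hx)
        rwa [Function.update_comm hij] at this
      · have := hev _ (update_mem_part_self hf i hy)
        rwa [Function.update_comm hij] at this

lemma dpT_tn {p : Fin r → ℕ} (hp : ∀ l, Even (p l)) {j : Fin r} (hj : 0 < p j)
    {f : ∀ l, Deh (F l) (hF l)} (hf : ∀ l, f l ∈ part (hF l) (p l)) (i : ℕ) :
    dpT hg i (tn hF f) = tn hF (Function.update (f ^ i) j (g j i (f j))) := by
  rw [dpT, gamT_tn hg hp hj f hf, coe_cf_tnSeq hg hf hp hj]

/-- Vanishing from index 2 on survives addition in slot i as soon as the two tensors multiply to 0.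
They do, because they share the same odd element in another slot. -/
lemma triv_gamT_tn {p : Fin r → ℕ} (hp : Even (∑ l, p l)) {a : Fin r} (ha : Odd (p a)) :
    ∀ f : ∀ l, Deh (F l) (hF l), (∀ l, f l ∈ part (hF l) (p l)) →
      ExpMod.Triv (gamT hg (tn hF f)) := by
  have hp0 : 0 < ∑ l, p l := lt_of_lt_of_le ha.pos
    (Finset.single_le_sum (f := p) (fun _ _ => Nat.zero_le _) (Finset.mem_univ a))
  refine tuple_induction (fun K hK => ?_) (fun f i hf hi => ?_) (fun f i c hf h => ?_)
    fun f i x y hf hx hy h h' => ?_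
  · rw [tn_sg, gamT_sg, seqT_odd hg ⟨⟨a, (hK a).symm ▸ ha⟩, by simpa only [hK] using hp⟩]
    exact fun i hi => ExpMod.cf_lin_of_two_le _ _ hi
  · rw [tn_eq_zero i hi, map_zero]
    exact ExpMod.Triv.zero
  · rw [tn_update_smul, Function.update_eq_self, gamT_smul]
    exact h.smul _
  · rw [tn_update_add, map_add]
    refine h.add h' (Subtype.ext ?_)
    have hx' := update_mem_part_self hf i hx
    have hy' := update_mem_part_self hf i hy
    change dpT hg 1 (tn hF _) * dpT hg 1 (tn hF _) = 0
    rw [dpT_one hg hp hp0 _ (tn_mem_part hx'), dpT_one hg hp hp0 _ (tn_mem_part hy')]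
    obtain ⟨b, hbi, hb⟩ : ∃ b, b ≠ i ∧ Odd (p b) := by
      by_cases hai : a = i
      · subst hai
        exact exists_odd_ne hp ha
      · exact ⟨a, hai, ha⟩
    refine tn_mul_eq_zero hx' hy' b ?_
    rw [Function.update_of_ne hbi, Function.update_of_ne hbi]
    exact mul_self_eq_zero hb (hf b)

/-- If the product has an odd slot, the previous lemma applies. Otherwise e_a and f_a are both odd;
placing the divided power in slot a gives (e_a f_a)^{(i)} = 0 there. -/
lemma triv_gamT_tn_mul {p q : Fin r → ℕ} {e f : ∀ l, Deh (F l) (hF l)}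
    (he : ∀ l, e l ∈ part (hF l) (p l)) (hf : ∀ l, f l ∈ part (hF l) (q l))
    (hpq : Even (∑ l, p l + ∑ l, q l)) {a : Fin r} (ha : Odd (p a) ∨ Odd (q a)) :
    ExpMod.Triv (gamT hg (tn hF e * tn hF f)) := by
  rw [tn_mul he hf, gamT_smul]
  refine ExpMod.Triv.smul ?_ _
  have hef := mul_mem_part_pi he hf
  by_cases h : ∃ l, Odd ((p + q) l)
  · obtain ⟨l, hl⟩ := h
    refine triv_gamT_tn hg ?_ hl _ hef
    simpa only [Pi.add_apply, Finset.sum_add_distrib] using hpq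
  · push Not at h
    have h' : ∀ l, Even ((p + q) l) := fun l => Nat.not_odd_iff_even.1 (h l)
    have ha' : Odd (p a) ∧ Odd (q a) := by
      have := Nat.even_add.1 (h' a)
      rw [← Nat.not_even_iff_odd, ← Nat.not_even_iff_odd] at ha ⊢
      tauto
    intro i hi
    apply Subtype.ext
    change dpT hg i (tn hF (e * f)) = 0
    rw [dpT_tn hg h' (j := a) (Nat.add_pos_left ha'.1.pos _) hef]
    refine tn_eq_zero a ?_
    rw [Function.update_self]
    exact (hg a).mul_odd _ _ _ (he a) _ (hf a) ha'.1 ha'.2 i hi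

end Deh

end GenTaylor

namespace GenTaylor

namespace Deh

open DGData

variable {k : Type v} [Field k] {n r : ℕ} {F : Fin r → DGData.{u, v} k n}
  {hF : ∀ l, (F l).IsDGAlgebra} {g : ∀ l, ℕ → Deh (F l) (hF l) → Deh (F l) (hF l)}
  (hg : ∀ l, IsDP (hF l) (g l))

/-! #### The axioms of divided powers -/

lemma sgT_mem_part_of_hdeg {p : ℕ} {J : ∀ l, (F l).B} (hJ : (genTaylor F).hdeg J = p) :
    sg (isDGAlgebra_genTaylor hF) J ∈ part (isDGAlgebra_genTaylor hF) p := by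
  rw [← hJ]
  exact sgT_mem_part (hF := hF) J

lemma triv_gamT_mul {p q : ℕ} (hp : Odd p) (hq : Odd q)
    {x y : Deh (genTaylor F) (isDGAlgebra_genTaylor hF)}
    (hx : x ∈ part (isDGAlgebra_genTaylor hF) p) (hy : y ∈ part (isDGAlgebra_genTaylor hF) q) :
    ExpMod.Triv (gamT hg (x * y)) := by
  have hpq : Even (p + q) := hp.add_odd hq
  have hpq0 : 0 < p + q := Nat.add_pos_left hp.pos _
  have hadd : ∀ z w, z ∈ part (isDGAlgebra_genTaylor hF) (p + q) →
      w ∈ part (isDGAlgebra_genTaylor hF) (p + q) → z * w = 0 → ExpMod.Triv (gamT hg z) →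
      ExpMod.Triv (gamT hg w) → ExpMod.Triv (gamT hg (z + w)) := fun z w hz hw h0 h h' => by
    rw [map_add]
    refine h.add h' (Subtype.ext ?_)
    change dpT hg 1 z * dpT hg 1 w = 0
    rw [dpT_one hg hpq hpq0 z hz, dpT_one hg hpq hpq0 w hw, h0]
  refine part_induction (P := fun x => ExpMod.Triv (gamT hg (x * y)))
    (by rw [zero_mul, map_zero]; exact ExpMod.Triv.zero) (fun c J hJ => ?_)
    (fun x x' hx hx' h h' => ?_) x hx
  · refine part_induction (P := fun y => ExpMod.Triv (gamT hg
        (c • sg (isDGAlgebra_genTaylor hF) J * y)))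
      (by rw [mul_zero, map_zero]; exact ExpMod.Triv.zero) (fun c' K hK => ?_)
      (fun y y' hy hy' h h' => ?_) y hy
    · rw [smul_mul_smul_comm, gamT_smul, ← tn_sg (hF := hF), ← tn_sg (hF := hF)]
      have hJ' : ∑ l, (F l).hdeg (J l) = p := hJ
      have hK' : ∑ l, (F l).hdeg (K l) = q := hK
      obtain ⟨a, ha⟩ := exists_odd_of_odd_sum (hJ'.symm ▸ hp)
      exact (triv_gamT_tn_mul hg (sg_mem_part_pi J) (sg_mem_part_pi K)
        (by rw [hJ', hK']; exact hpq) (Or.inl ha)).smul _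
    · have hJ' : c • sg (isDGAlgebra_genTaylor hF) J ∈ part (isDGAlgebra_genTaylor hF) p :=
        Submodule.smul_mem _ c (sgT_mem_part_of_hdeg (hF := hF) hJ)
      rw [mul_add]
      refine hadd _ _ (mul_mem_part hJ' hy) (mul_mem_part hJ' hy') ?_ h h'
      -- Anticommuting the odd factors brings two copies of the same odd element together, so the
      -- cross product of the two summands is 0.
      rw [neg_comm hp hq hJ' hy, neg_mul, mul_assoc,
        ← mul_assoc (c • sg (isDGAlgebra_genTaylor hF) J), mul_self_eq_zero hp hJ', zero_mul,
        mul_zero, neg_zero]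
  · rw [add_mul]
    refine hadd _ _ (mul_mem_part hx hy) (mul_mem_part hx' hy) ?_ h h'
    rw [neg_comm hp hq hx' hy, mul_neg, mul_assoc, ← mul_assoc y, mul_self_eq_zero hq hy, zero_mul,
      mul_zero, neg_zero]

lemma toE_mem_mul {x y : Deh (genTaylor F) (isDGAlgebra_genTaylor hF)}
    (hx : x ∈ evenPart (isDGAlgebra_genTaylor hF)) (i : ℕ) :
    ((toE x • gamT hg y).cf i : Deh (genTaylor F) (isDGAlgebra_genTaylor hF)) =
      x ^ i * dpT hg i y := by
  rw [ExpMod.cf_smul, dpT]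
  conv_rhs => rw [← coe_toE hx]
  rfl

/-- If an odd slot occurs, both sequences vanish from index 2 on and agree in index 1; on the right
this is due to K having an odd slot, or else to the square of the J-tensor being 0. If all slots are
even, one slot of positive degree in K carries the divided power for K and for the product alike. -/
lemma gamT_sg_mul_sg {p q : ℕ} (hp : Even p) (hq : Even q) (hq0 : 0 < q) (J K : ∀ l, (F l).B)
    (hJ : (genTaylor F).hdeg J = p) (hK : (genTaylor F).hdeg K = q) :
    gamT hg (sg (isDGAlgebra_genTaylor hF) J * sg (isDGAlgebra_genTaylor hF) K) =
      toE (sg (isDGAlgebra_genTaylor hF) J) • gamT hg (sg (isDGAlgebra_genTaylor hF) K) := by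
  have hJ' : ∑ l, (F l).hdeg (J l) = p := hJ
  have hK' : ∑ l, (F l).hdeg (K l) = q := hK
  have hJp : sg (isDGAlgebra_genTaylor hF) J ∈ part (isDGAlgebra_genTaylor hF) p :=
    sgT_mem_part_of_hdeg (hF := hF) hJ
  have hKq : sg (isDGAlgebra_genTaylor hF) K ∈ part (isDGAlgebra_genTaylor hF) q :=
    sgT_mem_part_of_hdeg (hF := hF) hK
  have hJe := mem_evenPart hp hJp
  have hs := sg_mem_part_pi (hF := hF) J
  have ht := sg_mem_part_pi (hF := hF) K
  by_cases hodd : ∃ a, Odd ((F a).hdeg (J a)) ∨ Odd ((F a).hdeg (K a))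
  · obtain ⟨a, ha⟩ := hodd
    refine ExpMod.Triv.ext ?_ ?_ (Subtype.ext ?_)
    · rw [← tn_sg (hF := hF), ← tn_sg (hF := hF)]
      exact triv_gamT_tn_mul hg hs ht (by rw [hJ', hK']; exact hp.add hq) ha
    · by_cases hKodd : ∃ b, Odd ((F b).hdeg (K b))
      · obtain ⟨b, hb⟩ := hKodd
        refine ExpMod.Triv.smul ?_ _
        rw [← tn_sg (hF := hF)]
        exact triv_gamT_tn hg (hK'.symm ▸ hq) hb _ ht
      · push Not at hKodd
        have hJa := ha.resolve_right (hKodd a)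
        intro i hi
        apply Subtype.ext
        have h0 : sg (isDGAlgebra_genTaylor hF) J * sg (isDGAlgebra_genTaylor hF) J = 0 := by
          rw [← tn_sg (hF := hF)]
          exact tn_mul_eq_zero hs hs a (mul_self_eq_zero hJa (sg_mem_part _))
        rw [toE_mem_mul hg hJe, show i = 2 + (i - 2) by omega, pow_add, pow_two, h0, zero_mul,
          zero_mul]
        rfl
    · rw [toE_mem_mul hg hJe, pow_one, dpT_one hg hq hq0 _ hKq]
      exact dpT_one hg (hp.add hq) (Nat.add_pos_right _ hq0) _ (mul_mem_part hJp hKq)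
  · push Not at hodd
    have hJev : ∀ l, Even ((F l).hdeg (J l)) := fun l => Nat.not_odd_iff_even.1 (hodd l).1
    have hKev : ∀ l, Even ((F l).hdeg (K l)) := fun l => Nat.not_odd_iff_even.1 (hodd l).2
    obtain ⟨j, hj⟩ := exists_pos_of_sum_pos (hK'.symm ▸ hq0)
    ext i
    rw [toE_mem_mul hg hJe, dpT_sg_even hg hKev hj, ← tn_sg (hF := hF), ← tn_sg (hF := hF),
      tn_mul_even hs ht hJev, tn_pow hs hJev,
      tn_mul_even (pow_mem_part_pi hs i) (update_mem_part (pow_mem_part_pi ht i) j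
        ((hg j).mem_part (ht j) (hKev j) hj i)) (fun l => (hJev l).mul_left i)]
    refine (dpT_tn hg (p := (fun l => (F l).hdeg (J l)) + fun l => (F l).hdeg (K l))
      (fun l => (hJev l).add (hKev l)) (j := j) (Nat.add_pos_right _ hj)
      (mul_mem_part_pi hs ht) i).trans ?_
    congr 1
    ext1 l
    by_cases hl : l = j
    · subst hl
      simp only [Function.update_self, Pi.mul_apply, Pi.pow_apply]
      exact (hg l).mul_even' (hs l) (ht l) (hJev l) (hKev l) hj i
    · simp only [Function.update_of_ne hl, Pi.mul_apply, Pi.pow_apply]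
      exact (commute_of_mem_part (hJev l) (hs l) _).mul_pow i

/-- In the module `ExpMod` both sides are additive in x and in y, so the case of basis elements is
enough. -/
lemma gamT_mul {p q : ℕ} (hp : Even p) (hq : Even q) (hq0 : 0 < q)
    {x y : Deh (genTaylor F) (isDGAlgebra_genTaylor hF)}
    (hx : x ∈ part (isDGAlgebra_genTaylor hF) p) (hy : y ∈ part (isDGAlgebra_genTaylor hF) q) :
    gamT hg (x * y) = toE x • gamT hg y := by
  refine part_induction (P := fun x => gamT hg (x * y) = toE x • gamT hg y)
    (by rw [zero_mul, map_zero, toE_zero, zero_smul]) (fun c J hJ => ?_)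
    (fun x x' hx hx' h h' => ?_) x hx
  · have hJp : sg (isDGAlgebra_genTaylor hF) J ∈ part (isDGAlgebra_genTaylor hF) p :=
      sgT_mem_part_of_hdeg (hF := hF) hJ
    rw [smul_mul_assoc, gamT_smul, toE_smul (mem_evenPart hp hJp), mul_smul]
    congr 1
    refine part_induction (P := fun y => gamT hg (sg (isDGAlgebra_genTaylor hF) J * y) =
        toE (sg (isDGAlgebra_genTaylor hF) J) • gamT hg y)
      (by rw [mul_zero, map_zero, smul_zero]) (fun c' K hK => ?_) (fun y y' _ _ h h' => ?_) y hy
    · rw [mul_smul_comm, gamT_smul, gamT_smul, smul_comm, gamT_sg_mul_sg hg hp hq hq0 J K hJ hK]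
    · rw [mul_add, map_add, h, h', map_add, smul_add]
  · rw [add_mul, map_add, h, h', toE_add (mem_evenPart hp hx) (mem_evenPart hp hx'), add_smul]

lemma dpComp_one (i : ℕ) : dpComp 1 i = 1 := by
  simp [dpComp, Nat.div_self (Nat.factorial_pos i)]

lemma dpComp_zero (h : ℕ) : dpComp h 0 = 1 := by
  simp [dpComp]

lemma dpT_comp {p : ℕ} (hp : Even p) (hp0 : 0 < p) :
    ∀ x ∈ part (isDGAlgebra_genTaylor hF) p, ∀ h i, 1 ≤ h →
      dpT hg i (dpT hg h x) = dpComp h i • dpT hg (h * i) x := by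
  refine part_induction (fun h i hh => ?_) (fun c J hJ h i hh => ?_)
    fun x y hx hy hGx hGy h i hh => ?_
  · rw [dpT_zero_right hg (by omega)]
    rcases Nat.eq_zero_or_pos i with rfl | hi
    · rw [dpT_zero_left, mul_zero, dpT_zero_left, dpComp_zero, one_smul]
    · rw [dpT_zero_right hg hi, dpT_zero_right hg (Nat.mul_pos hh hi), smul_zero]
  · rw [dpT_smul, dpT_smul, dpT_smul, ← pow_mul, smul_comm]
    congr 1
    rcases basis_cases hp hp0 J hJ with ⟨hev, j, hj⟩ | hodd
    · have hs := sg_mem_part_pi (hF := hF) J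
      have hgs := (hg j).mem_part (hs j) (hev j) hj h
      rw [dpT_sg_even hg hev hj, dpT_sg_even hg hev hj,
        dpT_tn hg (p := fun l => h * (F l).hdeg (J l)) (fun l => (hev l).mul_left h) (j := j)
          (Nat.mul_pos hh hj)
          (update_mem_part_self (pow_mem_part_pi hs h) j hgs),
        Function.update_self, update_pow, Function.update_idem,
        (hg j).comp _ _ (hs j) (hev j) hj h i hh, ← pow_mul, ← Nat.cast_smul_eq_nsmul k,
        tn_update_smul, Nat.cast_smul_eq_nsmul]
    · have ht : ExpMod.Triv (gamT hg (sg (isDGAlgebra_genTaylor hF) J)) := by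
        rw [gamT_sg, seqT_odd hg hodd]
        exact fun i hi => ExpMod.cf_lin_of_two_le _ _ hi
      have h0 : ∀ i, 2 ≤ i → dpT hg i (sg (isDGAlgebra_genTaylor hF) J) = 0 := fun i hi =>
        congrArg Subtype.val (ht i hi)
      rcases hh.eq_or_lt with rfl | hh'
      · rw [dpT_one hg hp hp0 _ (sgT_mem_part_of_hdeg (hF := hF) hJ), dpComp_one, one_smul,
          one_mul]
      · rw [h0 h hh']
        rcases Nat.eq_zero_or_pos i with rfl | hi
        · rw [dpT_zero_left, mul_zero, dpT_zero_left, dpComp_zero, one_smul]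
        · rw [dpT_zero_right hg hi, h0 _ (hh'.trans_le (Nat.le_mul_of_pos_right h hi)), smul_zero]
  · have hcoe : ∀ a, dpT hg a x ∈ evenPart (isDGAlgebra_genTaylor hF) := fun a =>
      ((gamT hg x).cf a).2
    -- Expanding the inner (x+y)^{(h)} as a sum of x^{(a)} y^{(b)}, the outer divided powers become
    -- coefficients of a product of series, one for each (a, b). Linearity and the induction
    -- hypotheses identify these factors, and the transfer from ℚ evaluates their product.
    rw [dpT_add, dpT, map_sum, ExpMod.cf, ExpMod.ser_sum, coeff_prod_dpComp (gamT hg x).isExpSeq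
      (gamT hg y).isExpSeq hh (fun ab => (gamT hg (dpT hg ab.1 x * dpT hg ab.2 y)).ser)]
    · rw [dpT, map_add, ExpMod.cf_add]
      rfl
    · intro ab _ hb i
      change (gamT hg (dpT hg ab.1 x * dpT hg ab.2 y)).cf i = _
      rw [gamT_mul hg (hp.mul_left ab.1) (hp.mul_left ab.2) (Nat.mul_pos hb hp0)
        (dpT_mem_part hg hp hp0 hx _) (dpT_mem_part hg hp hp0 hy _), ExpMod.cf_smul]
      congr 1
      · rw [dpT, toE_coe]
      · exact Subtype.ext (hGy ab.2 i hb)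
    · intro i
      simp only [dpT_zero_left, mul_one]
      exact Subtype.ext (hGx h i hh)

/-- For y = x^{(i)} and z = x^{(i+1)} this is the differential rule for Rx. The factor i + 1
produced by ∂(R^{i+1}) is absorbed by x^{(i)} x = (i+1) x^{(i+1)}. -/
lemma d_pow_mul {A : DGData.{u, v} k n} {hA : A.IsDGAlgebra} {p q i : ℕ} {R x y z : Deh A hA}
    (hp : Even p) (hR : R ∈ part hA p) (hq : Even q) (hy : y ∈ part hA q)
    (hyx : y * x = (i + 1) • z) (hz : d hA z = y * d hA x) :
    d hA (R ^ (i + 1) * z) = R ^ i * y * d hA (R * x) := by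
  have hcR := (commute_of_mem_part hp hR y).eq
  have hcy := (commute_of_mem_part hq hy (d hA R)).eq
  rw [leibniz_even (hp.mul_left (i + 1)) (pow_mem_part hR _), d_pow_succ hp hR,
    leibniz_even hp hR, mul_add, hz, smul_mul_assoc, ← mul_smul_comm, ← hyx]
  congr 1
  · rw [mul_assoc (R ^ i), mul_assoc (R ^ i), ← mul_assoc y, hcy, mul_assoc]
  · rw [pow_succ, mul_assoc, mul_assoc, ← mul_assoc R, hcR, mul_assoc]

lemma dpT_d_sg_even {J : ∀ l, (F l).B} (hev : ∀ l, Even ((F l).hdeg (J l))) {j : Fin r}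
    (hj : 0 < (F j).hdeg (J j)) (i : ℕ) :
    d (isDGAlgebra_genTaylor hF) (dpT hg (i + 1) (sg (isDGAlgebra_genTaylor hF) J)) =
      dpT hg i (sg (isDGAlgebra_genTaylor hF) J) *
        d (isDGAlgebra_genTaylor hF) (sg (isDGAlgebra_genTaylor hF) J) := by
  have hs := sg_mem_part_pi (hF := hF) J
  have hgs := fun i => (hg j).mem_part (hs j) (hev j) hj i
  have hform : ∀ i, dpT hg i (sg (isDGAlgebra_genTaylor hF) J) =
      tn hF (Function.update (fun l => sg (hF l) (J l)) j 1) ^ i *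
        iota hF j (g j i (sg (hF j) (J j))) := fun i => by
    rw [dpT_sg_even hg hev hj, rest_pow_mul_iota hs hev j i (hgs i)]
  have h1 : sg (isDGAlgebra_genTaylor hF) J =
      tn hF (Function.update (fun l => sg (hF l) (J l)) j 1) * iota hF j (sg (hF j) (J j)) := by
    rw [← tn_sg (hF := hF), tn_eq_rest_mul_iota_even hs hev j]
  have h2 : iota hF j (g j i (sg (hF j) (J j))) * iota hF j (sg (hF j) (J j)) =
      (i + 1) • iota hF j (g j (i + 1) (sg (hF j) (J j))) := by
    have := (hg j).mul _ _ (hs j) (hev j) hj i 1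
    rw [(hg j).one _ _ (hs j) (hev j) hj, Nat.choose_succ_self_right] at this
    rw [← map_mul, this, map_nsmul]
  have h3 : d (isDGAlgebra_genTaylor hF) (iota hF j (g j (i + 1) (sg (hF j) (J j)))) =
      iota hF j (g j i (sg (hF j) (J j))) *
        d (isDGAlgebra_genTaylor hF) (iota hF j (sg (hF j) (J j))) := by
    rw [← iota_d, (hg j).d_succ _ _ (hs j) (hev j) hj, map_mul, iota_d]
  rw [hform, hform, h1]
  exact d_pow_mul (Finset.even_sum _ fun l _ => even_update hev j Even.zero l)
    (tn_mem_part (update_mem_part hs j one_mem_part)) ((hev j).mul_left i)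
    (iota_mem_part j (hgs i)) h2 h3

lemma dpT_d_sg_odd {p : ℕ} (hp : Even p) (hp0 : 0 < p) {J : ∀ l, (F l).B}
    (hJ : (genTaylor F).hdeg J = p)
    (hodd : (∃ l, Odd ((F l).hdeg (J l))) ∧ Even (∑ l, (F l).hdeg (J l))) (i : ℕ) :
    d (isDGAlgebra_genTaylor hF) (dpT hg (i + 1) (sg (isDGAlgebra_genTaylor hF) J)) =
      dpT hg i (sg (isDGAlgebra_genTaylor hF) J) *
        d (isDGAlgebra_genTaylor hF) (sg (isDGAlgebra_genTaylor hF) J) := by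
  have hs := sg_mem_part_pi (hF := hF) J
  have ht : ExpMod.Triv (gamT hg (sg (isDGAlgebra_genTaylor hF) J)) := by
    rw [gamT_sg, seqT_odd hg hodd]
    exact fun i hi => ExpMod.cf_lin_of_two_le _ _ hi
  have h0 : ∀ i, 2 ≤ i → dpT hg i (sg (isDGAlgebra_genTaylor hF) J) = 0 := fun i hi =>
    congrArg Subtype.val (ht i hi)
  have h1 := dpT_one hg hp hp0 (sg (isDGAlgebra_genTaylor hF) J)
    (sgT_mem_part_of_hdeg (hF := hF) hJ)
  rcases i with _ | _ | i
  · rw [zero_add, h1, dpT_zero_left, one_mul]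
  · rw [h0 _ le_rfl, map_zero, zero_add, h1, ← tn_sg (hF := hF), d_tn hs, Finset.mul_sum, eq_comm]
    -- What remains is f · ∂f = 0: after differentiating slot i, another odd slot is unchanged and
    -- contributes a square.
    refine Finset.sum_eq_zero fun i _ => ?_
    obtain ⟨a, ha⟩ := hodd.1
    obtain ⟨b, hbi, hb⟩ : ∃ b, b ≠ i ∧ Odd ((F b).hdeg (J b)) := by
      by_cases hai : a = i
      · subst hai
        exact exists_odd_ne (p := fun l => (F l).hdeg (J l)) hodd.2 ha
      · exact ⟨a, hai, ha⟩
    rw [mul_smul_comm, tn_mul_eq_zero hs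
      (update_mem_part hs i (d_mem_part (hs i))) b, smul_zero]
    rw [Function.update_of_ne hbi]
    exact mul_self_eq_zero hb (sg_mem_part _)
  · rw [h0 _ (by omega), h0 _ (by omega), map_zero, zero_mul]

lemma dpT_d {p : ℕ} (hp : Even p) (hp0 : 0 < p) :
    ∀ x ∈ part (isDGAlgebra_genTaylor hF) p, ∀ i,
      d (isDGAlgebra_genTaylor hF) (dpT hg (i + 1) x) =
        dpT hg i x * d (isDGAlgebra_genTaylor hF) x := by
  refine part_induction (fun i => ?_) (fun c J hJ i => ?_) fun x y hx hy hdx hdy i => ?_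
  · rw [dpT_zero_right hg (Nat.succ_pos i), map_zero, mul_zero]
  · rw [dpT_smul, dpT_smul, map_smul, map_smul, smul_mul_smul_comm, ← pow_succ]
    congr 1
    rcases basis_cases hp hp0 J hJ with ⟨hev, j, hj⟩ | hodd
    · exact dpT_d_sg_even hg hev hj i
    · exact dpT_d_sg_odd hg hp hp0 hJ hodd i
  · have hc : ∀ a z, dpT hg a y * z = z * dpT hg a y := fun a z =>
      (commute_of_mem_part (hp.mul_left a) (dpT_mem_part hg hp hp0 hy a) z).eq
    have hd0 : ∀ z, d (isDGAlgebra_genTaylor hF) (dpT hg 0 z) = 0 := fun z => by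
      rw [dpT_zero_left, d_one]
    have hl : ∀ a b, d (isDGAlgebra_genTaylor hF) (dpT hg a x * dpT hg b y) =
        d (isDGAlgebra_genTaylor hF) (dpT hg a x) * dpT hg b y +
          dpT hg a x * d (isDGAlgebra_genTaylor hF) (dpT hg b y) := fun a b =>
      leibniz_even (hp.mul_left a) (dpT_mem_part hg hp hp0 hx a) _
    rw [dpT_add, dpT_add, map_sum, map_add, mul_add]
    simp only [hl, Finset.sum_add_distrib]
    congr 1
    -- The term with x^{(0)} = 1 has zero differential; dropping it shifts the first index by one
    -- and leaves the expansion of (x+y)^{(i)} times ∂x.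
    · rw [Finset.Nat.sum_antidiagonal_succ, hd0, zero_mul, zero_add, Finset.sum_mul]
      refine Finset.sum_congr rfl fun ab _ => ?_
      rw [hdx, mul_assoc, mul_assoc, hc]
    · rw [Finset.Nat.sum_antidiagonal_succ', hd0, mul_zero, zero_add, Finset.sum_mul]
      refine Finset.sum_congr rfl fun ab _ => ?_
      rw [hdy, mul_assoc]

theorem isDP_dpT : IsDP (isDGAlgebra_genTaylor hF) (dpT hg) where
  zero _ x _ _ _ := dpT_zero_left hg x
  one _ x hx hp hp0 := dpT_one hg hp hp0 x hx
  mem_bi _ _ x hx hp hp0 i := dpT_mem_bi hg hp hp0 x hx i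
  mul _ x _ _ _ h i := dpT_mul hg h i x
  add _ x _ y _ _ _ i := by
    rw [dpT_add, Finset.Nat.sum_antidiagonal_eq_sum_range_succ_mk]
  mul_odd _ _ _ hx _ hy hp hq i hi := congrArg Subtype.val (triv_gamT_mul hg hp hq hx hy i hi)
  mul_even _ _ x hx y hy hp hq hq0 i _ := by
    rw [dpT, gamT_mul hg hp hq hq0 hx hy, toE_mem_mul hg (mem_evenPart hp hx)]
  comp _ x hx hp hp0 h i hh := dpT_comp hg hp hp0 x hx h i hh
  d_succ _ x hx hp hp0 i := dpT_d hg hp hp0 x hx i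

lemma dpT_iota (l : Fin r) {p : ℕ} (hp : Even p) (hp0 : 0 < p) {y : Deh (F l) (hF l)}
    (hy : y ∈ part (hF l) p) (i : ℕ) : dpT hg i (iota hF l y) = iota hF l (g l i y) := by
  rw [iota_apply, dpT_tn hg (p := Pi.single l p) (fun a => ?_) (j := l) (by simpa using hp0)
    (update_one_mem_part l hy), Function.update_self, update_pow, one_pow, Function.update_idem,
    iota_apply]
  by_cases ha : a = l
  · subst ha; simpa using hp
  · rw [Pi.single_eq_of_ne ha]; exact Even.zero

/-! #### Divided powers compatible with the inclusions -/

section Compatible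

variable {G : ℕ → Deh (genTaylor F) (isDGAlgebra_genTaylor hF) →
    Deh (genTaylor F) (isDGAlgebra_genTaylor hF)}

/-- The tensor is an even element times the included f_j, so the product rule and the prescribed
values on the inclusion leave no choice. -/
lemma IsDP.tn_even (hG : IsDP (isDGAlgebra_genTaylor hF) G)
    (hg : ∀ l, IsDP (hF l) (g l))
    (hGg : ∀ l p, Even p → 0 < p → ∀ y ∈ part (hF l) p, ∀ i,
      G i (iota hF l y) = iota hF l (g l i y))
    {p : Fin r → ℕ} {f : ∀ l, Deh (F l) (hF l)} (hf : ∀ l, f l ∈ part (hF l) (p l))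
    (hp : ∀ l, Even (p l)) {j : Fin r} (hj : 0 < p j) (i : ℕ) :
    G i (tn hF f) = tn hF (Function.update (f ^ i) j (g j i (f j))) := by
  rw [← rest_pow_mul_iota hf hp j i ((hg j).mem_part (hf j) (hp j) hj i),
    ← tn_eq_rest_mul_iota_even hf hp j,
    hG.mul_even' (tn_mem_part (update_mem_part hf j one_mem_part)) (iota_mem_part j (hf j))
      (Finset.even_sum _ fun l _ => even_update hp j Even.zero l) (hp j) hj,
    hGg j _ (hp j) hj _ (hf j)]

/-- Splitting off an odd slot from an even total degree writes the tensor as a product of two odd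
elements; the sign of the splitting is moved into the first one. -/
lemma IsDP.tn_odd (hG : IsDP (isDGAlgebra_genTaylor hF) G)
    {p : Fin r → ℕ} {f : ∀ l, Deh (F l) (hF l)} (hf : ∀ l, f l ∈ part (hF l) (p l))
    (hp : Even (∑ l, p l)) {a : Fin r} (ha : Odd (p a)) {i : ℕ} (hi : 2 ≤ i) :
    G i (tn hF f) = 0 := by
  have h := tn_eq_rest_mul_iota hf a
  set e := sgnM (Function.update p a 0) (Pi.single a (p a))
  have h1 : tn hF f =
      ((-1 : k) ^ e • tn hF (Function.update f a 1)) * iota hF a (f a) := by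
    rw [smul_mul_assoc, h, smul_smul, ← pow_add, Even.neg_one_pow ⟨e, rfl⟩, one_smul]
  have hodd : Odd (∑ l, Function.update p a 0 l) := by
    have h2 : ∑ l, p l = ∑ l, Function.update p a 0 l + p a := by
      rw [← Finset.add_sum_erase _ _ (Finset.mem_univ a),
        ← Finset.add_sum_erase _ (Function.update p a 0) (Finset.mem_univ a),
        Function.update_self, zero_add, add_comm]
      congr 1
      exact Finset.sum_congr rfl fun l hl => by
        rw [Function.update_of_ne (Finset.ne_of_mem_erase hl)]
    rw [h2, Nat.even_add'] at hp
    exact hp.2 ha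
  rw [h1]
  exact hG.mul_odd _ _ _ (Submodule.smul_mem _ _ (tn_mem_part (update_mem_part hf a one_mem_part)))
    _ (iota_mem_part a (hf a)) hodd ha i hi

lemma IsDP.eq_dpT (hG : IsDP (isDGAlgebra_genTaylor hF) G)
    (hg : ∀ l, IsDP (hF l) (g l))
    (hGg : ∀ l p, Even p → 0 < p → ∀ y ∈ part (hF l) p, ∀ i,
      G i (iota hF l y) = iota hF l (g l i y))
    {p : ℕ} (hp : Even p) (hp0 : 0 < p) :
    ∀ x ∈ part (isDGAlgebra_genTaylor hF) p, ∀ i, G i x = dpT hg i x := by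
  have hT := isDP_dpT hg
  refine part_induction (fun i => ?_) (fun c J hJ i => ?_) fun x y hx hy h h' i => ?_
  · rcases Nat.eq_zero_or_pos i with rfl | hi
    · rw [hG.zero p 0 (zero_mem _) hp hp0, hT.zero p 0 (zero_mem _) hp hp0]
    · rw [hG.map_zero hi, hT.map_zero hi]
  · have hJp : sg (isDGAlgebra_genTaylor hF) J ∈ part (isDGAlgebra_genTaylor hF) p :=
      sgT_mem_part_of_hdeg (hF := hF) hJ
    rw [hG.smul hJp hp hp0, hT.smul hJp hp hp0]
    congr 1
    rcases basis_cases hp hp0 J hJ with ⟨hev, j, hj⟩ | hodd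
    · rw [dpT_sg_even hg hev hj, ← tn_sg (hF := hF)]
      exact hG.tn_even hg hGg (sg_mem_part_pi (hF := hF) J) hev hj i
    · rcases Nat.lt_or_ge i 2 with hi | hi
      · interval_cases i
        · rw [hG.zero p _ hJp hp hp0, hT.zero p _ hJp hp hp0]
        · rw [hG.one p _ hJp hp hp0, hT.one p _ hJp hp hp0]
      · obtain ⟨a, ha⟩ := hodd.1
        rw [← tn_sg (hF := hF), hG.tn_odd (sg_mem_part_pi (hF := hF) J) hodd.2 ha hi,
          hT.tn_odd (sg_mem_part_pi (hF := hF) J) hodd.2 ha hi]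
  · rw [hG.add p x hx y hy hp hp0, hT.add p x hx y hy hp hp0]
    exact Finset.sum_congr rfl fun j _ => by rw [h, h']

end Compatible

end Deh

end GenTaylor

namespace GenTaylor

/-! ### Lifting to the generalized Taylor complex -/

namespace Deh

open DGData

/-- Ensures that the two sides of the formula for (f_1 * ⋯ * f_r)^{(i)} have exactly the same
multidegree, as the comparison over k demands. -/
lemma nsmul_sup_finsupp {n : ℕ} {ι : Type*} (s : Finset ι) (m : ι → (Fin n →₀ ℕ)) (i : ℕ) :
    (s.sup fun l => i • m l) = i • s.sup m := by
  refine (Finset.apply_sup_eq_sup_comp (fun m : Fin n →₀ ℕ => i • m) (fun x y => ?_) ?_).symm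
  · ext a
    simp [Nat.mul_max_mul_left]
  · exact smul_zero i

/-! ### The inclusions of the factors over the polynomial ring -/

section Incl

variable {k : Type v} [Field k] {n r : ℕ} {F : Fin r → DGData.{u, v} k n}

lemma exists_bihom_d_basisElt {A : DGData.{u, v} k n} (hA : A.IsDGAlgebra) (b : A.B) :
    ∃ p, A.Bihom p (A.mdeg b) (A.d (A.basisElt b)) := by
  have h := bihom_basisElt b
  rcases hb : A.hdeg b with _ | p
  · refine ⟨0, ?_⟩
    rw [hb] at h
    rw [hA.d_zero _ h.mem_part]
    exact bihom_zero _ _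
  · rw [hb] at h
    exact ⟨p, hA.d_bihom _ _ _ h⟩

lemma incl_basisElt (l : Fin r) (b : (F l).B) : incl F l ((F l).basisElt b) =
    star F (Pi.single l ((F l).mdeg b))
      (Function.update (fun l => (F l).one) l ((F l).basisElt b)) := by
  rw [incl, basisElt, Finsupp.linearCombination_single, one_smul]
  rfl

lemma of_incl (hF : ∀ l, (F l).IsDGAlgebra) (l : Fin r) (x : (F l).Carrier) :
    of (isDGAlgebra_genTaylor hF) (incl F l x) = iota hF l (of (hF l) x) := by
  refine carrier_induction (P := fun x => of (isDGAlgebra_genTaylor hF) (incl F l x) =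
    iota hF l (of (hF l) x)) (by simp) (fun b => ?_) (fun c x h => ?_) (fun x y h h' => ?_) x
  · rw [incl_basisElt, of_star (hF := hF), iota_apply]
    congr 1
    ext1 a
    by_cases ha : a = l
    · subst ha; simp
    · rw [Function.update_of_ne ha, Function.update_of_ne ha]
      rfl
  · rw [map_smul, of_smul, of_smul, h, map_smul]
  · rw [map_add, map_add, map_add, map_add, h, h']

lemma bihom_incl_basisElt (hF : ∀ l, (F l).IsDGAlgebra) (l : Fin r) (b : (F l).B) :
    (genTaylor F).Bihom ((F l).hdeg b) ((F l).mdeg b) (incl F l ((F l).basisElt b)) := by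
  rw [incl_basisElt]
  have h : ∀ a, (F a).Bihom ((Pi.single l ((F l).hdeg b) : Fin r → ℕ) a)
      ((Pi.single l ((F l).mdeg b) : Fin r → (Fin n →₀ ℕ)) a)
      (Function.update (fun l => (F l).one) l ((F l).basisElt b) a) := by
    intro a
    by_cases ha : a = l
    · subst ha
      simpa using bihom_basisElt b
    · rw [Pi.single_eq_of_ne ha, Pi.single_eq_of_ne ha, Function.update_of_ne ha]
      exact (hF a).one_bihom
  have h1 := bihom_star h
  have h2 : Finset.univ.sup (Pi.single l ((F l).mdeg b) : Fin r → (Fin n →₀ ℕ)) =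
      (F l).mdeg b := by
    refine le_antisymm (Finset.sup_le fun a _ => ?_) ?_
    · by_cases ha : a = l
      · subst ha; simp
      · rw [Pi.single_eq_of_ne ha]
        exact zero_le
    · have := Finset.le_sup (f := (Pi.single l ((F l).mdeg b) : Fin r → (Fin n →₀ ℕ)))
        (Finset.mem_univ l)
      rwa [Pi.single_eq_same] at this
  rwa [h2, Finset.sum_pi_single' l _ Finset.univ, if_pos (Finset.mem_univ l)] at h1

lemma bihom_incl (hF : ∀ l, (F l).IsDGAlgebra) (l : Fin r) {p : ℕ} {m : Fin n →₀ ℕ}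
    {x : (F l).Carrier} (hx : (F l).Bihom p m x) : (genTaylor F).Bihom p m (incl F l x) := by
  have := bihom_map_of_basisElt (φ := incl F l) (q := p) (δ := 0) (fun b hb => ?_) hx
  · rwa [add_zero] at this
  · rw [add_zero, ← hb]
    exact bihom_incl_basisElt hF l b

lemma incl_d (hF : ∀ l, (F l).IsDGAlgebra) (l : Fin r) (x : (F l).Carrier) :
    incl F l ((F l).d x) = (genTaylor F).d (incl F l x) := by
  have hT := isDGAlgebra_genTaylor hF
  refine carrier_induction (P := fun x => incl F l ((F l).d x) = (genTaylor F).d (incl F l x))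
    (by simp) (fun b => ?_) (fun c x h => ?_) (fun x y h h' => ?_) x
  · obtain ⟨p, h⟩ := exists_bihom_d_basisElt (hF l) b
    have h1 := bihom_incl_basisElt hF l b
    have h2 : ∃ q, (genTaylor F).Bihom q ((F l).mdeg b)
        ((genTaylor F).d (incl F l ((F l).basisElt b))) := by
      rcases hb : (F l).hdeg b with _ | q
      · refine ⟨0, ?_⟩
        rw [hb] at h1
        rw [hT.d_zero _ h1.mem_part]
        exact bihom_zero _ _
      · rw [hb] at h1
        exact ⟨q, hT.d_bihom _ _ _ h1⟩
    obtain ⟨q, h2⟩ := h2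
    refine eq_of_bihom hT (bihom_incl hF l h) h2 ?_
    rw [of_incl hF, of_d, iota_d, of_d, of_incl hF]
  · rw [map_smul, map_smul, map_smul, map_smul, h]
  · rw [map_add, map_add, map_add, map_add, h, h']

lemma incl_one (hF : ∀ l, (F l).IsDGAlgebra) (l : Fin r) :
    incl F l (F l).one = (genTaylor F).one := by
  have hT := isDGAlgebra_genTaylor hF
  refine eq_of_bihom hT (bihom_incl hF l (hF l).one_bihom) hT.one_bihom ?_
  rw [of_incl hF, of_one, of_one, map_one]

lemma incl_mul (hF : ∀ l, (F l).IsDGAlgebra) (l : Fin r) (x y : (F l).Carrier) :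
    incl F l ((F l).mul x y) = (genTaylor F).mul (incl F l x) (incl F l y) := by
  have hT := isDGAlgebra_genTaylor hF
  refine carrier_induction (P := fun x => incl F l ((F l).mul x y) =
    (genTaylor F).mul (incl F l x) (incl F l y)) (by simp) (fun b => ?_) (fun c x h => ?_)
    (fun x x' h h' => ?_) x
  · refine carrier_induction (P := fun y => incl F l ((F l).mul ((F l).basisElt b) y) =
      (genTaylor F).mul (incl F l ((F l).basisElt b)) (incl F l y)) (by simp) (fun b' => ?_)
      (fun c x h => ?_) (fun x x' h h' => ?_) y
    · refine eq_of_bihom hT (bihom_incl hF l ((hF l).mul_bihom _ _ _ _ _ _ (bihom_basisElt b)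
        (bihom_basisElt b'))) (hT.mul_bihom _ _ _ _ _ _ (bihom_incl_basisElt hF l b)
        (bihom_incl_basisElt hF l b')) ?_
      rw [of_incl hF, of_mul, of_mul, map_mul, of_incl hF, of_incl hF]
    · rw [map_smul, map_smul, map_smul, map_smul, h]
    · rw [map_add, map_add, map_add, map_add, h, h']
  · rw [map_smul, LinearMap.smul_apply, map_smul, map_smul, map_smul, LinearMap.smul_apply, h]
  · rw [map_add, LinearMap.add_apply, map_add, map_add, map_add, LinearMap.add_apply, h, h']

end Incl

/-! ### Divided powers on the generalized Taylor resolution: formulas, inclusions and uniqueness -/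

section Main

variable {k : Type v} [Field k] {n r : ℕ} {F : Fin r → DGData.{u, v} k n}
  {γ : ∀ l, ℕ → (F l).Carrier → (F l).Carrier}

lemma isDGAlgebra_of_gamma (hF : ∀ l, (F l).IsDGGammaAlgebra (γ l)) (l : Fin r) :
    (F l).IsDGAlgebra := (hF l).isDGAlgebra

variable (hF : ∀ l, (F l).IsDGGammaAlgebra (γ l))

lemma isDP_dpOf_of_gamma (l : Fin r) :
    IsDP (isDGAlgebra_of_gamma hF l) (dpOf (isDGAlgebra_of_gamma hF l) (γ l)) :=
  isDP_dpOf (hF l).isDividedPowers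

/-- The divided powers on the generalized Taylor resolution. -/
def starDP (i : ℕ) : (genTaylor F).Carrier → (genTaylor F).Carrier :=
  dpLift (isDGAlgebra_genTaylor (isDGAlgebra_of_gamma hF)) (dpT (isDP_dpOf_of_gamma hF)) i

theorem isDGGammaAlgebra_genTaylor : (genTaylor F).IsDGGammaAlgebra (starDP hF) :=
  ⟨isDGAlgebra_genTaylor (isDGAlgebra_of_gamma hF),
    isDividedPowers_dpLift (isDP_dpT (isDP_dpOf_of_gamma hF))⟩

lemma of_starDP (i : ℕ) (x : (genTaylor F).Carrier) :
    of (isDGAlgebra_genTaylor (isDGAlgebra_of_gamma hF)) (starDP hF i x) =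
      dpT (isDP_dpOf_of_gamma hF) i (of (isDGAlgebra_genTaylor (isDGAlgebra_of_gamma hF)) x) :=
  of_dpLift _ i x

lemma starDP_star_odd {p : Fin r → ℕ} {m : Fin r → (Fin n →₀ ℕ)} {f : ∀ l, (F l).Carrier}
    (hf : ∀ l, (F l).Bihom (p l) (m l) (f l)) (hp : Even (∑ l, p l)) (hp0 : 0 < ∑ l, p l)
    {a : Fin r} (ha : Odd (p a)) {i : ℕ} (hi : 2 ≤ i) : starDP hF i (star F m f) = 0 := by
  refine eq_of_bihom (isDGAlgebra_genTaylor (isDGAlgebra_of_gamma hF))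
    ((isDGGammaAlgebra_genTaylor hF).isDividedPowers.bihom _ _ _ (bihom_star hf) hp hp0 i)
    (bihom_zero 0 _) ?_
  rw [of_starDP, of_star (hF := isDGAlgebra_of_gamma hF), map_zero]
  exact (isDP_dpT (isDP_dpOf_of_gamma hF)).tn_odd (fun l => of_mem_part (hf l).mem_part) hp ha hi

lemma starDP_star_even {p : Fin r → ℕ} {m : Fin r → (Fin n →₀ ℕ)} {f : ∀ l, (F l).Carrier}
    (hf : ∀ l, (F l).Bihom (p l) (m l) (f l)) (hp : ∀ l, Even (p l)) {j : Fin r} (hj : 0 < p j)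
    (i : ℕ) : starDP hF i (star F m f) =
      star F (fun l => i • m l)
        (Function.update (fun l => (F l).pow (f l) i) j (γ j i (f j))) := by
  have hp0 : 0 < ∑ l, p l := hj.trans_le
    (Finset.single_le_sum (f := p) (fun _ _ => Nat.zero_le _) (Finset.mem_univ j))
  have h1 : ∀ l, (F l).Bihom (i * p l) (i • m l)
      (Function.update (fun l => (F l).pow (f l) i) j (γ j i (f j)) l) := by
    intro l
    by_cases hl : l = j
    · subst hl
      rw [Function.update_self]
      exact (hF l).isDividedPowers.bihom _ _ _ (hf l) (hp l) hj i
    · rw [Function.update_of_ne hl]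
      exact bihom_pow (hF l).isDGAlgebra (hf l) i
  have h2 := bihom_star h1
  rw [nsmul_sup_finsupp] at h2
  refine eq_of_bihom (isDGAlgebra_genTaylor (isDGAlgebra_of_gamma hF))
    ((isDGGammaAlgebra_genTaylor hF).isDividedPowers.bihom _ _ _ (bihom_star hf)
      (Finset.even_sum _ fun l _ => hp l) hp0 i) h2 ?_
  rw [of_starDP, of_star (hF := isDGAlgebra_of_gamma hF),
    of_star (hF := isDGAlgebra_of_gamma hF), dpT_tn (isDP_dpOf_of_gamma hF) hp hj
    (fun l => of_mem_part (hf l).mem_part)]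
  congr 1
  ext1 l
  by_cases hl : l = j
  · subst hl
    rw [Function.update_self, Function.update_self,
      dpOf_of (hF l).isDividedPowers (hf l) (hp l) hj]
  · rw [Function.update_of_ne hl, Function.update_of_ne hl, of_pow]
    rfl

theorem isDGGammaHom_incl (l : Fin r) :
    IsDGGammaHom (F l) (genTaylor F) (γ l) (starDP hF) (incl F l) where
  bihom _ _ _ hx := bihom_incl (isDGAlgebra_of_gamma hF) l hx
  d := incl_d (isDGAlgebra_of_gamma hF) l
  one := incl_one (isDGAlgebra_of_gamma hF) l
  mul := incl_mul (isDGAlgebra_of_gamma hF) l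
  dp p m x hx hp hp0 i := by
    have hx' := bihom_incl (isDGAlgebra_of_gamma hF) l hx
    refine eq_of_bihom (isDGAlgebra_genTaylor (isDGAlgebra_of_gamma hF))
      (bihom_incl (isDGAlgebra_of_gamma hF) l ((hF l).isDividedPowers.bihom _ _ _ hx hp hp0 i))
      ((isDGGammaAlgebra_genTaylor hF).isDividedPowers.bihom _ _ _ hx' hp hp0 i) ?_
    rw [of_starDP, of_incl (isDGAlgebra_of_gamma hF), of_incl (isDGAlgebra_of_gamma hF),
      dpT_iota (isDP_dpOf_of_gamma hF) l hp hp0 (of_mem_part hx.mem_part),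
      dpOf_of (hF l).isDividedPowers hx hp hp0]

/-- The specialization of `Γ'` is again compatible with the inclusions, so uniqueness over k
applies; both values have multidegree i • m, so equality over k gives equality over R. -/
theorem eq_starDP {Γ' : ℕ → (genTaylor F).Carrier → (genTaylor F).Carrier}
    (hΓ : (genTaylor F).IsDividedPowers Γ')
    (hincl : ∀ l p m x, (F l).Bihom p m x → Even p → 0 < p →
      ∀ i, incl F l (γ l i x) = Γ' i (incl F l x))
    {p : ℕ} {m : Fin n →₀ ℕ} {x : (genTaylor F).Carrier} (hx : (genTaylor F).Bihom p m x)
    (hp : Even p) (hp0 : 0 < p) (i : ℕ) : Γ' i x = starDP hF i x := by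
  refine eq_of_bihom (isDGAlgebra_genTaylor (isDGAlgebra_of_gamma hF))
    (hΓ.bihom _ _ _ hx hp hp0 i)
    ((isDGGammaAlgebra_genTaylor hF).isDividedPowers.bihom _ _ _ hx hp hp0 i) ?_
  rw [of_starDP, ← dpOf_of hΓ hx hp hp0]
  refine (isDP_dpOf hΓ).eq_dpT (isDP_dpOf_of_gamma hF) (fun l q hq hq0 y hy i => ?_) hp hp0 _
    (of_mem_part hx.mem_part) i
  obtain ⟨m', y, hy', rfl⟩ := exists_bihom hy
  rw [dpOf_of (hF l).isDividedPowers hy' hq hq0, ← of_incl (isDGAlgebra_of_gamma hF),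
    ← of_incl (isDGAlgebra_of_gamma hF),
    dpOf_of hΓ (bihom_incl (isDGAlgebra_of_gamma hF) l hy') hq hq0, hincl l q m' y hy' hq hq0]

end Main

end Deh

end GenTaylor

end

theorem mainTheorem1 {k : Type v} [Field k] {n r : ℕ}
    (I : Fin r → Ideal (GenTaylor.Poly k n))
    (hI : ∀ i, GenTaylor.IsMonomialIdeal (I i))
    (F : Fin r → GenTaylor.DGData.{u, v} k n)
    (γ : ∀ i, ℕ → (F i).Carrier → (F i).Carrier)
    (hF : ∀ i, (F i).IsDGGammaAlgebra (γ i))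
    (hres : ∀ i, (F i).IsResolution (I i)) :
    ∃ Γ : ℕ → (GenTaylor.genTaylor F).Carrier → (GenTaylor.genTaylor F).Carrier,
      (GenTaylor.genTaylor F).IsDGGammaAlgebra Γ ∧
      (∀ (p : Fin r → ℕ) (m : Fin r → (Fin n →₀ ℕ)) (f : ∀ l, (F l).Carrier),
        (∀ l, (F l).Bihom (p l) (m l) (f l)) → Even (∑ l, p l) → 0 < ∑ l, p l →
          ((∃ l, Odd (p l)) → ∀ i, 2 ≤ i → Γ i (GenTaylor.star F m f) = 0) ∧
          ((∀ l, Even (p l)) → ∀ j, 0 < p j → (∀ l, l < j → p l = 0) →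
            ∀ i, Γ i (GenTaylor.star F m f) =
              GenTaylor.star F (fun l => i • m l)
                (Function.update (fun l => (F l).pow (f l) i) j (γ j i (f j))))) ∧
      (∀ l, GenTaylor.DGData.IsDGGammaHom (F l) (GenTaylor.genTaylor F) (γ l) Γ
        (GenTaylor.incl F l)) ∧
      (∀ Γ' : ℕ → (GenTaylor.genTaylor F).Carrier → (GenTaylor.genTaylor F).Carrier,
        (GenTaylor.genTaylor F).IsDGGammaAlgebra Γ' →
        (∀ l, GenTaylor.DGData.IsDGGammaHom (F l) (GenTaylor.genTaylor F) (γ l) Γ'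
          (GenTaylor.incl F l)) →
        ∀ p m x, (GenTaylor.genTaylor F).Bihom p m x → Even p → 0 < p →
          ∀ i, Γ' i x = Γ i x) := by
  refine ⟨GenTaylor.Deh.starDP hF, GenTaylor.Deh.isDGGammaAlgebra_genTaylor hF, ?_,
    GenTaylor.Deh.isDGGammaHom_incl hF, ?_⟩
  · intro p m f hf hp hp0
    refine ⟨?_, fun hev j hj _ i => GenTaylor.Deh.starDP_star_even hF hf hev hj i⟩
    rintro ⟨a, ha⟩ i hi
    exact GenTaylor.Deh.starDP_star_odd hF hf hp hp0 ha hi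
  · intro Γ' hΓ hincl p m x hx hp hp0 i
    exact GenTaylor.Deh.eq_starDP hF hΓ.isDividedPowers (fun l => (hincl l).dp) hx hp hp0 i
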